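/- Let $f:[0,1]\to\mathbb{R}^2$ be a simple closed curve ($f$ is continuous, $f(0)=f(1)$, and $f$ is injective on $[0,1)$) that is differentiable with constant non-zero speed, and put $\Gamma_f=f([0,1])$. Let the thickness $\Delta(f)$ be the infimum of the radii of the circles through three distinct points of $\Gamma_f$ (the radius is $\infty$ for collinear points), and let $0<\sigma<\Delta(f)$. Let $H$ be a distribution on $[0,1]$ with a density $h$ satisfying $0<c_1\le h\le c_2<\infty$. Let $F$ be a distribution on $\mathbb{R}^2$ with a bounded density $\phi$ that vanishes for $\|x\|>\sigma$, is continuous and positive for $\|x\|<\sigma$, depends only on $\|x\|$ and is nonincreasing in $\|x\|$, and satisfies $\phi(x)\sim c(\sigma-\|x\|)^\beta$ as $\|x\|\uparrow\sigma$, for some $c>0$ and some $\beta\in[0,\infty)$. Observe $Y_i=f(U_i)+\epsilon_i$, $i=1,\dots,n$, where $U_i\sim H$ and $\epsilon_i\sim F$ are all independent. Put $$\alpha=\beta+\tfrac12,\qquad r_n=\Bigl(\frac{\log n}{n}\Bigr)^{1/(2+\alpha)},\qquad \hat S=\bigcup_{i=1}^n B(Y_i,\varepsilon_n),\qquad \varepsilon_n=C\,r_n,$$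 where $B(x,\rho)$ is the closed disc. Suppose that $\partial\hat S$ is the disjoint union of two simple closed curves $\hat{\partial S}_0$ and $\hat{\partial S}_1$ (labelled in either order), and let $g:[0,1]\to\mathbb{R}^2$ be a parametrization of $\hat{\partial S}_0$ as a simple closed curve. For $y\in\hat{\partial S}_0$ let $\hat\mu(y)$ be the midpoint of the segment from $y$ to a closest point of $\hat{\partial S}_1$ (with any choice among ties), and let $\hat f(u)=\hat\mu(g(u))$ be the fitted curve of the medial estimator. When $\hat f$ is piecewise continuous, i.e. there are $0=a_0<\dots<a_N=1$ such that $\hat f$ is continuous on each $(a_j,a_{j+1})$ with one-sided limits at both ends of that interval, let $f^*$ be the curve that runs through the pieces of $\hat f$ in order and joins $\hat f(a_j^-)$ to $\hat f(a_j^+)$ by a line segment at every jump; the parameters $0$ and $1$ are identified, so that $\hat f(1^-)$ is joined to $\hat f(0^+)$. Let $\Gamma_{f^*}=f^*([0,1])$. **Theorem.** There is a constant $C_0>0$ such that the following holds for every $C\ge C_0$. With probability one, for all sufficiently large $n$, $\partial\hat S$ is the disjoint union of two simple closed curves, and, whatever the labelling, the parametrization and the choice among ties, $\hat f$ is piecewise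 continuous and $f^*$ is a simple closed curve. Furthermore, uniformly over these choices, $$d_H(\Gamma_{f^*},\Gamma_f)=O_P(r_n),$$ where $d_H$ is the Hausdorff distance. -/

import Mathlib

open Set Filter Topology MeasureTheory ProbabilityTheory
open scoped ENNReal

namespace Filament

/-- The Euclidean plane. -/
abbrev Plane : Type := EuclideanSpace ℝ (Fin 2)

/-! ### Curves and thickness -/

/-- The trace of a curve `γ : [0,1] → ℝ²`. -/
def trace (γ : ℝ → Plane) : Set Plane := γ '' Icc 0 1

/-- A simple closed curve parametrized by `[0,1]`. -/
structure IsSimpleClosedCurve (γ : ℝ → Plane) : Prop where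
  continuousOn : ContinuousOn γ (Icc 0 1)
  closed : γ 0 = γ 1
  injOn : InjOn γ (Ico 0 1)

/-- The curve is differentiable on `[0,1]` (one-sidedly at the end points) with constant non-zero
speed, that is, it is parametrized by arclength, normalized to `[0,1]`. -/
def IsArclengthParametrized (γ : ℝ → Plane) : Prop :=
  ∃ ℓ : ℝ, 0 < ℓ ∧ ∀ u ∈ Icc (0 : ℝ) 1, ∃ γ' : Plane,
    HasDerivWithinAt γ γ' (Icc 0 1) u ∧ ‖γ'‖ = ℓ

/-- The radius of the circle through three distinct points of the plane; it is `∞` when the points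
are collinear (no centre `c` qualifies). -/
noncomputable def circleRadius (x y z : Plane) : ℝ≥0∞ :=
  ⨅ (c : Plane) (_ : dist x c = dist y c ∧ dist y c = dist z c), edist x c

/-- The thickness (minimum global radius of curvature) of a set of points. -/
noncomputable def thickness (Γ : Set Plane) : ℝ≥0∞ :=
  ⨅ (x ∈ Γ) (y ∈ Γ) (z ∈ Γ) (_ : x ≠ y ∧ y ≠ z ∧ x ≠ z), circleRadius x y z

/-! ### The model -/

/-- `h` is a density on `[0,1]` that is bounded and bounded away from zero. -/
structure IsDesignDensity (h : ℝ → ℝ) : Prop where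
  measurable : Measurable h
  bounds : ∃ c₁ c₂ : ℝ, 0 < c₁ ∧ ∀ u ∈ Icc (0 : ℝ) 1, c₁ ≤ h u ∧ h u ≤ c₂

/-- The distribution on `[0,1]` with density `h`. -/
noncomputable def designLaw (h : ℝ → ℝ) : Measure ℝ :=
  (volume.restrict (Icc (0 : ℝ) 1)).withDensity fun u => ENNReal.ofReal (h u)

/-- The conditions on the noise density `φ`: it vanishes off the closed disc of radius `σ`, is
bounded, continuous and positive on the open disc (so that the uniform density is
included), is a nonincreasing function of the norm, and decays like `(σ - ‖x‖) ^ β` at the edge. -/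
structure IsNoiseDensity (σ β : ℝ) (φ : Plane → ℝ) : Prop where
  measurable : Measurable φ
  nonneg : ∀ x, 0 ≤ φ x
  bounded : ∃ M : ℝ, ∀ x, φ x ≤ M
  eq_zero : ∀ x, σ < ‖x‖ → φ x = 0
  pos : ∀ x, ‖x‖ < σ → 0 < φ x
  continuousOn : ContinuousOn φ (Metric.ball 0 σ)
  nonincreasing : ∀ x y, ‖x‖ ≤ ‖y‖ → φ y ≤ φ x
  symmetric : ∀ x y, ‖x‖ = ‖y‖ → φ x = φ y
  edge : ∃ C : ℝ, 0 < C ∧ Asymptotics.IsEquivalent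
    (comap (fun x : Plane => ‖x‖) (𝓝[<] σ)) φ (fun x => C * (σ - ‖x‖) ^ β)

/-- The distribution on the plane with density `φ`. -/
noncomputable def noiseLaw (φ : Plane → ℝ) : Measure Plane :=
  volume.withDensity fun x => ENNReal.ofReal (φ x)

/-- The observations `Yᵢ = f(Uᵢ) + εᵢ`. -/
def observation {Ω : Type*} (f : ℝ → Plane) (U : ℕ → Ω → ℝ) (ε : ℕ → Ω → Plane)
    (i : ℕ) (ω : Ω) : Plane :=
  f (U i ω) + ε i ω

/-- The rate `(log n / n) ^ (1 / (2 + α))` with `α = β + 1/2`. -/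
noncomputable def rate (β : ℝ) (n : ℕ) : ℝ :=
  (Real.log n / n) ^ (1 / (2 + (β + 1 / 2)))

/-- The union-of-balls estimator with radius `ρ` from the first `n` points. -/
def unionOfBalls (y : ℕ → Plane) (n : ℕ) (ρ : ℝ) : Set Plane :=
  ⋃ i ∈ Finset.range n, Metric.closedBall (y i) ρ

/-! ### The medial estimator and its completion -/

/-- The boundary of `S` consists of two disjoint simple closed curves, parametrized by `g₀` and
`g₁` (in either order). -/
structure IsBoundaryPair (S : Set Plane) (g₀ g₁ : ℝ → Plane) : Prop where
  simple₀ : IsSimpleClosedCurve g₀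
  simple₁ : IsSimpleClosedCurve g₁
  disjoint : Disjoint (trace g₀) (trace g₁)
  union : trace g₀ ∪ trace g₁ = frontier S

/-- `p` assigns to each point of `A` a closest point of `B`. -/
def IsClosestPointMap (A B : Set Plane) (p : Plane → Plane) : Prop :=
  ∀ y ∈ A, p y ∈ B ∧ ∀ z ∈ B, dist y (p y) ≤ dist y z

/-- `F` is a fitted curve of the medial estimator for the support estimate `S`: `F u` is the
midpoint of the segment from `g₀ u` to a closest point on the other boundary curve. -/
def IsMedialFit (S : Set Plane) (F : ℝ → Plane) : Prop :=
  ∃ (g₀ g₁ : ℝ → Plane) (p : Plane → Plane), IsBoundaryPair S g₀ g₁ ∧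
    IsClosestPointMap (trace g₀) (trace g₁) p ∧
    F = fun u => midpoint ℝ (g₀ u) (p (g₀ u))

/-- `F` is continuous on each open piece `(aⱼ, aⱼ₊₁)` of a partition `0 = a₀ < ⋯ < a_N = 1`, with
right limit `r j` at `aⱼ` and left limit `l (j + 1)` at `aⱼ₊₁`. The end points `0` and `1` of the
parameter interval are identified, so `r N = r 0`. -/
structure IsPiecewiseContinuousWith (F : ℝ → Plane) (N : ℕ) (a : ℕ → ℝ) (l r : ℕ → Plane) :
    Prop where
  pos : 0 < N
  first : a 0 = 0
  last : a N = 1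
  lt : ∀ j < N, a j < a (j + 1)
  continuousOn : ∀ j < N, ContinuousOn F (Ioo (a j) (a (j + 1)))
  right : ∀ j < N, Tendsto F (𝓝[>] a j) (𝓝 (r j))
  left : ∀ j < N, Tendsto F (𝓝[<] a (j + 1)) (𝓝 (l (j + 1)))
  wrap : r N = r 0

/-- `F` is piecewise continuous on `[0,1]` (finitely many pieces, with one-sided limits). -/
def IsPiecewiseContinuous (F : ℝ → Plane) : Prop :=
  ∃ (N : ℕ) (a : ℕ → ℝ) (l r : ℕ → Plane), IsPiecewiseContinuousWith F N a l r

/-- `G` is the curve obtained from the piecewise continuous `F` by joining the one-sided limits at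
every jump by a line segment. The `j`-th piece of `F` is run (affinely) during the time interval
`[s j, t j]` and the segment from `l (j + 1)` to `r (j + 1)` during `[t j, s (j + 1)]`; the latter
interval is a single instant exactly when there is no jump. The last segment joins the left limit
at `1` to the right limit at `0`. -/
def IsCompletion (F G : ℝ → Plane) : Prop :=
  ∃ (N : ℕ) (a : ℕ → ℝ) (l r : ℕ → Plane) (s t : ℕ → ℝ),
    IsPiecewiseContinuousWith F N a l r ∧
    s 0 = 0 ∧ s N = 1 ∧
    (∀ j < N, s j < t j ∧ t j ≤ s (j + 1) ∧ (t j = s (j + 1) ↔ l (j + 1) = r (j + 1))) ∧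
    G 0 = r 0 ∧
    (∀ j < N, ∀ x ∈ Ioo (0 : ℝ) 1, G (AffineMap.lineMap (s j) (t j) x) =
      F (AffineMap.lineMap (a j) (a (j + 1)) x)) ∧
    (∀ j < N, ∀ x ∈ Icc (0 : ℝ) 1, G (AffineMap.lineMap (t j) (s (j + 1)) x) =
      AffineMap.lineMap (l (j + 1)) (r (j + 1)) x)

/-- The completed medial estimators (one for each labelling and parametrization of the two boundary
curves, each choice among tied closest points, and each time scale). -/
def completedMedialEstimators (S : Set Plane) : Set (ℝ → Plane) :=
  {G | ∃ F, IsMedialFit S F ∧ IsCompletion F G}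

/-- `X n = O_P(r n)`. (`P` of a set that is not measurable is its outer measure.) -/
def IsBigOP {Ω : Type*} [MeasurableSpace Ω] (P : Measure Ω) (X : ℕ → Ω → ℝ≥0∞) (r : ℕ → ℝ) :
    Prop :=
  ∀ η : ℝ, 0 < η → ∃ K : ℝ, 0 < K ∧
    ∀ᶠ n in atTop, P {ω | ENNReal.ofReal (K * r n) < X n ω} ≤ ENNReal.ofReal η

end Filament

/-! Fix `τ` strictly between `σ` and the thickness. Letting two points of a circumscribed circle
merge turns the thickness bound into a disc condition: the curve avoids both open discs of radius
`τ` tangent to it at any of its points (`exists_unitTangent`). Hence the tangent is continuous and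
the closed curve has no cusp at its base point, so the curve extends to a periodic frame. Normal
coordinates `(s, t)` are then injective up to periodicity for `|t| < τ`.

Probability enters only once. A disc of radius `δ` centred in the `σ`-tube receives an observation
with probability at least a constant times `δ ^ (2 + α)`. The noise contributes `δ ^ (2 + β)`, and
the additional half power is the length of the parameter interval on which the noise bound applies
(`exists_prob_closedBall_ge`). A union bound over a net then shows that, outside an event of
probability `O(n⁻²)`, the observations are an `ε / 2`-net of the tube, with `ε = C * rate β n`
(`exists_prob_uncovered_le`). Summability and Borel–Cantelli give the almost sure statement, and the
same bound gives the `O_P` statement.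

Everything else is deterministic, for a `Sample`. Moving inward along a normal strictly decreases
the distance to the sample at the relevant heights (`Sample.infDist_lt_of_lt`), so on each side the
boundary of the union of balls is a continuous graph over the curve. By connectedness these two
graphs are the only possible pair of boundary curves, up to order.

A closest point on the opposite boundary curve lies on two of the circles
(`Sample.mem_cocircle_of_isNearest`), because an arc of a single circle bulges towards the outside
and cannot be nearest to a point across the tube. So there are finitely many candidates and finitely
many tie points, whence piecewise continuity. Simplicity rests on monotonicity of closest points,
`⟪y - y', v - v'⟫ ≥ 0`: it gives `‖y - y'‖ ≤ 2 * ‖m - m'‖` for points `m`, `m'` of the completed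
curve lying over `y`, `y'`, jump segments included (`norm_sub_le_of_isOver`).

For the Hausdorff distance, the segment from `y` to its closest point has length at most `2 * σ + 2
* ε` and must cross the curve, so its midpoint is within `ε` of the curve. A jump segment is close
to a chord of length `O(√ε)`, whose deviation from the curve is `O(ε)` by thickness. Conversely, a
connectedness argument finds a point of the completed curve on each normal line, within `O(√ε)` of
the foot; the disc condition improves this to `O(ε)` (`Sample.hausdorffEDist_le_of_selection`). -/

namespace Filament

/-! ### Plane geometry -/

/-- Rotation of the plane by a right angle. -/
def perp (v : Plane) : Plane := !₂[-v 1, v 0]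

@[simp] lemma perp_apply_zero (v : Plane) : perp v 0 = -v 1 := rfl
@[simp] lemma perp_apply_one (v : Plane) : perp v 1 = v 0 := rfl

lemma inner_eq (x y : Plane) : inner ℝ x y = x 0 * y 0 + x 1 * y 1 := by
  simp [PiLp.inner_apply, Fin.sum_univ_two, mul_comm]

lemma norm_sq_eq (x : Plane) : ‖x‖ ^ 2 = x 0 ^ 2 + x 1 ^ 2 := by
  rw [EuclideanSpace.real_norm_sq_eq, Fin.sum_univ_two]

lemma plane_ext {x y : Plane} (h0 : x 0 = y 0) (h1 : x 1 = y 1) : x = y := by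
  ext i; fin_cases i <;> assumption

@[simp] lemma norm_perp (v : Plane) : ‖perp v‖ = ‖v‖ := by
  have h : ‖perp v‖ ^ 2 = ‖v‖ ^ 2 := by rw [norm_sq_eq, norm_sq_eq]; simp; ring
  exact (sq_eq_sq₀ (norm_nonneg _) (norm_nonneg _)).1 h

lemma inner_perp_self (v : Plane) : inner ℝ (perp v) v = 0 := by
  rw [inner_eq]; simp; ring

lemma perp_sub (v w : Plane) : perp (v - w) = perp v - perp w := by
  apply plane_ext <;> simp; ring

lemma perp_smul (c : ℝ) (v : Plane) : perp (c • v) = c • perp v := by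
  apply plane_ext <;> simp

lemma perp_neg (v : Plane) : perp (-v) = -perp v := by
  apply plane_ext <;> simp

lemma continuous_perp : Continuous perp := by
  unfold perp
  refine (PiLp.continuous_toLp 2 _).comp (continuous_pi fun i => ?_)
  fin_cases i <;> simp <;> fun_prop

lemma inner_sq_add_inner_perp_sq {T : Plane} (hT : ‖T‖ = 1) (v : Plane) :
    inner ℝ T v ^ 2 + inner ℝ (perp T) v ^ 2 = ‖v‖ ^ 2 := by
  have h : T 0 ^ 2 + T 1 ^ 2 = 1 := by rw [← norm_sq_eq, hT]; norm_num
  rw [inner_eq, inner_eq, norm_sq_eq]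
  simp only [perp_apply_zero, perp_apply_one]
  linear_combination (v 0 ^ 2 + v 1 ^ 2) * h

lemma eq_inner_smul_add {T : Plane} (hT : ‖T‖ = 1) (v : Plane) :
    v = inner ℝ T v • T + inner ℝ (perp T) v • perp T := by
  have h : T 0 ^ 2 + T 1 ^ 2 = 1 := by rw [← norm_sq_eq, hT]; norm_num
  rw [inner_eq, inner_eq]
  apply plane_ext
  · simp; linear_combination (-v 0) * h
  · simp; linear_combination (-v 1) * h

/-- The circumradius formula `R = abc / (4 · area)`. -/
lemma thickness_le_circumradius {Γ : Set Plane} {τ : ℝ}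
    (hΓ : ENNReal.ofReal τ ≤ thickness Γ) {x y z : Plane} (hx : x ∈ Γ) (hy : y ∈ Γ) (hz : z ∈ Γ) :
    2 * τ * |inner ℝ (perp (y - x)) (z - x)| ≤ ‖y - x‖ * ‖z - x‖ * ‖y - z‖ := by
  set D := inner ℝ (perp (y - x)) (z - x) with hD
  rcases eq_or_ne D 0 with h0 | h0
  · rw [h0]; simp; positivity
  have hxy : x ≠ y := by rintro rfl; apply h0; rw [hD, inner_eq]; simp
  have hxz : x ≠ z := by rintro rfl; apply h0; rw [hD, inner_eq]; simp
  have hyz : y ≠ z := by rintro rfl; apply h0; rw [hD, inner_perp_self]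
  have hDe : D = -(y 1 - x 1) * (z 0 - x 0) + (y 0 - x 0) * (z 1 - x 1) := by
    rw [hD, inner_eq]; simp
  -- The vector from `x` to the circumcentre; `D` is twice the signed area of the triangle, and
  -- `e0`, `e1` are its coordinates cleared of denominators.
  set w : Plane := (2 * D)⁻¹ • perp (‖z - x‖ ^ 2 • (y - x) - ‖y - x‖ ^ 2 • (z - x)) with hw
  set c : Plane := x + w with hc
  have e0 : 2 * D * w 0 = -(‖z - x‖ ^ 2 * (y 1 - x 1) - ‖y - x‖ ^ 2 * (z 1 - x 1)) := by
    rw [hw]; simp; field_simp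
  have e1 : 2 * D * w 1 = (‖z - x‖ ^ 2 * (y 0 - x 0) - ‖y - x‖ ^ 2 * (z 0 - x 0)) := by
    rw [hw]; simp; field_simp
  have key : ∀ p : Plane, 2 * D * (‖p - c‖ ^ 2 - ‖x - c‖ ^ 2) =
      2 * D * ‖p - x‖ ^ 2 - 2 * ((p 0 - x 0) * (2 * D * w 0) + (p 1 - x 1) * (2 * D * w 1)) := by
    intro p
    simp only [norm_sq_eq, hc, PiLp.sub_apply, PiLp.add_apply]
    ring
  have hyc : ‖y - c‖ ^ 2 = ‖x - c‖ ^ 2 := by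
    have := key y
    rw [e0, e1] at this
    have h2 : 2 * D * (‖y - c‖ ^ 2 - ‖x - c‖ ^ 2) = 0 := by
      rw [this, hDe]; simp only [norm_sq_eq, PiLp.sub_apply]; ring
    have := (mul_eq_zero.1 h2).resolve_left (by simpa using h0)
    linarith
  have hzc : ‖z - c‖ ^ 2 = ‖x - c‖ ^ 2 := by
    have := key z
    rw [e0, e1] at this
    have h2 : 2 * D * (‖z - c‖ ^ 2 - ‖x - c‖ ^ 2) = 0 := by
      rw [this, hDe]; simp only [norm_sq_eq, PiLp.sub_apply]; ring
    have := (mul_eq_zero.1 h2).resolve_left (by simpa using h0)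
    linarith
  have hyc' : dist x c = dist y c := by
    rw [dist_eq_norm, dist_eq_norm]
    exact ((sq_eq_sq₀ (norm_nonneg _) (norm_nonneg _)).1 hyc).symm
  have hzc' : dist y c = dist z c := by
    rw [← hyc', dist_eq_norm, dist_eq_norm]
    exact ((sq_eq_sq₀ (norm_nonneg _) (norm_nonneg _)).1 hzc).symm
  have hle : ENNReal.ofReal τ ≤ edist x c := by
    refine hΓ.trans ?_
    refine (iInf₂_le x hx).trans ((iInf₂_le y hy).trans ((iInf₂_le z hz).trans
      ((iInf_le _ ⟨hxy, hyz, hxz⟩).trans (iInf₂_le c ⟨hyc', hzc'⟩))))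
  rw [edist_dist, ENNReal.ofReal_le_ofReal_iff dist_nonneg, dist_eq_norm] at hle
  have hxc : x - c = -w := by rw [hc]; abel
  rw [hxc, norm_neg] at hle
  have hwn : (2 * |D| * ‖w‖) ^ 2 = (‖y - x‖ * ‖z - x‖ * ‖y - z‖) ^ 2 := by
    have h3 : (2 * |D| * ‖w‖) ^ 2 = (2 * D * w 0) ^ 2 + (2 * D * w 1) ^ 2 := by
      rw [mul_pow, mul_pow, sq_abs, norm_sq_eq]; ring
    rw [h3, e0, e1, mul_pow, mul_pow]
    simp only [norm_sq_eq, PiLp.sub_apply]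
    ring
  have := (sq_eq_sq₀ (by positivity) (by positivity)).1 hwn
  rw [← this]
  nlinarith [abs_nonneg D]

/-! ### Unit tangents of a curve with positive thickness -/

/-- `T` is the unit tangent of the simple closed curve `f` of speed `ℓ`, and no point of the curve
lies in the two open discs of radius `τ` that are tangent to it at `f u`. -/
structure UnitTangent (f T : ℝ → Plane) (ℓ τ : ℝ) : Prop where
  simple : IsSimpleClosedCurve f
  speed_pos : 0 < ℓ
  radius_pos : 0 < τ
  deriv : ∀ u ∈ Icc (0 : ℝ) 1, HasDerivWithinAt f (ℓ • T u) (Icc 0 1) u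
  norm_eq : ∀ u ∈ Icc (0 : ℝ) 1, ‖T u‖ = 1
  disc : ∀ u ∈ Icc (0 : ℝ) 1, ∀ v ∈ Icc (0 : ℝ) 1,
    2 * τ * |inner ℝ (perp (T u)) (f v - f u)| ≤ ‖f v - f u‖ ^ 2

lemma nhdsWithin_Icc_diff_neBot {u : ℝ} (hu : u ∈ Icc (0 : ℝ) 1) :
    (𝓝[Icc (0 : ℝ) 1 \ {u}] u).NeBot := by
  exact accPt_principal_iff_nhdsWithin.1 (uniqueDiffOn_Icc_zero_one u hu).accPt

/-- The disc condition at `f u` is the limit of `thickness_le_circumradius` for the points `f u`, `f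
w`, `f v` as `w → u`: after division by `|w - u|` the chord becomes the velocity and the third side
becomes `‖f u - f v‖`. -/
lemma exists_unitTangent {f : ℝ → Plane} (hf : IsSimpleClosedCurve f)
    (harc : IsArclengthParametrized f) {τ : ℝ} (hτ : 0 < τ)
    (hthick : ENNReal.ofReal τ ≤ thickness (trace f)) : ∃ T ℓ, UnitTangent f T ℓ τ := by
  obtain ⟨ℓ, hℓ, h⟩ := harc
  choose! D hD hn using h
  refine ⟨fun u => ℓ⁻¹ • D u, ℓ, hf, hℓ, hτ, ?_, ?_, ?_⟩
  · intro u hu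
    have := hD u hu
    rwa [smul_smul, mul_inv_cancel₀ hℓ.ne', one_smul]
  · intro u hu
    rw [norm_smul, hn u hu, norm_inv, Real.norm_of_nonneg hℓ.le, inv_mul_cancel₀ hℓ.ne']
  · intro u hu v hv
    have hs := hasDerivWithinAt_iff_tendsto_slope.1 (hD u hu)
    have := nhdsWithin_Icc_diff_neBot hu
    have hc : Tendsto f (𝓝[Icc (0 : ℝ) 1 \ {u}] u) (𝓝 (f u)) :=
      (hf.continuousOn u hu).mono_left (nhdsWithin_mono _ sdiff_subset)
    have h1 : Tendsto (fun w => 2 * τ * |inner ℝ (perp (slope f u w)) (f v - f u)|)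
        (𝓝[Icc (0 : ℝ) 1 \ {u}] u) (𝓝 (2 * τ * |inner ℝ (perp (D u)) (f v - f u)|)) :=
      ((((continuous_perp.tendsto _).comp hs).inner tendsto_const_nhds).abs).const_mul _
    have h2 : Tendsto (fun w => ‖slope f u w‖ * ‖f v - f u‖ * ‖f w - f v‖)
        (𝓝[Icc (0 : ℝ) 1 \ {u}] u) (𝓝 (‖D u‖ * ‖f v - f u‖ * ‖f u - f v‖)) :=
      (hs.norm.mul_const _).mul (hc.sub_const _).norm
    have h3 := le_of_tendsto_of_tendsto h1 h2 (by
      filter_upwards [self_mem_nhdsWithin] with w hw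
      have := thickness_le_circumradius hthick (x := f u) (y := f w) (z := f v)
        ⟨u, hu, rfl⟩ ⟨w, hw.1, rfl⟩ ⟨v, hv, rfl⟩
      rw [slope_def_module, perp_smul, real_inner_smul_left, abs_mul, norm_smul, Real.norm_eq_abs]
      have h4 := mul_le_mul_of_nonneg_left this (abs_nonneg (w - u)⁻¹)
      calc _ = |(w - u)⁻¹| * (2 * τ * |inner ℝ (perp (f w - f u)) (f v - f u)|) := by ring
        _ ≤ _ := h4
        _ = _ := by ring)
    rw [hn u hu, norm_sub_rev (f u)] at h3
    rw [perp_smul, real_inner_smul_left, abs_mul, abs_of_pos (inv_pos.2 hℓ)]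
    calc _ = ℓ⁻¹ * (2 * τ * |inner ℝ (perp (D u)) (f v - f u)|) := by ring
      _ ≤ ℓ⁻¹ * (ℓ * ‖f v - f u‖ * ‖f v - f u‖) :=
        mul_le_mul_of_nonneg_left h3 (inv_pos.2 hℓ).le
      _ = _ := by field_simp

namespace UnitTangent
variable {f T : ℝ → Plane} {ℓ τ : ℝ}

/-- Transfers forward statements about short arcs to arcs run backwards, where the tangent changes
sign. -/
lemma reverse (h : UnitTangent f T ℓ τ) :
    UnitTangent (fun u => f (1 - u)) (fun u => -T (1 - u)) ℓ τ := by
  have hm : ∀ u ∈ Icc (0 : ℝ) 1, 1 - u ∈ Icc (0 : ℝ) 1 := fun u hu =>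
    ⟨by linarith [hu.2], by linarith [hu.1]⟩
  refine ⟨⟨?_, ?_, ?_⟩, h.speed_pos, h.radius_pos, ?_, ?_, ?_⟩
  · exact h.simple.continuousOn.comp (by fun_prop) hm
  · simp [h.simple.closed]
  · intro u hu v hv huv
    simp only at huv
    rcases hu.1.eq_or_lt with h0 | h0 <;> rcases hv.1.eq_or_lt with h1 | h1
    · rw [← h0, ← h1]
    · rw [← h0, sub_zero, ← h.simple.closed] at huv
      have := h.simple.injOn (by simp) ⟨by linarith [hv.2], by linarith⟩ huv
      linarith [hv.2]
    · rw [← h1, sub_zero, ← h.simple.closed] at huv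
      have := h.simple.injOn ⟨by linarith [hu.2], by linarith⟩ (by simp) huv
      linarith [hu.2]
    · have := h.simple.injOn ⟨by linarith [hu.2], by linarith⟩
        ⟨by linarith [hv.2], by linarith⟩ huv
      linarith
  · intro u hu
    have h1 := h.deriv (1 - u) (hm u hu)
    have h2 : HasDerivWithinAt (fun u : ℝ => 1 - u) (-1) (Icc 0 1) u := by
      simpa using ((hasDerivAt_id u).const_sub 1).hasDerivWithinAt
    have h3 : HasDerivWithinAt (fun u => f (1 - u)) ((-1 : ℝ) • ℓ • T (1 - u)) (Icc 0 1) u :=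
      h1.scomp u h2 hm
    convert h3 using 1
    simp
  · intro u hu; simpa using h.norm_eq _ (hm u hu)
  · intro u hu v hv
    simpa [perp_neg] using h.disc _ (hm u hu) _ (hm v hv)

lemma norm_sub_le (h : UnitTangent f T ℓ τ) {u v : ℝ} (hu : u ∈ Icc (0 : ℝ) 1)
    (hv : v ∈ Icc (0 : ℝ) 1) : ‖f v - f u‖ ≤ ℓ * |v - u| := by
  refine (convex_Icc (0 : ℝ) 1).norm_image_sub_le_of_norm_hasDerivWithin_le
    (fun x hx => h.deriv x hx) (fun x hx => ?_) hu hv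
  rw [norm_smul, h.norm_eq x hx, Real.norm_of_nonneg h.speed_pos.le, mul_one]

lemma ne_of_lt (h : UnitTangent f T ℓ τ) {u v : ℝ} (hu : 0 ≤ u) (huv : u < v) (hv : v ≤ 1)
    (h1 : v - u < 1) : f v ≠ f u := by
  intro he
  rcases hv.eq_or_lt with rfl | hv
  · rw [← h.simple.closed] at he
    have := h.simple.injOn (by simp) ⟨hu, huv⟩ he
    linarith
  · have := h.simple.injOn ⟨hu.trans huv.le, hv⟩ ⟨hu, huv.trans hv⟩ he
    linarith

/-- For chords no longer than `τ` the disc condition makes the normal component at most half the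
chord, so at least three quarters of the squared length is tangential. In particular the tangential
component of a short nonzero chord does not vanish. -/
lemma three_mul_norm_sq_le (h : UnitTangent f T ℓ τ) {u v : ℝ} (hu : u ∈ Icc (0 : ℝ) 1)
    (hv : v ∈ Icc (0 : ℝ) 1) (hd : ‖f v - f u‖ ≤ τ) :
    3 * ‖f v - f u‖ ^ 2 ≤ 4 * inner ℝ (T u) (f v - f u) ^ 2 := by
  have h1 := inner_sq_add_inner_perp_sq (h.norm_eq u hu) (f v - f u)
  have h2 := h.disc u hu v hv
  have h3 : 2 * |inner ℝ (perp (T u)) (f v - f u)| ≤ ‖f v - f u‖ := by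
    have : τ * (2 * |inner ℝ (perp (T u)) (f v - f u)|) ≤ τ * ‖f v - f u‖ := by
      nlinarith [norm_nonneg (f v - f u)]
    exact le_of_mul_le_mul_left this h.radius_pos
  have h4 := pow_le_pow_left₀ (by positivity) h3 2
  rw [mul_pow, sq_abs] at h4
  linarith

/-- The tangential component has derivative `ℓ > 0` at `u`, so it starts out positive; a sign change
would produce a zero, which `three_mul_norm_sq_le` excludes on short arcs. -/
lemma inner_pos (h : UnitTangent f T ℓ τ) {u v : ℝ} (hu : 0 ≤ u) (huv : u < v) (hv : v ≤ 1)
    (h1 : v - u < 1) (hτ : ℓ * (v - u) ≤ τ) : 0 < inner ℝ (T u) (f v - f u) := by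
  by_contra hneg
  push Not at hneg
  have hu' : u ∈ Icc (0 : ℝ) 1 := ⟨hu, huv.le.trans hv⟩
  have hne : ∀ w ∈ Ioc u v, inner ℝ (T u) (f w - f u) ≠ 0 := by
    intro w hw h0
    have hw' : w ∈ Icc (0 : ℝ) 1 := ⟨hu.trans hw.1.le, hw.2.trans hv⟩
    have hd : ‖f w - f u‖ ≤ τ := by
      refine (h.norm_sub_le hu' hw').trans (le_trans ?_ hτ)
      rw [abs_of_pos (by linarith [hw.1])]
      exact mul_le_mul_of_nonneg_left (by linarith [hw.2]) h.speed_pos.le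
    have := h.three_mul_norm_sq_le hu' hw' hd
    rw [h0] at this
    have h5 : ‖f w - f u‖ ^ 2 ≤ 0 := by linarith
    have h6 : ‖f w - f u‖ = 0 := by nlinarith [norm_nonneg (f w - f u)]
    exact h.ne_of_lt hu hw.1 (hw.2.trans hv) (by linarith [hw.2]) (sub_eq_zero.1 (norm_eq_zero.1 h6))
  have hder : HasDerivWithinAt (fun w => inner ℝ (T u) (f w - f u)) ℓ (Icc u v) u := by
    have h7 := ((h.deriv u hu').mono (Icc_subset_Icc hu hv)).sub_const (f u)
    have h8 := (hasDerivWithinAt_const u (Icc u v) (T u)).inner ℝ h7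
    have h9 := h.norm_eq u hu'
    simpa [real_inner_smul_right, real_inner_self_eq_norm_sq, h9] using h8
  have hs := hasDerivWithinAt_iff_tendsto_slope.1 hder
  have : (𝓝[Icc u v \ {u}] u).NeBot := by
    rw [Icc_sdiff_left, nhdsWithin_Ioc_eq_nhdsGT huv]; infer_instance
  obtain ⟨w, hw, hwm⟩ := ((hs.eventually (lt_mem_nhds h.speed_pos)).and
    self_mem_nhdsWithin).exists
  have hwu : u < w := lt_of_le_of_ne hwm.1.1 (Ne.symm hwm.2)
  have hwpos : 0 < inner ℝ (T u) (f w - f u) := by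
    rw [slope_def_field] at hw
    simp only [sub_self, inner_zero_right, sub_zero] at hw
    exact (div_pos_iff_of_pos_right (by linarith)).1 hw
  have hcont : ContinuousOn (fun w => inner ℝ (T u) (f w - f u)) (Icc w v) :=
    continuousOn_const.inner ((h.simple.continuousOn.mono
      (Icc_subset_Icc (hu.trans hwu.le) hv)).sub continuousOn_const)
  obtain ⟨x, hx, hx0⟩ := intermediate_value_Icc' hwm.1.2 hcont ⟨hneg, hwpos.le⟩
  exact hne x ⟨hwu.trans_le hx.1, hx.2⟩ hx0

/-- With `θ` the angle between `T` and `e`, the disc condition says `|sin θ| ≤ ‖e‖ / (2 * τ)`.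
Positivity of the inner product gives `1 - cos θ ≤ sin² θ`, and the left side squared is `2 - 2 *
cos θ`. -/
lemma norm_sub_unit_le {T e : Plane} (hT : ‖T‖ = 1) (hτ : 0 < τ) (he : e ≠ 0)
    (hpos : 0 < inner ℝ T e) (hd : 2 * τ * |inner ℝ (perp T) e| ≤ ‖e‖ ^ 2) :
    ‖T - ‖e‖⁻¹ • e‖ ≤ ‖e‖ / τ := by
  have hd0 : 0 < ‖e‖ := norm_pos_iff.2 he
  have h1 := inner_sq_add_inner_perp_sq hT e
  set a := inner ℝ T e
  set b := inner ℝ (perp T) e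
  set d := ‖e‖
  have h2 : ‖T - d⁻¹ • e‖ ^ 2 = 2 - 2 * (a / d) := by
    rw [norm_sub_sq_real, hT, norm_smul, real_inner_smul_right, norm_inv, norm_norm,
      inv_mul_cancel₀ hd0.ne']
    field_simp; ring
  have h3 : b ^ 2 ≤ (d ^ 2 / (2 * τ)) ^ 2 := by
    rw [← sq_abs b]
    apply pow_le_pow_left₀ (abs_nonneg _)
    rw [le_div_iff₀ (by positivity)]; linarith
  have h4 : a ≤ d := by nlinarith [sq_nonneg b]
  have h5 : 1 - b ^ 2 / d ^ 2 ≤ a / d := by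
    have : 1 - b ^ 2 / d ^ 2 = (a / d) * (a / d) := by field_simp; linarith
    rw [this]
    have h6 : a / d ≤ 1 := (div_le_one hd0).2 h4
    have h7 : 0 ≤ a / d := by positivity
    nlinarith
  have h6 : b ^ 2 / d ^ 2 ≤ (d / τ) ^ 2 / 4 := by
    rw [div_le_iff₀ (by positivity)]
    calc b ^ 2 ≤ _ := h3
      _ = _ := by field_simp; norm_num
  exact (sq_le_sq₀ (norm_nonneg _) (by positivity)).1 (by rw [h2]; nlinarith [sq_nonneg (d / τ)])

/-- Both tangents are compared with the unit vector along the common chord; the estimate at `v` uses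
the reversed curve for the sign of its inner product. -/
lemma norm_tangent_sub_le (h : UnitTangent f T ℓ τ) {u v : ℝ} (hu : 0 ≤ u) (huv : u < v)
    (hv : v ≤ 1) (h1 : v - u < 1) (hτ : ℓ * (v - u) ≤ τ) :
    ‖T u - T v‖ ≤ 2 * ℓ / τ * (v - u) := by
  have hu' : u ∈ Icc (0 : ℝ) 1 := ⟨hu, huv.le.trans hv⟩
  have hv' : v ∈ Icc (0 : ℝ) 1 := ⟨hu.trans huv.le, hv⟩
  have hne : f v - f u ≠ 0 := sub_ne_zero.2 (h.ne_of_lt hu huv hv h1)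
  have hlen := h.norm_sub_le hu' hv'
  rw [abs_of_pos (by linarith)] at hlen
  have e1 := norm_sub_unit_le (h.norm_eq u hu') h.radius_pos hne (h.inner_pos hu huv hv h1 hτ)
    (h.disc u hu' v hv')
  have hback : 0 < inner ℝ (T v) (f v - f u) := by
    have := h.reverse.inner_pos (u := 1 - v) (v := 1 - u) (by linarith) (by linarith)
      (by linarith) (by linarith) (by linarith)
    simp only [sub_sub_cancel, inner_neg_left] at this
    rw [← inner_neg_right, neg_sub] at this
    exact this
  have e2 := norm_sub_unit_le (h.norm_eq v hv') h.radius_pos hne hback (by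
    have := h.disc v hv' u hu'
    rwa [← neg_sub (f v) (f u), inner_neg_right, abs_neg, norm_neg] at this)
  calc ‖T u - T v‖ ≤ ‖T u - ‖f v - f u‖⁻¹ • (f v - f u)‖ + ‖T v - ‖f v - f u‖⁻¹ • (f v - f u)‖ := by
        rw [norm_sub_rev (T v)]; exact norm_sub_le_norm_sub_add_norm_sub _ _ _
    _ ≤ ‖f v - f u‖ / τ + ‖f v - f u‖ / τ := add_le_add e1 e2
    _ ≤ ℓ * (v - u) / τ + ℓ * (v - u) / τ := by gcongr <;> exact h.radius_pos.le
    _ = _ := by ring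

lemma continuousOn_tangent (h : UnitTangent f T ℓ τ) : ContinuousOn T (Icc 0 1) := by
  have hℓ := h.speed_pos
  have hτ := h.radius_pos
  rw [Metric.continuousOn_iff]
  intro v hv e he
  refine ⟨min (min (1 / 2) (τ / ℓ)) (e / (2 * ℓ / τ)), by positivity, fun u hu hd => ?_⟩
  rw [lt_min_iff, lt_min_iff, lt_div_iff₀ hℓ, lt_div_iff₀' (c := 2 * ℓ / τ) (by positivity), Real.dist_eq] at hd
  rw [dist_eq_norm]
  rcases lt_trichotomy u v with huv | rfl | huv
  · rw [abs_of_neg (by linarith)] at hd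
    refine (h.norm_tangent_sub_le hu.1 huv hv.2 (by linarith) (by linarith)).trans_lt ?_
    linarith
  · simpa using he
  · rw [abs_of_pos (by linarith)] at hd
    rw [norm_sub_rev]
    refine (h.norm_tangent_sub_le hv.1 huv hu.2 (by linarith) (by linarith)).trans_lt ?_
    linarith

/-- The disc condition at `f 0`, tested on points that approach the base point from the end of the
parameter interval, forces the normal component of `T 1` to vanish. -/
lemma tangent_zero_eq_or (h : UnitTangent f T ℓ τ) : T 1 = T 0 ∨ T 1 = -T 0 := by
  have h0 : (0 : ℝ) ∈ Icc (0 : ℝ) 1 := by simp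
  have h1 : (1 : ℝ) ∈ Icc (0 : ℝ) 1 := by simp
  have hs := hasDerivWithinAt_iff_tendsto_slope.1 (h.deriv 1 h1)
  have := nhdsWithin_Icc_diff_neBot h1
  have hc : Tendsto f (𝓝[Icc (0 : ℝ) 1 \ {1}] 1) (𝓝 (f 1)) :=
    (h.simple.continuousOn 1 h1).mono_left (nhdsWithin_mono _ sdiff_subset)
  have l1 : Tendsto (fun w => 2 * τ * |inner ℝ (perp (T 0)) (slope f 1 w)|)
      (𝓝[Icc (0 : ℝ) 1 \ {1}] 1) (𝓝 (2 * τ * |inner ℝ (perp (T 0)) (ℓ • T 1)|)) :=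
    ((tendsto_const_nhds.inner hs).abs).const_mul _
  have l2 : Tendsto (fun w => ‖slope f 1 w‖ * ‖f w - f 1‖)
      (𝓝[Icc (0 : ℝ) 1 \ {1}] 1) (𝓝 (‖ℓ • T 1‖ * ‖f 1 - f 1‖)) :=
    hs.norm.mul (hc.sub_const _).norm
  have h3 := le_of_tendsto_of_tendsto l1 l2 (by
    filter_upwards [self_mem_nhdsWithin] with w hw
    have := h.disc 0 h0 w hw.1
    rw [h.simple.closed] at this
    rw [slope_def_module, real_inner_smul_right, abs_mul, norm_smul, Real.norm_eq_abs]
    have h4 := mul_le_mul_of_nonneg_left this (abs_nonneg (w - 1)⁻¹)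
    calc _ = |(w - 1)⁻¹| * (2 * τ * |inner ℝ (perp (T 0)) (f w - f 1)|) := by ring
      _ ≤ _ := h4
      _ = _ := by ring)
  rw [sub_self, norm_zero, mul_zero, real_inner_smul_right, abs_mul, abs_of_pos h.speed_pos] at h3
  have h4 : inner ℝ (perp (T 0)) (T 1) = 0 := by
    have h5 := h.speed_pos
    have h6 := h.radius_pos
    have : |inner ℝ (perp (T 0)) (T 1)| ≤ 0 := by
      by_contra hc
      push Not at hc
      have : 0 < 2 * τ * (ℓ * |inner ℝ (perp (T 0)) (T 1)|) := by positivity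
      linarith
    exact abs_nonpos_iff.1 this
  have h5 := inner_sq_add_inner_perp_sq (h.norm_eq 0 h0) (T 1)
  have h6 := eq_inner_smul_add (h.norm_eq 0 h0) (T 1)
  rw [h4, h.norm_eq 1 h1] at h5
  rw [h4, zero_smul, add_zero] at h6
  rcases sq_eq_sq_iff_eq_or_eq_neg.1 ((by linarith : inner ℝ (T 0) (T 1) ^ 2 = 1).trans (one_pow 2).symm) with h7 | h7
  · left; rw [h6, h7, one_smul]
  · right; rw [h6, h7]; simp

/-- The curve has no cusp at its base point. -/
lemma tangent_one (h : UnitTangent f T ℓ τ) : T 1 = T 0 := by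
  refine h.tangent_zero_eq_or.resolve_right fun hT => ?_
  have hℓ := h.speed_pos
  have hτ := h.radius_pos
  set η := min (1 / 4) (τ / (4 * ℓ)) with hη
  have η0 : 0 < η := by positivity
  have η1 : η ≤ 1 / 4 := min_le_left _ _
  have η2 : ℓ * η ≤ τ / 4 := by
    have : η ≤ τ / (4 * ℓ) := min_le_right _ _
    rw [le_div_iff₀ (by positivity)] at this; linarith
  set φ := fun v => inner ℝ (T 0) (f v - f 0) with hφ
  have hφc : ContinuousOn φ (Icc 0 1) :=
    continuousOn_const.inner (h.simple.continuousOn.sub continuousOn_const)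
  have hφη : 0 < φ η := h.inner_pos le_rfl η0 (by linarith) (by linarith) (by linarith)
  have hφ1 : 0 < φ (1 - η) := by
    have := h.reverse.inner_pos (u := 0) (v := η) (by linarith) η0
      (by linarith) (by linarith) (by linarith)
    simpa [hT, hφ, h.simple.closed] using this
  -- In a cusp both ends of the curve leave the base point in direction `T 0`. Two points at the
  -- same height `m`, one on each branch, have a chord orthogonal to `T 0`, hence nearly normal at
  -- the first point. The disc condition then makes it at least `τ` long, although both points lie
  -- within `τ / 4` of the base point.
  set m := min (φ η) (φ (1 - η)) with hm
  have m0 : 0 < m := lt_min hφη hφ1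
  have φ0 : φ 0 = 0 := by simp [hφ]
  have φ1 : φ 1 = 0 := by simp [hφ, h.simple.closed]
  obtain ⟨a, ha, ham⟩ := intermediate_value_Icc η0.le
    (hφc.mono (Icc_subset_Icc le_rfl (by linarith))) ⟨φ0.trans_le m0.le, min_le_left _ _⟩
  obtain ⟨b, hb, hbm⟩ := intermediate_value_Icc' (a := 1 - η) (b := 1) (by linarith)
    (hφc.mono (Icc_subset_Icc (by linarith) le_rfl)) ⟨φ1.trans_le m0.le, min_le_right _ _⟩
  have ha0 : 0 < a := lt_of_le_of_ne ha.1 (by rintro rfl; rw [φ0] at ham; linarith)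
  have hb1 : b < 1 := lt_of_le_of_ne hb.2 (by rintro rfl; rw [φ1] at hbm; linarith)
  have ha' : a ∈ Icc (0 : ℝ) 1 := ⟨ha.1, by linarith [ha.2]⟩
  have hb' : b ∈ Icc (0 : ℝ) 1 := ⟨by linarith [hb.1], hb.2⟩
  set e := f b - f a with he
  have hne : e ≠ 0 := sub_ne_zero.2 (h.ne_of_lt ha.1 (by linarith [ha.2, hb.1]) hb.2 (by linarith))
  have hTe : inner ℝ (T 0) e = 0 := by
    have : inner ℝ (T 0) e = φ b - φ a := by simp only [hφ, he, inner_sub_right]; ring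
    rw [this, ham, hbm, sub_self]
  have hN := inner_sq_add_inner_perp_sq (h.norm_eq 0 (by simp)) e
  rw [hTe] at hN
  have hN' : |inner ℝ (perp (T 0)) e| = ‖e‖ := by
    rw [← sq_eq_sq₀ (abs_nonneg _) (norm_nonneg _), sq_abs]; linarith
  have hTa : ‖T 0 - T a‖ ≤ 1 / 2 := by
    refine (h.norm_tangent_sub_le le_rfl ha0 (by linarith [ha.2]) (by linarith [ha.2]) ?_).trans ?_
    · nlinarith [ha.2]
    · rw [sub_zero, div_mul_eq_mul_div, div_le_iff₀ hτ]; nlinarith [ha.2]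
  have hNa : ‖e‖ / 2 ≤ |inner ℝ (perp (T a)) e| := by
    have h1 : |inner ℝ (perp (T 0 - T a)) e| ≤ ‖e‖ / 2 := by
      refine (abs_real_inner_le_norm _ _).trans ?_
      rw [norm_perp]; nlinarith [norm_nonneg e]
    rw [perp_sub, inner_sub_left] at h1
    have := abs_sub_abs_le_abs_sub (inner ℝ (perp (T 0)) e) (inner ℝ (perp (T a)) e)
    linarith
  have hd := h.disc a ha' b hb'
  have hpos : 0 < ‖e‖ := norm_pos_iff.2 hne
  have hlarge : τ ≤ ‖e‖ := by
    have : τ * ‖e‖ ≤ ‖e‖ * ‖e‖ := by nlinarith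
    exact le_of_mul_le_mul_right this hpos
  have hsmall : ‖e‖ ≤ ℓ * η + ℓ * η := by
    have e1 := h.norm_sub_le (u := 1) (by simp) hb'
    have e2 := h.norm_sub_le (u := 0) (by simp) ha'
    have : e = (f b - f 1) - (f a - f 0) := by rw [he, h.simple.closed]; abel
    rw [this]
    refine (_root_.norm_sub_le _ _).trans (add_le_add (e1.trans ?_) (e2.trans ?_))
    · rw [abs_of_neg (by linarith)]; nlinarith [hb.1]
    · rw [sub_zero, abs_of_pos ha0]; nlinarith [ha.2]
  linarith

end UnitTangent

/-! ### Periodic frames -/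

/-- `γ` is a closed curve of period `1` and speed `ℓ` with unit tangent `T`, with no point in the
open discs of radius `τ` that are tangent to it. -/
structure ClosedFrame (γ T : ℝ → Plane) (ℓ τ : ℝ) : Prop where
  speed_pos : 0 < ℓ
  radius_pos : 0 < τ
  periodic : Function.Periodic γ 1
  periodic_tangent : Function.Periodic T 1
  deriv : ∀ s, HasDerivAt γ (ℓ • T s) s
  norm_eq : ∀ s, ‖T s‖ = 1
  continuous_tangent : Continuous T
  injOn : InjOn γ (Ico 0 1)
  disc : ∀ s s', 2 * τ * |inner ℝ (perp (T s)) (γ s' - γ s)| ≤ ‖γ s' - γ s‖ ^ 2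

lemma fract_mem_Icc (s : ℝ) : Int.fract s ∈ Icc (0 : ℝ) 1 :=
  ⟨Int.fract_nonneg s, (Int.fract_lt_one s).le⟩

lemma fract_mem_Ico (s : ℝ) : Int.fract s ∈ Ico (0 : ℝ) 1 :=
  ⟨Int.fract_nonneg s, Int.fract_lt_one s⟩

lemma comp_fract_eq_on_Icc {f : ℝ → Plane} (hf : f 0 = f 1) (n : ℤ) {s : ℝ}
    (hs : s ∈ Icc (n : ℝ) (n + 1)) : f (Int.fract s) = f (s - n) := by
  rcases hs.2.eq_or_lt with h | h
  · have : Int.fract s = 0 := by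
      rw [h]; simp
    rw [this, hf, h]; congr 1; ring
  · rw [show Int.fract s = s - n from by
      rw [Int.fract, (Int.floor_eq_iff).2 ⟨hs.1, h⟩]]

namespace UnitTangent
variable {f T : ℝ → Plane} {ℓ τ : ℝ}

lemma hasDerivWithinAt_comp_fract (h : UnitTangent f T ℓ τ) (n : ℤ) {s : ℝ}
    (hs : s ∈ Icc (n : ℝ) (n + 1)) :
    HasDerivWithinAt (fun s => f (Int.fract s)) (ℓ • T (Int.fract s)) (Icc (n : ℝ) (n + 1)) s := by
  have hm : ∀ s ∈ Icc (n : ℝ) (n + 1), s - n ∈ Icc (0 : ℝ) 1 := fun s hs =>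
    ⟨by linarith [hs.1], by linarith [hs.2]⟩
  rw [comp_fract_eq_on_Icc h.tangent_one.symm n hs]
  have h1 := h.deriv (s - n) (hm s hs)
  have h2 : HasDerivWithinAt (fun s : ℝ => s - n) 1 (Icc (n : ℝ) (n + 1)) s :=
    ((hasDerivAt_id s).sub_const _).hasDerivWithinAt
  have h3 : HasDerivWithinAt (fun s => f (s - n)) ((1 : ℝ) • ℓ • T (s - n))
    (Icc (n : ℝ) (n + 1)) s := h1.scomp s h2 hm
  rw [one_smul] at h3
  exact h3.congr (fun x hx => comp_fract_eq_on_Icc h.simple.closed n hx)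
    (comp_fract_eq_on_Icc h.simple.closed n hs)

lemma closedFrame (h : UnitTangent f T ℓ τ) :
    ClosedFrame (fun s => f (Int.fract s)) (fun s => T (Int.fract s)) ℓ τ where
  speed_pos := h.speed_pos
  radius_pos := h.radius_pos
  periodic s := by simp
  periodic_tangent s := by simp
  deriv s := by
    set n := ⌊s⌋ with hn
    have h1 : (n : ℝ) ≤ s := Int.floor_le s
    have h2 : s < n + 1 := Int.lt_floor_add_one s
    rcases h1.eq_or_lt with h3 | h3
    -- At an integer the one-sided derivatives from the two adjacent periods are glued;
    -- `tangent_one` makes them agree.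
    · have e1 := h.hasDerivWithinAt_comp_fract n ⟨h1, h2.le⟩
      have e2 := h.hasDerivWithinAt_comp_fract (n - 1) (s := s)
        ⟨by push_cast; linarith, by push_cast; linarith⟩
      have e3 := e2.union e1
      push_cast at e3
      rw [show (n : ℝ) - 1 + 1 = n by ring, Icc_union_Icc_eq_Icc (by linarith) (by linarith)] at e3
      exact e3.hasDerivAt (Icc_mem_nhds (by linarith) h2)
    · exact (h.hasDerivWithinAt_comp_fract n ⟨h1, h2.le⟩).hasDerivAt (Icc_mem_nhds h3 h2)
  norm_eq s := h.norm_eq _ (fract_mem_Icc s)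
  continuous_tangent := h.continuousOn_tangent.comp_fract'' h.tangent_one.symm
  injOn s hs s' hs' hss := by
    simp only [Int.fract_eq_self.2 hs, Int.fract_eq_self.2 hs'] at hss
    exact h.simple.injOn hs hs' hss
  disc s s' := h.disc _ (fract_mem_Icc s) _ (fract_mem_Icc s')

end UnitTangent

lemma range_comp_fract {f : ℝ → Plane} (hf : f 0 = f 1) :
    range (fun s => f (Int.fract s)) = trace f := by
  apply Subset.antisymm
  · rintro _ ⟨s, rfl⟩; exact ⟨_, fract_mem_Icc s, rfl⟩
  · rintro _ ⟨s, hs, rfl⟩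
    refine ⟨s, ?_⟩
    have := comp_fract_eq_on_Icc hf 0 (s := s) (by simpa using hs)
    simpa using this

/-- A closed curve `γ` with unit normal field `N` whose normal coordinates cover the plane, with no
point in the open discs of radius `τ` that are tangent to it. -/
structure NormalFrame (γ N : ℝ → Plane) (τ : ℝ) : Prop where
  radius_pos : 0 < τ
  continuous : Continuous γ
  continuous_normal : Continuous N
  periodic : Function.Periodic γ 1
  periodic_normal : Function.Periodic N 1
  norm_eq : ∀ s, ‖N s‖ = 1
  injOn : InjOn γ (Ico 0 1)
  disc : ∀ s s', 2 * τ * |inner ℝ (N s) (γ s' - γ s)| ≤ ‖γ s' - γ s‖ ^ 2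
  foot : ∀ x, ∃ s t, x = γ s + t • N s ∧ |t| = Metric.infDist x (range γ)

lemma periodic_comp_fract {g : ℝ → Plane} (hg : Function.Periodic g 1) (s : ℝ) :
    g (Int.fract s) = g s := by
  have := hg.sub_int_mul_eq ⌊s⌋ (x := s)
  rwa [mul_one] at this

lemma range_eq_image_Icc {g : ℝ → Plane} (hg : Function.Periodic g 1) : range g = g '' Icc 0 1 := by
  apply Subset.antisymm
  · rintro _ ⟨s, rfl⟩; exact ⟨_, fract_mem_Icc s, periodic_comp_fract hg s⟩
  · rintro _ ⟨s, -, rfl⟩; exact ⟨s, rfl⟩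

/-- A nearest point of the compact curve serves as foot point: the first-order condition there makes
`x - γ s` orthogonal to the tangent, hence a multiple of the normal. -/
lemma ClosedFrame.normalFrame {γ T : ℝ → Plane} {ℓ τ : ℝ} (h : ClosedFrame γ T ℓ τ) :
    NormalFrame γ (fun s => perp (T s)) τ := by
  have hc : Continuous γ := continuous_iff_continuousAt.2 fun s => (h.deriv s).continuousAt
  refine ⟨h.radius_pos, hc, continuous_perp.comp h.continuous_tangent, h.periodic,
    fun s => by simp [h.periodic_tangent s], fun s => by simp [h.norm_eq s], h.injOn, h.disc, ?_⟩
  intro x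
  have hK : IsCompact (range γ) := by
    rw [range_eq_image_Icc h.periodic]; exact isCompact_Icc.image hc
  obtain ⟨_, ⟨s, rfl⟩, hs⟩ := hK.exists_infDist_eq_dist (range_nonempty γ) x
  have hmin : IsLocalMin (fun s' => ‖x - γ s'‖ ^ 2) s := by
    refine Filter.Eventually.of_forall fun s' => ?_
    have : dist x (γ s) ≤ dist x (γ s') := hs ▸ Metric.infDist_le_dist_of_mem ⟨s', rfl⟩
    rw [dist_eq_norm, dist_eq_norm] at this
    exact pow_le_pow_left₀ (norm_nonneg _) this 2
  have hd : HasDerivAt (fun s' => ‖x - γ s'‖ ^ 2) (2 * inner ℝ (x - γ s) (-(ℓ • T s))) s :=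
    ((h.deriv s).const_sub x).norm_sq
  have h0 := hmin.hasDerivAt_eq_zero hd
  rw [inner_neg_right, real_inner_smul_right, real_inner_comm] at h0
  have h1 : inner ℝ (T s) (x - γ s) = 0 := by
    have := h.speed_pos.ne'
    simpa [this] using h0
  have h2 := eq_inner_smul_add (h.norm_eq s) (x - γ s)
  rw [h1, zero_smul, zero_add] at h2
  refine ⟨s, inner ℝ (perp (T s)) (x - γ s), ?_, ?_⟩
  · rw [← h2]; abel
  · have h3 := inner_sq_add_inner_perp_sq (h.norm_eq s) (x - γ s)
    rw [h1] at h3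
    rw [hs, dist_eq_norm, ← sq_eq_sq₀ (abs_nonneg _) (norm_nonneg _), sq_abs]
    linarith

namespace NormalFrame
variable {γ N : ℝ → Plane} {τ : ℝ}

/-- No orientation enters a `NormalFrame`, so each result about the side of `N` also serves for the
other side. -/
lemma neg (h : NormalFrame γ N τ) : NormalFrame γ (fun s => -N s) τ := by
  refine ⟨h.radius_pos, h.continuous, h.continuous_normal.neg, h.periodic,
    fun s => by simp [h.periodic_normal s], fun s => by simp [h.norm_eq s], h.injOn,
    fun s s' => by simpa using h.disc s s', fun x => ?_⟩
  obtain ⟨s, t, hx, ht⟩ := h.foot x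
  exact ⟨s, -t, by simpa using hx, by simpa using ht⟩

lemma isCompact_range (h : NormalFrame γ N τ) : IsCompact (range γ) := by
  rw [range_eq_image_Icc h.periodic]; exact isCompact_Icc.image h.continuous

lemma norm_sq_add_smul_sub (h : NormalFrame γ N τ) (s t : ℝ) (c : Plane) :
    ‖γ s + t • N s - c‖ ^ 2 = t ^ 2 - 2 * t * inner ℝ (N s) (c - γ s) + ‖c - γ s‖ ^ 2 := by
  rw [show γ s + t • N s - c = t • N s - (c - γ s) by abel, norm_sub_sq_real, norm_smul, h.norm_eq,
    real_inner_smul_left, mul_one, Real.norm_eq_abs, sq_abs]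
  ring

/-- Quantitative uniqueness of the foot point. -/
lemma le_norm_sq (h : NormalFrame γ N τ) (s t s' : ℝ) :
    t ^ 2 + (1 - |t| / τ) * ‖γ s' - γ s‖ ^ 2 ≤ ‖γ s + t • N s - γ s'‖ ^ 2 := by
  rw [h.norm_sq_add_smul_sub]
  have h1 := h.disc s s'
  have hτ := h.radius_pos
  have h2 : |t| * |inner ℝ (N s) (γ s' - γ s)| ≤ |t| * (‖γ s' - γ s‖ ^ 2 / (2 * τ)) := by
    apply mul_le_mul_of_nonneg_left _ (abs_nonneg t)
    rw [le_div_iff₀ (by positivity)]; linarith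
  rw [← abs_mul] at h2
  have h3 := le_abs_self (t * inner ℝ (N s) (γ s' - γ s))
  have h4 : |t| * (‖γ s' - γ s‖ ^ 2 / (2 * τ)) = |t| / τ * ‖γ s' - γ s‖ ^ 2 / 2 := by
    field_simp
  rw [h4] at h2
  linarith

lemma infDist_add_smul (h : NormalFrame γ N τ) (s : ℝ) {t : ℝ} (ht : |t| ≤ τ) :
    Metric.infDist (γ s + t • N s) (range γ) = |t| := by
  apply le_antisymm
  · refine (Metric.infDist_le_dist_of_mem (mem_range_self s)).trans ?_
    rw [dist_eq_norm, add_sub_cancel_left, norm_smul, h.norm_eq, mul_one, Real.norm_eq_abs]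
  · refine (Metric.le_infDist (range_nonempty γ)).2 ?_
    rintro _ ⟨s', rfl⟩
    rw [dist_eq_norm, ← sq_le_sq₀ (abs_nonneg _) (norm_nonneg _), sq_abs]
    refine le_trans ?_ (h.le_norm_sq s t s')
    have : |t| / τ ≤ 1 := (div_le_one h.radius_pos).2 ht
    nlinarith [sq_nonneg ‖γ s' - γ s‖]

lemma fract_eq_of_eq (h : NormalFrame γ N τ) {s s' : ℝ} (hs : γ s = γ s') :
    Int.fract s = Int.fract s' := by
  rw [← periodic_comp_fract h.periodic s, ← periodic_comp_fract h.periodic s'] at hs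
  exact h.injOn (fract_mem_Ico s) (fract_mem_Ico s') hs

lemma normal_eq_of_eq (h : NormalFrame γ N τ) {s s' : ℝ} (hs : γ s = γ s') : N s = N s' := by
  rw [← periodic_comp_fract h.periodic_normal s, ← periodic_comp_fract h.periodic_normal s',
    h.fract_eq_of_eq hs]

/-- Equal points have equal distance to the curve, so `|t| = |t'|`; the positive coefficient `1 -
|t| / τ` in `le_norm_sq` then forces the feet to coincide. The parameters themselves need only agree
modulo the period. -/
lemma add_smul_injective (h : NormalFrame γ N τ) {s t s' t' : ℝ} (ht : |t| < τ) (ht' : |t'| < τ)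
    (he : γ s + t • N s = γ s' + t' • N s') : γ s = γ s' ∧ t = t' := by
  have h1 := h.infDist_add_smul s ht.le
  rw [he, h.infDist_add_smul s' ht'.le] at h1
  have h2 : ‖γ s + t • N s - γ s'‖ ^ 2 = t ^ 2 := by
    rw [he, add_sub_cancel_left, norm_smul, h.norm_eq, mul_one, Real.norm_eq_abs, sq_abs,
      ← sq_abs, h1, sq_abs]
  have h3 := h.le_norm_sq s t s'
  rw [h2] at h3
  have h4 : |t| / τ < 1 := (div_lt_one h.radius_pos).2 ht
  have h5 : ‖γ s' - γ s‖ ^ 2 = 0 := by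
    by_contra hne
    have : 0 < ‖γ s' - γ s‖ ^ 2 := lt_of_le_of_ne (sq_nonneg _) (Ne.symm hne)
    nlinarith
  have h6 : γ s = γ s' := (sub_eq_zero.1 (norm_eq_zero.1 (pow_eq_zero_iff two_ne_zero |>.1 h5))).symm
  refine ⟨h6, ?_⟩
  rw [h6, h.normal_eq_of_eq h6] at he
  have h7 := add_left_cancel he
  have h8 : (t - t') • N s' = 0 := by rw [sub_smul, h7, sub_self]
  have h9 : N s' ≠ 0 := by intro h0; have := h.norm_eq s'; rw [h0, norm_zero] at this; simp at this
  have := (smul_eq_zero.1 h8).resolve_right h9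
  linarith

lemma exists_foot_nonneg_or (h : NormalFrame γ N τ) (x : Plane) :
    ∃ s, x = γ s + Metric.infDist x (range γ) • N s ∨
      x = γ s + (-Metric.infDist x (range γ)) • N s := by
  obtain ⟨s, t, hx, ht⟩ := h.foot x
  refine ⟨s, ?_⟩
  rcases abs_choice t with h1 | h1 <;> rw [h1] at ht
  · left; rw [← ht]; exact hx
  · right; rw [← ht, neg_neg]; exact hx

end NormalFrame

/-! ### The two sides of the curve -/

/-- Every continuous circle-valued function on the plane has a continuous argument. -/
lemma exists_continuous_arg {θ : Plane → Circle} (hθ : Continuous θ) :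
    ∃ Θ : Plane → ℝ, Continuous Θ ∧ ∀ x, Circle.exp (Θ x) = θ x := by
  obtain ⟨e₀, he⟩ : ∃ e : ℝ, Circle.exp e = θ 0 := ⟨Complex.arg (θ 0), Circle.exp_arg _⟩
  obtain ⟨F, ⟨-, hF⟩, -⟩ := Circle.isCoveringMap_exp.existsUnique_continuousMap_lifts
    (⟨θ, hθ⟩ : C(Plane, Circle)) 0 e₀ he
  exact ⟨F, F.continuous, fun x => congrFun hF x⟩

namespace NormalFrame
variable {γ N : ℝ → Plane} {τ : ℝ}

/-- The closed collar of width `r` on the side of `N`. -/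
def collar (γ N : ℝ → Plane) (r : ℝ) : Set Plane :=
  (fun q : ℝ × ℝ => γ q.1 + q.2 • N q.1) '' (Icc (0 : ℝ) 1 ×ˢ Icc 0 r)

lemma mem_collar (h : NormalFrame γ N τ) (s : ℝ) {t r : ℝ} (ht : 0 ≤ t) (htr : t ≤ r) :
    γ s + t • N s ∈ collar γ N r :=
  ⟨(Int.fract s, t), ⟨fract_mem_Icc s, ht, htr⟩, by
    simp only [periodic_comp_fract h.periodic, periodic_comp_fract h.periodic_normal]⟩

lemma isCompact_collar (h : NormalFrame γ N τ) (r : ℝ) : IsCompact (collar γ N r) := by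
  have := h.continuous
  have := h.continuous_normal
  exact (isCompact_Icc.prod isCompact_Icc).image (by fun_prop)

lemma isPreconnected_collar (h : NormalFrame γ N τ) (r : ℝ) : IsPreconnected (collar γ N r) := by
  have := h.continuous
  have := h.continuous_normal
  exact (isPreconnected_Icc.prod isPreconnected_Icc).image _ (by fun_prop)

lemma eq_of_mem_collar (h : NormalFrame γ N τ) {r : ℝ} (hr : r < τ) {x : Plane}
    (hx : x ∈ collar γ N r) : Metric.infDist x (range γ) ≤ r ∧
      ∃ s, x = γ s + Metric.infDist x (range γ) • N s := by
  obtain ⟨⟨s, t⟩, ⟨-, ht0, htr⟩, rfl⟩ := hx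
  have h0 : |t| = t := abs_of_nonneg ht0
  simp only
  rw [h.infDist_add_smul s (by rw [h0]; linarith [htr]), h0]
  exact ⟨htr, s, rfl⟩

lemma infDist_eq_zero_of_mem_collars (h : NormalFrame γ N τ) {r : ℝ} (hr : r < τ) {x : Plane}
    (hx : x ∈ collar γ N r) (hx' : x ∈ collar γ (fun s => -N s) r) :
    Metric.infDist x (range γ) = 0 := by
  obtain ⟨h1, s, hs⟩ := h.eq_of_mem_collar hr hx
  obtain ⟨-, s', hs'⟩ := h.neg.eq_of_mem_collar hr hx'
  have h0 : 0 ≤ Metric.infDist x (range γ) := Metric.infDist_nonneg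
  have := (h.add_smul_injective (s := s) (s' := s') (t := Metric.infDist x (range γ))
    (t' := -Metric.infDist x (range γ)) (by rw [abs_of_nonneg h0]; linarith)
    (by rw [abs_neg, abs_of_nonneg h0]; linarith) (by
      rw [← hs, neg_smul, ← smul_neg]; exact hs')).2
  linarith

lemma mem_collar_or (h : NormalFrame γ N τ) {r : ℝ} {x : Plane}
    (hx : Metric.infDist x (range γ) ≤ r) :
    x ∈ collar γ N r ∨ x ∈ collar γ (fun s => -N s) r := by
  obtain ⟨s, hs | hs⟩ := h.exists_foot_nonneg_or x
  · left; rw [hs]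
    exact h.mem_collar s Metric.infDist_nonneg hx
  · right; rw [neg_smul, ← smul_neg] at hs; rw [hs]
    exact h.neg.mem_collar s Metric.infDist_nonneg hx

open Classical in
/-- A circle-valued function that winds once when the curve is crossed. -/
noncomputable def crossing (γ N : ℝ → Plane) (r : ℝ) (x : Plane) : Circle :=
  if x ∈ collar γ N r then Circle.exp (Real.pi * Metric.infDist x (range γ) / r)
  else if x ∈ collar γ (fun s => -N s) r then
    Circle.exp (-(Real.pi * Metric.infDist x (range γ) / r))
  else Circle.exp Real.pi

/-- The order of the case distinction is harmless: the collars overlap only on the curve, where both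
formulas give angle zero. -/
lemma crossing_of_mem_neg (h : NormalFrame γ N τ) {r : ℝ} (hr : r < τ) {x : Plane}
    (hx : x ∈ collar γ (fun s => -N s) r) :
    crossing γ N r x = Circle.exp (-(Real.pi * Metric.infDist x (range γ) / r)) := by
  unfold crossing
  split_ifs with h1
  · simp [h.infDist_eq_zero_of_mem_collars hr h1 hx]
  · rfl

lemma circle_exp_neg_pi : Circle.exp (-Real.pi) = Circle.exp Real.pi := by
  have := Circle.exp_sub_two_pi Real.pi
  rw [← this]; congr 1; ring

/-- The collars end at the angles `π` and `-π`, which are the same point of the circle, so the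
function closes up continuously with a constant outside. -/
lemma crossing_of_le (h : NormalFrame γ N τ) {r : ℝ} (hr0 : 0 < r) (hr : r < τ) {x : Plane}
    (hx : r ≤ Metric.infDist x (range γ)) : crossing γ N r x = Circle.exp Real.pi := by
  unfold crossing
  split_ifs with h1 h2
  · rw [le_antisymm (h.eq_of_mem_collar hr h1).1 hx]; congr 1; field_simp
  · rw [le_antisymm (h.neg.eq_of_mem_collar hr h2).1 hx, ← circle_exp_neg_pi]; congr 1; field_simp
  · rfl

lemma continuous_crossing (h : NormalFrame γ N τ) {r : ℝ} (hr0 : 0 < r) (hr : r < τ) :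
    Continuous (crossing γ N r) := by
  have hd : Continuous fun x : Plane => Metric.infDist x (range γ) := Metric.continuous_infDist_pt _
  have c1 : ContinuousOn (crossing γ N r) (collar γ N r) := by
    refine ContinuousOn.congr (f := fun x => Circle.exp (Real.pi * Metric.infDist x (range γ) / r))
      (by fun_prop) fun x hx => ?_
    unfold crossing; rw [if_pos hx]
  have c2 : ContinuousOn (crossing γ N r) (collar γ (fun s => -N s) r) := by
    refine ContinuousOn.congr
      (f := fun x => Circle.exp (-(Real.pi * Metric.infDist x (range γ) / r)))
      (by fun_prop) fun x hx => h.crossing_of_mem_neg hr hx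
  have c3 : ContinuousOn (crossing γ N r) {x | r ≤ Metric.infDist x (range γ)} :=
    ContinuousOn.congr continuousOn_const fun x hx => h.crossing_of_le hr0 hr hx
  have c4 := (c1.union_of_isClosed c2 (h.isCompact_collar r).isClosed
    (h.neg.isCompact_collar r).isClosed).union_of_isClosed c3
    ((h.isCompact_collar r).isClosed.union (h.neg.isCompact_collar r).isClosed)
    (isClosed_le continuous_const hd)
  rw [← continuousOn_univ]
  refine c4.mono fun x _ => ?_
  rcases le_total (Metric.infDist x (range γ)) r with hx | hx
  · exact Or.inl (h.mem_collar_or hx)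
  · exact Or.inr hx

lemma circle_exp_eq_one_iff_mem {a : ℝ} (ha : -Real.pi ≤ a) (ha' : a ≤ Real.pi) :
    Circle.exp a = 1 ↔ a = 0 := by
  have hpi := Real.pi_pos
  constructor
  · intro h
    rw [Circle.exp_eq_one] at h
    obtain ⟨n, hn⟩ := h
    have h1 : (-1 : ℝ) < n := by nlinarith
    have h2 : (n : ℝ) < 1 := by nlinarith
    have h3 : n = 0 := by
      have : (-1 : ℤ) < n := by exact_mod_cast h1
      have : n < (1 : ℤ) := by exact_mod_cast h2
      omega
    simp [hn, h3]
  · rintro rfl; simp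

/-- A function on a preconnected set that takes values in `2πℤ` is constant. -/
lemma eq_of_circle_exp_eq_one {K : Set Plane} (hK : IsPreconnected K) {g : Plane → ℝ}
    (hg : ContinuousOn g K) (h1 : ∀ x ∈ K, Circle.exp (g x) = 1) {x y : Plane} (hx : x ∈ K)
    (hy : y ∈ K) : g x = g y := by
  have hpi := Real.pi_pos
  obtain ⟨n, hn⟩ := Circle.exp_eq_one.1 (h1 x hx)
  obtain ⟨m, hm⟩ := Circle.exp_eq_one.1 (h1 y hy)
  by_contra hne
  wlog hlt : g x < g y generalizing x y n m
  · exact this hy hx m hm n hn (Ne.symm hne) (lt_of_le_of_ne (not_lt.1 hlt) (Ne.symm hne))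
  have hnm : n < m := by
    rw [hn, hm] at hlt
    have : (n : ℝ) < m := lt_of_mul_lt_mul_right hlt (by positivity)
    exact_mod_cast this
  have hnm' : (n : ℝ) + 1 ≤ m := by exact_mod_cast hnm
  have hmem : g x + Real.pi ∈ Icc (g x) (g y) := by
    refine ⟨by linarith, ?_⟩
    rw [hn, hm]; nlinarith
  obtain ⟨z, hz, hzg⟩ := hK.intermediate_value hx hy hg hmem
  have h2 := h1 z hz
  rw [hzg, Circle.exp_add, h1 x hx, one_mul,
    circle_exp_eq_one_iff_mem (by linarith) le_rfl] at h2
  linarith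

/-- A connected set that meets both sides of the curve meets the curve. -/
theorem exists_mem_range_of_isPreconnected (h : NormalFrame γ N τ) {s t s' t' : ℝ} (ht : 0 < t)
    (htτ : t < τ) (ht' : 0 < t') (htτ' : t' < τ) {K : Set Plane} (hK : IsPreconnected K)
    (hx : γ s + t • N s ∈ K) (hx' : γ s' + (-t') • N s' ∈ K) : ∃ z ∈ K, z ∈ range γ := by
  obtain ⟨r, hr1, hr⟩ := exists_between (max_lt htτ htτ')
  have hr0 : 0 < r := lt_of_lt_of_le ht ((le_max_left _ _).trans hr1.le)
  have htr : t ≤ r := (le_max_left _ _).trans hr1.le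
  have htr' : t' ≤ r := (le_max_right _ _).trans hr1.le
  have hpi := Real.pi_pos
  -- The plane is simply connected, so `crossing` has a global real argument. On the collar of `N`
  -- it must equal `Θ (γ 0) + π d / r`, on the opposite collar `Θ (γ 0) - π d / r`; thus the two
  -- given points have arguments on either side of `Θ (γ 0)`.
  obtain ⟨Θ, hΘ, hΘe⟩ := exists_continuous_arg (h.continuous_crossing hr0 hr)
  have hd : Continuous fun x : Plane => Metric.infDist x (range γ) := Metric.continuous_infDist_pt _
  set d := fun x : Plane => Metric.infDist x (range γ) with hdd
  have hd0 : ∀ s, d (γ s) = 0 := fun s => Metric.infDist_zero_of_mem ⟨s, rfl⟩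
  have e1 : ∀ x ∈ collar γ N r, Θ x - Real.pi * d x / r = Θ (γ 0) := by
    intro x hx
    have h0 : γ 0 ∈ collar γ N r := by simpa using h.mem_collar 0 le_rfl hr0.le
    have := eq_of_circle_exp_eq_one (h.isPreconnected_collar r)
      (g := fun x => Θ x - Real.pi * d x / r) (by fun_prop) (fun y hy => by
        rw [Circle.exp_sub, hΘe]; unfold crossing; rw [if_pos hy, div_self']) hx h0
    simpa [hd0] using this
  have e2 : ∀ x ∈ collar γ (fun s => -N s) r, Θ x + Real.pi * d x / r = Θ (γ 0) := by
    intro x hx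
    have h0 : γ 0 ∈ collar γ (fun s => -N s) r := by simpa using h.neg.mem_collar 0 le_rfl hr0.le
    have := eq_of_circle_exp_eq_one (h.neg.isPreconnected_collar r)
      (g := fun x => Θ x + Real.pi * d x / r) (by fun_prop) (fun y hy => by
        rw [Circle.exp_add, hΘe, h.crossing_of_mem_neg hr hy, ← Circle.exp_add]; simp [hdd]) hx h0
    simpa [hd0] using this
  have f1 := e1 _ (h.mem_collar s ht.le htr)
  have f2 := e2 (γ s' + (-t') • N s') (by
    rw [neg_smul, ← smul_neg]; exact h.neg.mem_collar s' ht'.le htr')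
  have g1 : d (γ s + t • N s) = t := by
    simp only [hdd]; rw [h.infDist_add_smul s (by rw [abs_of_pos ht]; exact htτ.le), abs_of_pos ht]
  have g2 : d (γ s' + (-t') • N s') = t' := by
    simp only [hdd]
    rw [h.infDist_add_smul s' (by rw [abs_neg, abs_of_pos ht']; exact htτ'.le), abs_neg,
      abs_of_pos ht']
  rw [g1] at f1
  rw [g2] at f2
  have p1 : 0 < Real.pi * t / r := by positivity
  have p2 : 0 < Real.pi * t' / r := by positivity
  -- A point of `K` with argument `Θ (γ 0)` has `crossing` equal to `1`, which happens only on the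
  -- curve.
  obtain ⟨z, hz, hzΘ⟩ := hK.intermediate_value hx' hx hΘ.continuousOn
    (show Θ (γ 0) ∈ _ from ⟨by linarith, by linarith⟩)
  refine ⟨z, hz, ?_⟩
  have hθz : crossing γ N r z = 1 := by
    rw [← hΘe, hzΘ, hΘe]
    have h0 : γ 0 ∈ collar γ N r := by simpa using h.mem_collar 0 le_rfl hr0.le
    unfold crossing
    rw [if_pos h0, Metric.infDist_zero_of_mem (mem_range_self 0)]; simp
  have hclosed := h.isCompact_range.isClosed
  rw [hclosed.mem_iff_infDist_zero (range_nonempty γ)]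
  have hnn : 0 ≤ d z := Metric.infDist_nonneg
  rcases le_total (d z) r with hzr | hzr
  · have b : Real.pi * d z / r ≤ Real.pi := by
      rw [div_le_iff₀ hr0]; nlinarith
    have b0 : 0 ≤ Real.pi * d z / r := by positivity
    have key : Real.pi * d z / r = 0 := by
      rcases h.mem_collar_or hzr with hc | hc
      · unfold crossing at hθz
        rw [if_pos hc] at hθz
        exact (circle_exp_eq_one_iff_mem (by linarith) b).1 hθz
      · rw [h.crossing_of_mem_neg hr hc] at hθz
        have := (circle_exp_eq_one_iff_mem (a := -(Real.pi * d z / r)) (by linarith)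
          (by linarith)).1 hθz
        linarith
    rw [div_eq_zero_iff, mul_eq_zero] at key
    rcases key with (h1 | h1) | h1
    · linarith
    · exact h1
    · linarith
  · rw [h.crossing_of_le hr0 hr hzr,
      circle_exp_eq_one_iff_mem (by linarith) le_rfl] at hθz
    linarith

end NormalFrame

/-! ### Unions of balls around a dense sample of a tube -/

/-- `Y` is a finite `ε / 2`-net of points in the closed `σ`-tube around the curve `γ`, with `ε`
small. -/
structure Sample (γ N : ℝ → Plane) (τ σ ε : ℝ) (Y : Finset Plane) : Prop where
  frame : NormalFrame γ N τ
  pos : 0 < ε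
  le : ε ≤ σ
  small : 16 * ε ≤ τ - σ
  subset : ∀ c ∈ Y, Metric.infDist c (range γ) ≤ σ
  dense : ∀ x, Metric.infDist x (range γ) ≤ σ → ∃ c ∈ Y, dist x c ≤ ε / 2

namespace Sample
variable {γ N : ℝ → Plane} {τ σ ε : ℝ} {Y : Finset Plane}

lemma neg (h : Sample γ N τ σ ε Y) : Sample γ (fun s => -N s) τ σ ε Y :=
  ⟨h.frame.neg, h.pos, h.le, h.small, h.subset, h.dense⟩

lemma tube_pos (h : Sample γ N τ σ ε Y) : 0 < σ := h.pos.trans_le h.le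

lemma nonempty (h : Sample γ N τ σ ε Y) : (Y : Set Plane).Nonempty := by
  obtain ⟨c, hc, -⟩ := h.dense (γ 0)
    (by rw [Metric.infDist_zero_of_mem (mem_range_self 0)]; exact h.tube_pos.le)
  exact ⟨c, hc⟩

lemma exists_dist_eq (h : Sample γ N τ σ ε Y) (x : Plane) :
    ∃ c ∈ Y, dist x c = Metric.infDist x Y := by
  obtain ⟨c, hc, hd⟩ := Y.finite_toSet.isCompact.exists_infDist_eq_dist h.nonempty x
  exact ⟨c, hc, hd.symm⟩

lemma infDist_le {x c : Plane} (hc : c ∈ Y) : Metric.infDist x (Y : Set Plane) ≤ dist x c :=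
  Metric.infDist_le_dist_of_mem (Finset.mem_coe.2 hc)

lemma iUnion_closedBall_eq (h : Sample γ N τ σ ε Y) :
    ⋃ c ∈ Y, Metric.closedBall c ε = {x | Metric.infDist x (Y : Set Plane) ≤ ε} := by
  ext x
  simp only [mem_iUnion, Metric.mem_closedBall, exists_prop, mem_ofPred_eq]
  constructor
  · rintro ⟨c, hc, hx⟩; exact (infDist_le hc).trans hx
  · intro hx
    obtain ⟨c, hc, hd⟩ := h.exists_dist_eq x
    exact ⟨c, hc, hd.trans_le hx⟩

lemma sub_le_infDist (h : Sample γ N τ σ ε Y) (x : Plane) :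
    Metric.infDist x (range γ) - σ ≤ Metric.infDist x (Y : Set Plane) := by
  obtain ⟨c, hc, hd⟩ := h.exists_dist_eq x
  have h1 := Metric.infDist_le_infDist_add_dist (s := range γ) (x := x) (y := c)
  linarith [h.subset c hc]

lemma infDist_le_add (h : Sample γ N τ σ ε Y) {x y : Plane}
    (hy : Metric.infDist y (range γ) ≤ σ) :
    Metric.infDist x (Y : Set Plane) ≤ dist x y + ε / 2 := by
  obtain ⟨c, hc, hd⟩ := h.dense y hy
  exact (infDist_le hc).trans ((dist_triangle x y c).trans (by linarith))

lemma dist_add_smul (h : Sample γ N τ σ ε Y) (s t t' : ℝ) :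
    dist (γ s + t • N s) (γ s + t' • N s) = |t - t'| := by
  rw [dist_eq_norm, add_sub_add_left_eq_sub, ← sub_smul, norm_smul, h.frame.norm_eq, mul_one,
    Real.norm_eq_abs]

/-- Sample points within `ε` of a point outside the tube lie essentially below it. -/
lemma inner_le (h : Sample γ N τ σ ε Y) {s t : ℝ} {c : Plane} (hc : c ∈ Y) (ht : σ ≤ t)
    (ht' : t ≤ σ + ε) (hd : dist (γ s + t • N s) c ≤ ε) :
    inner ℝ (N s) (c - γ s) ≤ σ + ε / 8 := by
  have hτ := h.frame.radius_pos
  have hε := h.pos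
  have hs := h.small
  -- The centre of the tangent disc is at distance `τ` from the curve, while `c` is within `σ` of
  -- it.
  have h1 : τ - σ ≤ ‖γ s + τ • N s - c‖ := by
    have e1 := h.frame.infDist_add_smul s (t := τ) (by rw [abs_of_pos hτ])
    have e2 := Metric.infDist_le_infDist_add_dist (s := range γ) (x := γ s + τ • N s) (y := c)
    rw [e1, abs_of_pos hτ, dist_eq_norm] at e2
    linarith [h.subset c hc]
  have h2 : ‖γ s + σ • N s - c‖ ≤ 2 * ε := by
    rw [← dist_eq_norm]
    refine (dist_triangle _ (γ s + t • N s) c).trans ?_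
    rw [h.dist_add_smul, abs_sub_comm, abs_of_nonneg (by linarith)]
    linarith
  have h1' := pow_le_pow_left₀ (by linarith) h1 2
  have h2' := pow_le_pow_left₀ (norm_nonneg _) h2 2
  rw [h.frame.norm_sq_add_smul_sub] at h1' h2'
  set a := inner ℝ (N s) (c - γ s)
  -- Subtracting the two expansions eliminates `‖c - γ s‖ ^ 2`; the requirement `16 * ε ≤ τ - σ`
  -- then yields the margin `ε / 8`.
  have h3 : 2 * (τ - σ) * (a - σ) ≤ 4 * ε ^ 2 := by nlinarith
  by_contra hlt
  push Not at hlt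
  have h4 : 2 * (16 * ε) * (ε / 8) < 2 * (τ - σ) * (a - σ) := by
    apply mul_lt_mul' (by linarith) (by linarith) (by positivity) (by linarith)
  nlinarith

/-- Below height `σ + ε / 2` the density of the sample suffices. Above it, the sample point nearest
to the outer point has normal coordinate at most `σ + ε / 8`, so descending along the normal brings
it closer. This strict crossing of the level `ε` makes the boundary a graph. -/
lemma infDist_lt_of_lt (h : Sample γ N τ σ ε Y) {s t t' : ℝ} (ht : 0 ≤ t) (htt' : t < t')
    (ht'τ : t' ≤ τ) (hd : Metric.infDist (γ s + t' • N s) (Y : Set Plane) ≤ ε) :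
    Metric.infDist (γ s + t • N s) (Y : Set Plane) < ε := by
  have hε := h.pos
  have hσ := h.tube_pos
  have hs := h.small
  rcases lt_or_ge t (σ + ε / 2) with h1 | h1
  · rcases le_or_gt t σ with h2 | h2
    · have := h.infDist_le_add (x := γ s + t • N s) (y := γ s + t • N s) (by
        rw [h.frame.infDist_add_smul s (by rw [abs_of_nonneg ht]; linarith), abs_of_nonneg ht]
        exact h2)
      rw [dist_self] at this
      linarith
    · have := h.infDist_le_add (x := γ s + t • N s) (y := γ s + σ • N s) (by
        rw [h.frame.infDist_add_smul s (by rw [abs_of_pos hσ]; linarith), abs_of_pos hσ])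
      rw [h.dist_add_smul, abs_of_pos (by linarith)] at this
      linarith
  · obtain ⟨c, hc, hcd⟩ := h.exists_dist_eq (γ s + t' • N s)
    have h3 := h.sub_le_infDist (γ s + t' • N s)
    rw [h.frame.infDist_add_smul s (by rw [abs_of_nonneg (by linarith)]; linarith),
      abs_of_nonneg (by linarith)] at h3
    have h4 := h.inner_le hc (by linarith) (by linarith) (hcd.trans_le hd)
    refine (infDist_le hc).trans_lt (lt_of_lt_of_le ?_ (hcd.trans_le hd))
    rw [dist_eq_norm, dist_eq_norm, ← sq_lt_sq₀ (norm_nonneg _) (norm_nonneg _),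
      h.frame.norm_sq_add_smul_sub, h.frame.norm_sq_add_smul_sub]
    nlinarith

lemma exists_height (h : Sample γ N τ σ ε Y) (s : ℝ) :
    ∃ t ∈ Icc (σ + ε / 2) (σ + ε), Metric.infDist (γ s + t • N s) (Y : Set Plane) = ε := by
  have hε := h.pos
  have hσ := h.tube_pos
  have hs := h.small
  have hc : Continuous fun t : ℝ => Metric.infDist (γ s + t • N s) (Y : Set Plane) :=
    (Metric.continuous_infDist_pt _).comp (by fun_prop)
  have e1 : ∀ t, σ ≤ t →
      Metric.infDist (γ s + t • N s) (Y : Set Plane) ≤ (t - σ) + ε / 2 := by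
    intro t ht
    have := h.infDist_le_add (x := γ s + t • N s) (y := γ s + σ • N s) (by
      rw [h.frame.infDist_add_smul s (by rw [abs_of_pos hσ]; linarith), abs_of_pos hσ])
    rwa [h.dist_add_smul, abs_of_nonneg (by linarith)] at this
  have e2 : ∀ t, σ ≤ t → t ≤ τ →
      t - σ ≤ Metric.infDist (γ s + t • N s) (Y : Set Plane) := by
    intro t ht ht'
    have := h.sub_le_infDist (γ s + t • N s)
    rwa [h.frame.infDist_add_smul s (by rw [abs_of_nonneg (by linarith)]; linarith),
      abs_of_nonneg (by linarith)] at this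
  obtain ⟨t, ht, htd⟩ := intermediate_value_Icc (a := σ) (b := σ + 2 * ε) (by linarith)
    hc.continuousOn (show ε ∈ _ from ⟨by linarith [e1 σ le_rfl], by
      linarith [e2 (σ + 2 * ε) (by linarith) (by linarith)]⟩)
  simp only at htd
  refine ⟨t, ⟨?_, ?_⟩, htd⟩
  · linarith [e1 t ht.1]
  · linarith [e2 t ht.1 (by linarith [ht.2])]

/-- The height of the boundary of the union of balls over the foot point `γ s`. -/
noncomputable def height (h : Sample γ N τ σ ε Y) (s : ℝ) : ℝ := (h.exists_height s).choose

lemma height_mem (h : Sample γ N τ σ ε Y) (s : ℝ) : h.height s ∈ Icc (σ + ε / 2) (σ + ε) :=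
  (h.exists_height s).choose_spec.1

lemma height_pos (h : Sample γ N τ σ ε Y) (s : ℝ) : 0 < h.height s := by
  linarith [(h.height_mem s).1, h.pos, h.tube_pos]

lemma height_lt (h : Sample γ N τ σ ε Y) (s : ℝ) : h.height s < τ := by
  linarith [(h.height_mem s).2, h.pos, h.small]

lemma abs_height (h : Sample γ N τ σ ε Y) (s : ℝ) : |h.height s| = h.height s :=
  abs_of_pos (h.height_pos s)

lemma infDist_height (h : Sample γ N τ σ ε Y) (s : ℝ) :
    Metric.infDist (γ s + h.height s • N s) (Y : Set Plane) = ε :=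
  (h.exists_height s).choose_spec.2

lemma eq_height (h : Sample γ N τ σ ε Y) {s t : ℝ} (ht : 0 ≤ t) (htτ : t ≤ τ)
    (hd : Metric.infDist (γ s + t • N s) (Y : Set Plane) = ε) : t = h.height s := by
  rcases lt_trichotomy t (h.height s) with h1 | h1 | h1
  · have := h.infDist_lt_of_lt ht h1 (h.height_lt s).le (h.infDist_height s).le
    linarith
  · exact h1
  · have := h.infDist_lt_of_lt (h.height_pos s).le h1 htτ hd.le
    linarith [h.infDist_height s]

/-- At any fixed height just below or above `height s` the distance to the sample is strictly below
or above `ε`; this persists for nearby feet, whose heights are therefore trapped. -/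
lemma continuous_height (h : Sample γ N τ σ ε Y) : Continuous h.height := by
  have hγ := h.frame.continuous
  have hN := h.frame.continuous_normal
  have hc : ∀ t : ℝ, Continuous fun s => Metric.infDist (γ s + t • N s) (Y : Set Plane) :=
    fun t => (Metric.continuous_infDist_pt _).comp (by fun_prop)
  rw [continuous_iff_continuousAt]
  intro s
  refine tendsto_order.2 ⟨fun a ha => ?_, fun a ha => ?_⟩
  · set b := max a 0
    have hb : b < h.height s := max_lt ha (h.height_pos s)
    have h1 := h.infDist_lt_of_lt (le_max_right a 0) hb (h.height_lt s).le (h.infDist_height s).le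
    filter_upwards [(hc b).continuousAt.eventually (gt_mem_nhds h1)] with s' hs'
    refine (le_max_left a 0).trans_lt (lt_of_not_ge fun hle => ?_)
    rcases hle.eq_or_lt with h2 | h2
    · have := h.infDist_height s'
      rw [h2] at this; linarith
    · exact absurd (h.infDist_lt_of_lt (h.height_pos s').le h2 (hb.le.trans (h.height_lt s).le)
        hs'.le) (by rw [h.infDist_height s']; exact lt_irrefl _)
  · set b := min a τ
    have hb : h.height s < b := lt_min ha (h.height_lt s)
    have h1 : ε < Metric.infDist (γ s + b • N s) (Y : Set Plane) := by
      by_contra hle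
      push Not at hle
      have := h.infDist_lt_of_lt (h.height_pos s).le hb (min_le_right a τ) hle
      linarith [h.infDist_height s]
    filter_upwards [(hc b).continuousAt.eventually (lt_mem_nhds h1)] with s' hs'
    refine lt_of_lt_of_le (lt_of_not_ge fun hle => ?_) (min_le_left a τ)
    rcases hle.eq_or_lt with h2 | h2
    · have := h.infDist_height s'
      rw [← h2] at this; linarith
    · have := h.infDist_lt_of_lt ((h.height_pos s).le.trans hb.le) h2 (h.height_lt s').le
        (h.infDist_height s').le
      linarith

lemma periodic_height (h : Sample γ N τ σ ε Y) : Function.Periodic h.height 1 := by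
  intro s
  refine h.eq_height (h.height_pos _).le (h.height_lt _).le ?_
  have := h.infDist_height (s + 1)
  rwa [h.frame.periodic s, h.frame.periodic_normal s] at this

/-- The boundary curve of the union of balls on the side of `N`. -/
noncomputable def edge (h : Sample γ N τ σ ε Y) (s : ℝ) : Plane := γ s + h.height s • N s

lemma continuous_edge (h : Sample γ N τ σ ε Y) : Continuous h.edge := by
  have hγ := h.frame.continuous
  have hN := h.frame.continuous_normal
  have := h.continuous_height
  unfold edge
  fun_prop

lemma periodic_edge (h : Sample γ N τ σ ε Y) : Function.Periodic h.edge 1 := by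
  intro s
  simp only [edge, h.periodic_height s, h.frame.periodic s, h.frame.periodic_normal s]

lemma infDist_edge (h : Sample γ N τ σ ε Y) (s : ℝ) :
    Metric.infDist (h.edge s) (Y : Set Plane) = ε := h.infDist_height s

lemma infDist_edge_range (h : Sample γ N τ σ ε Y) (s : ℝ) :
    Metric.infDist (h.edge s) (range γ) = h.height s := by
  rw [edge, h.frame.infDist_add_smul s (by rw [h.abs_height]; exact (h.height_lt s).le),
    h.abs_height]

lemma isSimpleClosedCurve_edge (h : Sample γ N τ σ ε Y) : IsSimpleClosedCurve h.edge := by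
  refine ⟨h.continuous_edge.continuousOn, ?_, ?_⟩
  · simpa using (h.periodic_edge 0).symm
  · intro s hs s' hs' he
    exact h.frame.injOn hs hs' (h.frame.add_smul_injective
      (by rw [h.abs_height]; exact h.height_lt s) (by rw [h.abs_height]; exact h.height_lt s') he).1

lemma trace_edge (h : Sample γ N τ σ ε Y) : trace h.edge = range h.edge :=
  (range_eq_image_Icc h.periodic_edge).symm

lemma isCompact_range_edge (h : Sample γ N τ σ ε Y) : IsCompact (range h.edge) := by
  rw [range_eq_image_Icc h.periodic_edge]; exact isCompact_Icc.image h.continuous_edge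

lemma edge_neg (h : Sample γ N τ σ ε Y) (s : ℝ) :
    h.neg.edge s = γ s + (-h.neg.height s) • N s := by
  simp [edge]

lemma disjoint_range_edge (h : Sample γ N τ σ ε Y) :
    Disjoint (range h.edge) (range h.neg.edge) := by
  rw [Set.disjoint_left]
  rintro _ ⟨s, rfl⟩ ⟨s', hs'⟩
  rw [h.edge_neg] at hs'
  have := (h.frame.add_smul_injective (by rw [abs_neg, h.neg.abs_height]; exact h.neg.height_lt s')
    (by rw [h.abs_height]; exact h.height_lt s) hs').2
  linarith [h.height_pos s, h.neg.height_pos s']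

lemma mem_range_edge_of_infDist_eq (h : Sample γ N τ σ ε Y) {x : Plane}
    (hx : Metric.infDist x (Y : Set Plane) = ε) : x ∈ range h.edge ∪ range h.neg.edge := by
  have hτ : Metric.infDist x (range γ) ≤ τ := by
    linarith [h.sub_le_infDist x, h.small, h.pos]
  obtain ⟨s, hs | hs⟩ := h.frame.exists_foot_nonneg_or x
  · left
    refine ⟨s, ?_⟩
    have := h.eq_height Metric.infDist_nonneg hτ (by rw [← hs]; exact hx)
    rw [edge, ← this, ← hs]
  · right
    rw [neg_smul, ← smul_neg] at hs
    refine ⟨s, ?_⟩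
    have := h.neg.eq_height Metric.infDist_nonneg hτ (by rw [← hs]; exact hx)
    rw [edge, ← this, ← hs]

lemma edge_mem_frontier (h : Sample γ N τ σ ε Y) (s : ℝ) :
    h.edge s ∈ frontier {x | Metric.infDist x (Y : Set Plane) ≤ ε} := by
  refine ⟨subset_closure (h.infDist_edge s).le, fun hint => ?_⟩
  have hc : Continuous fun t : ℝ => γ s + t • N s := by fun_prop
  have hn : (fun t : ℝ => γ s + t • N s) ⁻¹' {x | Metric.infDist x (Y : Set Plane) ≤ ε} ∈
      𝓝 (h.height s) := hc.continuousAt (mem_interior_iff_mem_nhds.1 hint)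
  have h2 : ∀ᶠ t in 𝓝[>] h.height s, t ∈ Ioo (h.height s) τ :=
    Ioo_mem_nhdsGT (h.height_lt s)
  have h3 : ∀ᶠ t in 𝓝[>] h.height s,
      γ s + t • N s ∈ {x | Metric.infDist x (Y : Set Plane) ≤ ε} := nhdsWithin_le_nhds hn
  obtain ⟨t, ht, ht'⟩ := (h3.and h2).exists
  have := h.infDist_lt_of_lt (h.height_pos s).le ht'.1 ht'.2.le ht
  linarith [h.infDist_height s]

lemma frontier_eq (h : Sample γ N τ σ ε Y) :
    frontier (⋃ c ∈ Y, Metric.closedBall c ε) = range h.edge ∪ range h.neg.edge := by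
  rw [h.iUnion_closedBall_eq]
  apply Subset.antisymm
  · intro x hx
    exact h.mem_range_edge_of_infDist_eq
      (frontier_le_subset_eq (Metric.continuous_infDist_pt _) continuous_const hx)
  · rintro _ (⟨s, rfl⟩ | ⟨s, rfl⟩)
    · exact h.edge_mem_frontier s
    · exact h.neg.edge_mem_frontier s

lemma isBoundaryPair (h : Sample γ N τ σ ε Y) :
    IsBoundaryPair (⋃ c ∈ Y, Metric.closedBall c ε) h.edge h.neg.edge :=
  ⟨h.isSimpleClosedCurve_edge, h.neg.isSimpleClosedCurve_edge,
    by rw [h.trace_edge, h.neg.trace_edge]; exact h.disjoint_range_edge,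
    by rw [h.trace_edge, h.neg.trace_edge, h.frontier_eq]⟩

end Sample

/-! ### Uniqueness of the pair of boundary curves -/

lemma IsSimpleClosedCurve.isCompact_trace {g : ℝ → Plane} (h : IsSimpleClosedCurve g) :
    IsCompact (trace g) := isCompact_Icc.image_of_continuousOn h.continuousOn

lemma IsSimpleClosedCurve.isPreconnected_trace {g : ℝ → Plane} (h : IsSimpleClosedCurve g) :
    IsPreconnected (trace g) := isPreconnected_Icc.image _ h.continuousOn

lemma trace_nonempty (g : ℝ → Plane) : (trace g).Nonempty := ⟨g 0, 0, by simp, rfl⟩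

/-- A connected subset of the union of two disjoint closed sets lies in one of them. -/
lemma IsBoundaryPair.subset_or {S : Set Plane} {g₀ g₁ k : ℝ → Plane} (h : IsBoundaryPair S g₀ g₁)
    (hk : IsSimpleClosedCurve k) (hkS : trace k ⊆ frontier S) :
    trace k ⊆ trace g₀ ∨ trace k ⊆ trace g₁ :=
  isPreconnected_iff_subset_of_disjoint_closed.1 hk.isPreconnected_trace _ _
    h.simple₀.isCompact_trace.isClosed h.simple₁.isCompact_trace.isClosed
    (h.union ▸ hkS) (by rw [h.disjoint.inter_eq, inter_empty])

/-- The two boundary curves are determined up to order. -/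
lemma IsBoundaryPair.trace_eq {S : Set Plane} {g₀ g₁ k₀ k₁ : ℝ → Plane}
    (h : IsBoundaryPair S g₀ g₁) (hk : IsBoundaryPair S k₀ k₁) :
    trace g₀ = trace k₀ ∧ trace g₁ = trace k₁ ∨ trace g₀ = trace k₁ ∧ trace g₁ = trace k₀ := by
  have s0 : trace g₀ ⊆ frontier S := h.union ▸ subset_union_left
  have s1 : trace g₁ ⊆ frontier S := h.union ▸ subset_union_right
  have t0 : trace k₀ ⊆ frontier S := hk.union ▸ subset_union_left
  have t1 : trace k₁ ⊆ frontier S := hk.union ▸ subset_union_right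
  have key : ∀ {A B : Set Plane}, Disjoint A B → ∀ k, trace k ⊆ A → trace k ⊆ B → False := by
    intro A B hAB k hA hB
    obtain ⟨x, hx⟩ := trace_nonempty k
    exact Set.disjoint_left.1 hAB (hA hx) (hB hx)
  have hu : trace g₀ ∪ trace g₁ = trace k₀ ∪ trace k₁ := h.union.trans hk.union.symm
  rcases hk.subset_or h.simple₀ s0 with a | a <;> rcases hk.subset_or h.simple₁ s1 with b | b
  -- If both `g`-curves lay in `trace k₀`, so would `trace k₁`, against disjointness.
  · rcases h.subset_or hk.simple₁ t1 with c | c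
    · exact (key hk.disjoint k₁ (c.trans a) Subset.rfl).elim
    · exact (key hk.disjoint k₁ (c.trans b) Subset.rfl).elim
  · left
    refine ⟨a.antisymm ?_, b.antisymm ?_⟩
    · exact (h.subset_or hk.simple₀ t0).resolve_right
        fun c => key hk.disjoint k₀ Subset.rfl (c.trans b)
    · exact (h.subset_or hk.simple₁ t1).resolve_left
        fun c => key hk.disjoint k₁ (c.trans a) Subset.rfl
  · right
    refine ⟨a.antisymm ?_, b.antisymm ?_⟩
    · exact (h.subset_or hk.simple₁ t1).resolve_right
        fun c => key hk.disjoint k₁ (c.trans b) Subset.rfl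
    · exact (h.subset_or hk.simple₀ t0).resolve_left
        fun c => key hk.disjoint k₀ Subset.rfl (c.trans a)
  · rcases h.subset_or hk.simple₀ t0 with c | c
    · exact (key hk.disjoint k₀ Subset.rfl (c.trans a)).elim
    · exact (key hk.disjoint k₀ Subset.rfl (c.trans b)).elim

/-! ### Closest points are vertices -/

/-- `v` is a closest point of `B` to `y`. -/
def IsNearest (B : Set Plane) (y v : Plane) : Prop := v ∈ B ∧ ∀ z ∈ B, dist y v ≤ dist y z

namespace Sample
variable {γ N : ℝ → Plane} {τ σ ε : ℝ} {Y : Finset Plane}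

/-- The competitor is the opposite boundary point over the same foot; each of the two heights is at
most `σ + ε`. -/
lemma dist_le_of_isNearest (h : Sample γ N τ σ ε Y) {s : ℝ} {p : Plane}
    (hp : IsNearest (range h.neg.edge) (h.edge s) p) : dist (h.edge s) p ≤ 2 * σ + 2 * ε := by
  refine (hp.2 _ (mem_range_self s)).trans ?_
  rw [h.edge_neg, edge, h.dist_add_smul, sub_neg_eq_add,
    abs_of_pos (add_pos (h.height_pos s) (h.neg.height_pos s))]
  linarith [(h.height_mem s).2, (h.neg.height_mem s).2]

/-- A short segment between the two boundary curves crosses `γ` near its midpoint. -/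
lemma exists_crossing (h : Sample γ N τ σ ε Y) {s : ℝ} {p : Plane} (hp : p ∈ range h.neg.edge)
    (hd : dist (h.edge s) p ≤ 2 * σ + 2 * ε) : ∃ z ∈ range γ, z ∈ segment ℝ (h.edge s) p ∧
      dist (h.edge s) z ≤ σ + 2 * ε ∧ dist z p ≤ σ + 2 * ε ∧
      dist (midpoint ℝ (h.edge s) p) z ≤ ε := by
  obtain ⟨s', rfl⟩ := hp
  set y := h.edge s with hy
  set p := h.neg.edge s' with hp
  have hpre : IsPreconnected (segment ℝ y p) := (convex_segment y p).isPreconnected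
  obtain ⟨z, hz, hzΓ⟩ := h.frame.exists_mem_range_of_isPreconnected (h.height_pos s)
    (h.height_lt s) (h.neg.height_pos s') (h.neg.height_lt s') hpre
    (left_mem_segment ℝ y p) (by rw [← h.edge_neg]; exact right_mem_segment ℝ y p)
  -- Each end is at least `σ` away from the curve, so a crossing point splits a segment of length at
  -- most `2 * σ + 2 * ε` almost evenly.
  have h1 : σ ≤ dist y z := by
    refine le_trans ?_ (Metric.infDist_le_dist_of_mem hzΓ)
    rw [hy, h.infDist_edge_range]; linarith [(h.height_mem s).1, h.pos]
  have h2 : σ ≤ dist z p := by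
    rw [dist_comm]
    refine le_trans ?_ (Metric.infDist_le_dist_of_mem hzΓ)
    rw [hp, h.neg.infDist_edge_range]; linarith [(h.neg.height_mem s').1, h.pos]
  have h3 := dist_add_dist_of_mem_segment hz
  refine ⟨z, hzΓ, hz, by linarith, by linarith, ?_⟩
  obtain ⟨θ, hθ, rfl⟩ := (segment_eq_image_lineMap ℝ y p ▸ hz)
  rw [midpoint, dist_lineMap_lineMap]
  rw [dist_left_lineMap] at h1
  rw [dist_lineMap_right] at h2
  rw [Real.norm_of_nonneg hθ.1] at h1
  rw [Real.norm_of_nonneg (by linarith [hθ.2])] at h2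
  rw [Real.dist_eq]
  simp only [invOf_eq_inv]
  rw [← abs_of_nonneg (dist_nonneg (x := y) (y := p)), ← abs_mul, abs_le]
  constructor <;> nlinarith

/-- Suppose `p` is on one circle only, with centre `c`. Near `p` that circle belongs to the opposite
boundary curve, so `p` locally minimizes the distance from `y` along the circle; hence `y` lies on
the ray from `c` through `p`, beyond `p`. But `c` lies lower than `p` over the foot of `p`, so the
segment from `p` to `y` sets out with nonnegative outward component. It cannot then reach the curve
within `σ + 2 * ε`, as `exists_crossing` requires, without entering a tangent disc of radius `τ`. -/
lemma mem_cocircle_of_isNearest (h : Sample γ N τ σ ε Y) {s : ℝ} {p : Plane}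
    (hp : IsNearest (range h.neg.edge) (h.edge s) p) :
    ∃ c ∈ Y, ∃ c' ∈ Y, c ≠ c' ∧ dist p c = ε ∧ dist p c' = ε := by
  have hε := h.pos
  have hσ := h.tube_pos
  have hs := h.small
  have hsl := h.le
  have hDp : Metric.infDist p (Y : Set Plane) = ε := by
    obtain ⟨s', rfl⟩ := hp.1; exact h.neg.infDist_edge s'
  obtain ⟨c, hc, hpc⟩ := h.exists_dist_eq p
  rw [hDp] at hpc
  by_contra hno
  push Not at hno
  have hgt : ∀ c' ∈ Y, c' ≠ c → ε < dist p c' := fun c' hc' hne =>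
    lt_of_le_of_ne (hDp ▸ infDist_le hc') (Ne.symm (hno c hc c' hc' hne.symm hpc))
  have ev1 : ∀ᶠ q in 𝓝 p, ∀ c' ∈ Y, c' ≠ c → ε < dist q c' := by
    rw [Filter.eventually_all_finset]
    intro c' hc'
    by_cases hne : c' = c
    · simp [hne]
    · have : ContinuousAt (fun q => dist q c') p := by fun_prop
      filter_upwards [this.eventually (lt_mem_nhds (hgt c' hc' hne))] with q hq _ using hq
  have ev2 : ∀ᶠ q in 𝓝 p, q ∉ range h.edge :=
    h.isCompact_range_edge.isClosed.isOpen_compl.mem_nhds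
      (fun hA => Set.disjoint_left.1 h.disjoint_range_edge hA hp.1)
  set y := h.edge s with hy
  -- Near `p` all other sample points stay farther than `ε` and the near boundary curve is absent,
  -- so points of the circle about `c` are competitors for `p`.
  have ev3 : ∀ᶠ q in 𝓝 p, dist q c = ε → dist y p ≤ dist y q := by
    filter_upwards [ev1, ev2] with q h1 h2 hqc
    refine hp.2 q ((h.mem_range_edge_of_infDist_eq ?_).resolve_left h2)
    refine le_antisymm (hqc ▸ infDist_le hc) ?_
    refine (Metric.le_infDist h.nonempty).2 fun c' hc' => ?_
    by_cases hne : c' = c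
    · rw [hne, hqc]
    · exact (h1 c' hc' hne).le
  set e := ε⁻¹ • (p - c) with he
  have hne : ‖e‖ = 1 := by
    rw [he, norm_smul, ← dist_eq_norm, hpc, norm_inv, Real.norm_of_nonneg hε.le,
      inv_mul_cancel₀ hε.ne']
  have hpe : p = c + ε • e := by
    rw [he, smul_smul, mul_inv_cancel₀ hε.ne', one_smul]; abel
  set q : ℝ → Plane := fun θ => c + ε • (Real.cos θ • e + Real.sin θ • perp e) with hq
  have hq0 : q 0 = p := by simp [hq, hpe]
  have hqc : ∀ θ, dist (q θ) c = ε := by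
    intro θ
    have h1 : ‖Real.cos θ • e + Real.sin θ • perp e‖ ^ 2 = 1 := by
      rw [norm_add_sq_real, norm_smul _ e, norm_smul _ (perp e), norm_perp, hne,
        real_inner_smul_left, real_inner_smul_right, real_inner_comm, inner_perp_self]
      simp
    rw [dist_eq_norm, hq, add_sub_cancel_left, norm_smul, Real.norm_of_nonneg hε.le,
      (pow_eq_one_iff_of_nonneg (norm_nonneg _) two_ne_zero).1 h1, mul_one]
  have hqcont : Continuous q := by
    simp only [hq]; fun_prop
  set a := inner ℝ e (y - c) with ha
  set b := inner ℝ (perp e) (y - c) with hb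
  have hdist : ∀ θ, dist y (q θ) ^ 2 = ‖y - c‖ ^ 2 + ε ^ 2
      - 2 * ε * (a * Real.cos θ + b * Real.sin θ) := by
    intro θ
    have h1 := hqc θ
    rw [dist_eq_norm] at h1
    rw [dist_eq_norm, show y - q θ = (y - c) - (q θ - c) by abel, norm_sub_sq_real, h1,
      real_inner_comm]
    simp only [hq, add_sub_cancel_left, real_inner_smul_left, inner_add_left]
    rw [← ha, ← hb]; ring
  have hmax : ∀ᶠ θ in 𝓝 (0 : ℝ), a * Real.cos θ + b * Real.sin θ ≤ a := by
    have : Tendsto q (𝓝 0) (𝓝 p) := hq0 ▸ hqcont.tendsto 0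
    filter_upwards [this.eventually ev3] with θ hθ
    have h1 := pow_le_pow_left₀ dist_nonneg (hθ (hqc θ)) 2
    rw [hdist, ← hq0, hdist] at h1
    simp only [Real.cos_zero, Real.sin_zero, mul_one, mul_zero, add_zero] at h1
    have h2 : ε * (a * Real.cos θ + b * Real.sin θ) ≤ ε * a := by linarith
    exact le_of_mul_le_mul_left h2 hε
  -- Stationarity at `θ = 0` makes `y - c` parallel to `e`; maximality then fixes its sign, and
  -- emptiness of the open `ε`-disc about each sample point near `y` places it beyond `p`.
  have hb0 : b = 0 := by
    have hd : HasDerivAt (fun θ => a * Real.cos θ + b * Real.sin θ) b 0 := by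
      have := ((Real.hasDerivAt_cos 0).const_mul a).add ((Real.hasDerivAt_sin 0).const_mul b)
      simpa using! this
    have hlm : IsLocalMax (fun θ => a * Real.cos θ + b * Real.sin θ) 0 := by
      filter_upwards [hmax] with θ hθ
      simpa using hθ
    exact hlm.hasDerivAt_eq_zero hd
  have ha0 : 0 ≤ a := by
    have h2 : ∀ᶠ θ in 𝓝[>] (0 : ℝ), θ ∈ Ioo 0 Real.pi := Ioo_mem_nhdsGT Real.pi_pos
    obtain ⟨θ, hθ, hθ'⟩ := ((hmax.filter_mono nhdsWithin_le_nhds).and h2).exists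
    rw [hb0, zero_mul, add_zero] at hθ
    have h3 : Real.cos θ < 1 := by
      rw [← Real.cos_zero]
      exact Real.cos_lt_cos_of_nonneg_of_le_pi le_rfl hθ'.2.le hθ'.1
    nlinarith
  have hyc : y - c = a • e := by
    have := eq_inner_smul_add hne (y - c)
    rwa [← hb, hb0, zero_smul, add_zero] at this
  have haε : ε ≤ a := by
    have h1 : ε ≤ dist y c := by
      rw [← h.infDist_edge s]; exact infDist_le hc
    rwa [dist_eq_norm, hyc, norm_smul, hne, mul_one, Real.norm_of_nonneg ha0] at h1
  have hyp : y - p = (a - ε) • e := by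
    rw [sub_smul, ← hyc, hpe]; abel
  obtain ⟨z, ⟨s'', hzs⟩, hzseg, -, hzp, -⟩ := h.exists_crossing hp.1 (h.dist_le_of_isNearest hp)
  obtain ⟨s', hps⟩ := hp.1
  set ρ := h.neg.height s' with hρ
  have hρm := h.neg.height_mem s'
  have hpρ : p = γ s' + ρ • -N s' := hps.symm
  have hρd : dist (γ s' + ρ • -N s') c ≤ ε := by rw [← hpρ, hpc]
  have hin := h.neg.inner_le hc (by linarith [hρm.1] : σ ≤ ρ) hρm.2 hρd
  -- By `inner_le` the centre `c` has normal coordinate at most `σ + ε / 8`, below the height `ρ ≥ σ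
  -- + ε / 2` of `p`.
  have hcos : 0 ≤ inner ℝ (-N s') e := by
    rw [he, real_inner_smul_right]
    apply mul_nonneg (inv_nonneg.2 hε.le)
    rw [show p - c = ρ • -N s' - (c - γ s') by rw [hpρ]; abel, inner_sub_right,
      real_inner_smul_right, real_inner_self_eq_norm_sq, norm_neg, h.frame.norm_eq]
    linarith [hρm.1]
  rw [segment_symm, segment_eq_image_lineMap] at hzseg
  obtain ⟨μ, hμ, hzμ⟩ := hzseg
  have hzp' : z = p + (μ * (a - ε)) • e := by
    rw [← hzμ, AffineMap.lineMap_apply_module', hyp, smul_smul]; abel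
  set lam := μ * (a - ε) with hlam
  have hlam0 : 0 ≤ lam := mul_nonneg hμ.1 (by linarith)
  have hlamle : lam ≤ σ + 2 * ε := by
    rw [hzp', dist_eq_norm, add_sub_cancel_left, norm_smul, hne, mul_one,
      Real.norm_of_nonneg hlam0] at hzp
    exact hzp
  have hτ := h.frame.radius_pos
  -- The crossing point `z = p + lam • e` avoids the tangent disc on the side of `p`. Since `hcos`
  -- gives the cross term a favourable sign, this yields `τ ^ 2 - (τ - ρ) ^ 2 ≤ lam ^ 2`, impossible
  -- for `lam ≤ σ + 2 * ε`.
  have hfar : τ ^ 2 ≤ ‖γ s' + τ • -N s' - z‖ ^ 2 := by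
    have := h.frame.neg.le_norm_sq s' τ s''
    rw [abs_of_pos hτ, div_self hτ.ne', sub_self, zero_mul, add_zero, hzs] at this
    exact this
  rw [show γ s' + τ • -N s' - z = (τ - ρ) • -N s' - lam • e by
    rw [hzp', hpρ, sub_smul]; abel, norm_sub_sq_real, norm_smul, norm_smul, hne, norm_neg,
    h.frame.norm_eq, real_inner_smul_left, real_inner_smul_right, mul_one, mul_one,
    Real.norm_eq_abs, Real.norm_eq_abs, sq_abs, sq_abs] at hfar
  have hρτ := h.neg.height_lt s'
  have h5 : 0 ≤ (τ - ρ) * (lam * inner ℝ (-N s') e) :=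
    mul_nonneg (by linarith) (mul_nonneg hlam0 hcos)
  have h6 : τ ^ 2 - (τ - ρ) ^ 2 ≤ lam ^ 2 := by linarith
  have h7 : lam ^ 2 ≤ (σ + 2 * ε) ^ 2 := pow_le_pow_left₀ hlam0 hlamle 2
  have h8 : (τ - ρ) ^ 2 ≤ (τ - σ) ^ 2 := pow_le_pow_left₀ (by linarith) (by linarith [hρm.1]) 2
  nlinarith

/-- The points that lie on two of the circles. -/
def vertices (Y : Finset Plane) (ε : ℝ) : Set Plane :=
  {p | ∃ c ∈ Y, ∃ c' ∈ Y, c ≠ c' ∧ dist p c = ε ∧ dist p c' = ε}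

end Sample

lemma finite_of_forall_eq_or_eq {S : Set Plane}
    (h : ∀ p₁ ∈ S, ∀ p₂ ∈ S, p₁ ≠ p₂ → ∀ p ∈ S, p = p₁ ∨ p = p₂) : S.Finite := by
  by_cases hs : S.Subsingleton
  · exact hs.finite
  · rw [Set.not_subsingleton_iff] at hs
    obtain ⟨p₁, h₁, p₂, h₂, hne⟩ := hs
    exact (Set.toFinite {p₁, p₂}).subset fun p hp => h p₁ h₁ p₂ h₂ hne p hp

lemma finite_vertices (Y : Finset Plane) (ε : ℝ) : (Sample.vertices Y ε).Finite := by
  have : Sample.vertices Y ε ⊆ ⋃ q ∈ (Y ×ˢ Y).filter (fun q => q.1 ≠ q.2),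
      {p | dist p q.1 = ε ∧ dist p q.2 = ε} := by
    rintro p ⟨c, hc, c', hc', hne, h1, h2⟩
    simp only [mem_iUnion]
    exact ⟨(c, c'), by simp [hc, hc', hne], h1, h2⟩
  refine (Set.Finite.biUnion (Finset.finite_toSet _) fun q hq => ?_).subset this
  rw [Finset.mem_coe, Finset.mem_filter] at hq
  refine finite_of_forall_eq_or_eq fun p₁ h₁ p₂ h₂ hne p hp => ?_
  exact EuclideanGeometry.eq_of_dist_eq_of_dist_eq_of_finrank_eq_two (by simp) hq.2 hne
    h₁.1 h₂.1 hp.1 h₁.2 h₂.2 hp.2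

/-- A line meets a circle in finitely many points. -/
lemma finite_line_inter_sphere {w : Plane} (hw : w ≠ 0) (k : ℝ) (c : Plane) (ε : ℝ) :
    {y : Plane | inner ℝ w y = k ∧ dist y c = ε}.Finite := by
  set w' := ‖w‖⁻¹ • w with hw'
  have hn : ‖w‖ ≠ 0 := norm_ne_zero_iff.2 hw
  have h1 : ‖w'‖ = 1 := by rw [hw', norm_smul, norm_inv, norm_norm, inv_mul_cancel₀ hn]
  set k' := ‖w‖⁻¹ * k - inner ℝ w' c with hk'
  have hfin : {b : ℝ | b ^ 2 = ε ^ 2 - k' ^ 2}.Finite := by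
    by_cases hne : ∃ b₀ : ℝ, b₀ ^ 2 = ε ^ 2 - k' ^ 2
    · obtain ⟨b₀, h₀⟩ := hne
      refine (Set.toFinite {b₀, -b₀}).subset fun b hb => ?_
      exact sq_eq_sq_iff_eq_or_eq_neg.1 (hb.trans h₀.symm)
    · push Not at hne
      convert Set.finite_empty
      exact Set.eq_empty_of_forall_notMem hne
  refine Set.Finite.of_finite_image (f := fun y => inner ℝ (perp w') (y - c))
    (hfin.subset ?_) ?_
  · rintro _ ⟨y, ⟨hy1, hy2⟩, rfl⟩
    have h2 := inner_sq_add_inner_perp_sq h1 (y - c)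
    have h3 : inner ℝ w' (y - c) = k' := by
      rw [inner_sub_right, hw', real_inner_smul_left, hy1]
    rw [h3, ← dist_eq_norm, hy2] at h2
    simp only [Set.mem_ofPred_eq]
    linarith
  · rintro y ⟨hy1, hy2⟩ z ⟨hz1, hz2⟩ hyz
    simp only at hyz
    have h3 : inner ℝ w' (y - c) = inner ℝ w' (z - c) := by
      rw [inner_sub_right, inner_sub_right, hw', real_inner_smul_left w y, real_inner_smul_left w z,
        hy1, hz1]
    have e1 := eq_inner_smul_add h1 (y - c)
    have e2 := eq_inner_smul_add h1 (z - c)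
    rw [hyz, h3, ← e2] at e1
    exact sub_left_injective e1

lemma finite_bisector_inter_sphere {v v' : Plane} (hv : v ≠ v') (c : Plane) (ε : ℝ) :
    {y : Plane | dist y v = dist y v' ∧ dist y c = ε}.Finite := by
  refine (finite_line_inter_sphere (sub_ne_zero.2 hv) ((‖v‖ ^ 2 - ‖v'‖ ^ 2) / 2) c ε).subset ?_
  rintro y ⟨h1, h2⟩
  refine ⟨?_, h2⟩
  have h3 : ‖y - v‖ ^ 2 = ‖y - v'‖ ^ 2 := by rw [← dist_eq_norm, ← dist_eq_norm, h1]
  rw [norm_sub_sq_real, norm_sub_sq_real, real_inner_comm, real_inner_comm v'] at h3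
  rw [inner_sub_left]
  linarith

namespace Sample
variable {γ N : ℝ → Plane} {τ σ ε : ℝ} {Y : Finset Plane}

/-- The points of the circles that are equidistant from two vertices. -/
def ties (Y : Finset Plane) (ε : ℝ) : Set Plane :=
  {y | (∃ c ∈ Y, dist y c = ε) ∧
    ∃ v ∈ vertices Y ε, ∃ v' ∈ vertices Y ε, v ≠ v' ∧ dist y v = dist y v'}

end Sample

lemma finite_ties (Y : Finset Plane) (ε : ℝ) : (Sample.ties Y ε).Finite := by
  have hV := finite_vertices Y ε
  have : Sample.ties Y ε ⊆ ⋃ q ∈ {q : Plane × Plane × Plane | q.1 ∈ Y ∧ q.2.1 ∈ Sample.vertices Y ε ∧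
      q.2.2 ∈ Sample.vertices Y ε ∧ q.2.1 ≠ q.2.2},
      {y | dist y q.2.1 = dist y q.2.2 ∧ dist y q.1 = ε} := by
    rintro y ⟨⟨c, hc, hyc⟩, v, hv, v', hv', hne, h⟩
    simp only [mem_iUnion]
    exact ⟨(c, v, v'), ⟨hc, hv, hv', hne⟩, h, hyc⟩
  refine (Set.Finite.biUnion ?_ fun q hq => finite_bisector_inter_sphere hq.2.2.2 _ _).subset this
  refine ((Y.finite_toSet).prod (hV.prod hV)).subset ?_
  rintro ⟨c, v, v'⟩ ⟨h1, h2, h3, -⟩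
  exact ⟨h1, h2, h3⟩

/-! ### Partitions of the unit interval -/

lemma lineMap_real (a b x : ℝ) : AffineMap.lineMap a b x = a + x * (b - a) := by
  rw [AffineMap.lineMap_apply_module']; simp [add_comm]

lemma lt_of_chain {a : ℕ → ℝ} {N : ℕ} (ha : ∀ j < N, a j < a (j + 1)) {i j : ℕ} (hij : i < j)
    (hj : j ≤ N) : a i < a j := by
  induction j with
  | zero => omega
  | succ k ih =>
    rcases Nat.lt_succ_iff_lt_or_eq.1 hij with h | h
    · exact (ih h (by omega)).trans (ha k (by omega))
    · rw [h]; exact ha k (by omega)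

lemma le_of_chain {a : ℕ → ℝ} {N : ℕ} (ha : ∀ j < N, a j < a (j + 1)) {i j : ℕ} (hij : i ≤ j)
    (hj : j ≤ N) : a i ≤ a j := by
  rcases hij.eq_or_lt with rfl | h
  · exact le_rfl
  · exact (lt_of_chain ha h hj).le

lemma chain_index_unique {a : ℕ → ℝ} {N : ℕ} (ha : ∀ j < N, a j < a (j + 1)) {i j : ℕ}
    (hi : i < N) (hj : j < N) {u : ℝ} (hu : u ∈ Ioc (a i) (a (i + 1)))
    (hu' : u ∈ Ioc (a j) (a (j + 1))) : i = j := by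
  rcases lt_trichotomy i j with h | h | h
  · have := le_of_chain ha (show i + 1 ≤ j by omega) hj.le
    linarith [hu.2, hu'.1]
  · exact h
  · have := le_of_chain ha (show j + 1 ≤ i by omega) hi.le
    linarith [hu'.2, hu.1]

lemma exists_chain_index {a : ℕ → ℝ} {N : ℕ} {u : ℝ} (h0 : a 0 < u) (h1 : u ≤ a N) :
    ∃ j < N, u ∈ Ioc (a j) (a (j + 1)) := by
  induction N with
  | zero => linarith
  | succ k ih =>
    rcases le_or_gt u (a k) with h | h
    · obtain ⟨j, hj, hu⟩ := ih h
      exact ⟨j, by omega, hu⟩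
    · exact ⟨k, by omega, h, h1⟩

/-- A partition of `[0,1]` whose open pieces avoid a given finite set. -/
lemma exists_partition {W : Set ℝ} (hW : W.Finite) : ∃ (N : ℕ) (a : ℕ → ℝ), 0 < N ∧ a 0 = 0 ∧
    a N = 1 ∧ (∀ j < N, a j < a (j + 1)) ∧ ∀ j < N, ∀ u ∈ Ioo (a j) (a (j + 1)), u ∉ W := by
  classical
  set t : Finset ℝ := insert 0 (insert 1 (hW.toFinset.filter fun u => u ∈ Icc (0 : ℝ) 1)) with ht
  have ht0 : (0 : ℝ) ∈ t := by simp [ht]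
  have ht1 : (1 : ℝ) ∈ t := by simp [ht]
  have htI : ∀ u ∈ t, u ∈ Icc (0 : ℝ) 1 := by
    intro u hu
    simp only [ht, Finset.mem_insert, Finset.mem_filter] at hu
    rcases hu with rfl | rfl | hu
    · simp
    · simp
    · exact hu.2
  have hcard : 1 < t.card := Finset.one_lt_card.2 ⟨0, ht0, 1, ht1, by norm_num⟩
  obtain ⟨N, hN⟩ : ∃ N, t.card = N + 1 := ⟨t.card - 1, by omega⟩
  set e := t.orderEmbOfFin hN with he
  have hmem : ∀ i, e i ∈ t := fun i => t.orderEmbOfFin_mem hN i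
  have hsurj : ∀ u ∈ t, ∃ i, e i = u := by
    intro u hu
    have : u ∈ range e := by rw [he, Finset.range_orderEmbOfFin]; exact hu
    exact this
  -- Indices beyond `N` wrap around; only `j ≤ N` is ever used.
  set a : ℕ → ℝ := fun j => e (Fin.ofNat (N + 1) j) with ha
  have haj : ∀ j (hj : j < N + 1), a j = e ⟨j, hj⟩ := by
    intro j hj
    simp only [ha]; congr 1; ext; simp [Nat.mod_eq_of_lt hj]
  refine ⟨N, a, by omega, ?_, ?_, ?_, ?_⟩
  · rw [haj 0 (by omega)]
    obtain ⟨i, hi⟩ := hsurj 0 ht0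
    refine le_antisymm ?_ (htI _ (hmem _)).1
    rw [← hi]; exact e.monotone (Fin.mk_le_of_le_val (Nat.zero_le _))
  · rw [haj N (by omega)]
    obtain ⟨i, hi⟩ := hsurj 1 ht1
    refine le_antisymm (htI _ (hmem _)).2 ?_
    rw [← hi]; exact e.monotone (Fin.le_def.2 (by simp; omega))
  · intro j hj
    rw [haj j (by omega), haj (j + 1) (by omega)]
    exact e.strictMono (Fin.lt_def.2 (by simp))
  · intro j hj u hu huW
    rw [haj j (by omega), haj (j + 1) (by omega)] at hu
    have hut : u ∈ t := by
      simp only [ht, Finset.mem_insert, Finset.mem_filter, Set.Finite.mem_toFinset]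
      exact Or.inr (Or.inr ⟨huW, (htI _ (hmem _)).1.trans hu.1.le,
        hu.2.le.trans (htI _ (hmem _)).2⟩)
    obtain ⟨i, rfl⟩ := hsurj u hut
    have h1 := Fin.lt_def.1 (e.lt_iff_lt.1 hu.1)
    have h2 := Fin.lt_def.1 (e.lt_iff_lt.1 hu.2)
    simp only at h1 h2
    omega

lemma tendsto_nhdsGT_of_continuousOn {g : ℝ → Plane} (hg : ContinuousOn g (Icc 0 1)) {a b : ℝ}
    (ha : 0 ≤ a) (hab : a < b) (hb : b ≤ 1) : Tendsto g (𝓝[>] a) (𝓝 (g a)) := by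
  rw [← nhdsWithin_Ioo_eq_nhdsGT hab]
  exact (hg a ⟨ha, hab.le.trans hb⟩).mono
    (Ioo_subset_Icc_self.trans (Icc_subset_Icc ha hb))

lemma tendsto_nhdsLT_of_continuousOn {g : ℝ → Plane} (hg : ContinuousOn g (Icc 0 1)) {a b : ℝ}
    (ha : 0 ≤ a) (hab : a < b) (hb : b ≤ 1) : Tendsto g (𝓝[<] b) (𝓝 (g b)) := by
  rw [← nhdsWithin_Ioo_eq_nhdsLT hab]
  exact (hg b ⟨ha.trans hab.le, hb⟩).mono
    (Ioo_subset_Icc_self.trans (Icc_subset_Icc ha hb))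

/-! ### Piecewise continuity of the medial fit -/

lemma IsSimpleClosedCurve.injOn_Ioc {g : ℝ → Plane} (hg : IsSimpleClosedCurve g) :
    InjOn g (Ioc 0 1) := by
  intro u hu v hv huv
  rcases hu.2.eq_or_lt with h1 | h1 <;> rcases hv.2.eq_or_lt with h2 | h2
  · rw [h1, h2]
  · rw [h1, ← hg.closed] at huv
    have := hg.injOn (by simp) ⟨hv.1.le, h2⟩ huv
    linarith [hv.1]
  · rw [h2, ← hg.closed] at huv
    have := hg.injOn ⟨hu.1.le, h1⟩ (by simp) huv
    linarith [hu.1]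
  · exact hg.injOn ⟨hu.1.le, h1⟩ ⟨hv.1.le, h2⟩ huv

lemma IsSimpleClosedCurve.finite_preimage {g : ℝ → Plane} (hg : IsSimpleClosedCurve g)
    {Z : Set Plane} (hZ : Z.Finite) : {u ∈ Ioc (0 : ℝ) 1 | g u ∈ Z}.Finite :=
  Set.Finite.of_finite_image (f := g) (hZ.subset (by rintro _ ⟨u, hu, rfl⟩; exact hu.2))
    (hg.injOn_Ioc.mono fun _ hu => hu.1)

/-- Closest-point selections with finitely many values and finitely many ties give piecewise
continuous midpoints. -/
lemma isPiecewiseContinuous_midpoint {g : ℝ → Plane} (hg : IsSimpleClosedCurve g) {B : Set Plane}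
    {p : Plane → Plane} (hp : ∀ u ∈ Icc (0 : ℝ) 1, IsNearest B (g u) (p (g u))) {V Z : Set Plane}
    (hV : V.Finite) (hZ : Z.Finite)
    (hpV : ∀ u ∈ Icc (0 : ℝ) 1, ∀ v, IsNearest B (g u) v → v ∈ V)
    (hties : ∀ u ∈ Icc (0 : ℝ) 1, g u ∉ Z → ∀ v ∈ V, ∀ v' ∈ V,
      dist (g u) v = dist (g u) v' → v = v') :
    IsPiecewiseContinuous fun u => midpoint ℝ (g u) (p (g u)) := by
  obtain ⟨N, a, hN, ha0, haN, halt, haW⟩ := exists_partition (hg.finite_preimage hZ)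
  have hI : ∀ j < N, ∀ u ∈ Icc (a j) (a (j + 1)), u ∈ Icc (0 : ℝ) 1 := by
    intro j hj u hu
    refine ⟨?_, ?_⟩
    · rw [← ha0]; exact (le_of_chain halt (Nat.zero_le j) hj.le).trans hu.1
    · rw [← haN]; exact hu.2.trans (le_of_chain halt hj le_rfl)
  have hconst : ∀ j < N, ∃ v, ∀ u ∈ Ioo (a j) (a (j + 1)), p (g u) = v := by
    intro j hj
    have hloc : ∀ u ∈ Ioo (a j) (a (j + 1)), ∀ᶠ u' in 𝓝 u, p (g u') = p (g u) := by
      intro u hu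
      have huI := hI j hj u (Ioo_subset_Icc_self hu)
      have hu0 : 0 < u := (hI j hj (a j) ⟨le_rfl, (halt j hj).le⟩).1.trans_lt hu.1
      have hnZ : g u ∉ Z := fun hz => haW j hj u hu ⟨⟨hu0, huI.2⟩, hz⟩
      have hgc : ContinuousAt g u :=
        (hg.continuousOn.mono fun x hx => hI j hj x (Ioo_subset_Icc_self hx)).continuousAt
          (isOpen_Ioo.mem_nhds hu)
      -- Away from ties the closest point beats each of the finitely many rivals strictly, and
      -- strict inequalities persist nearby.
      have ev : ∀ᶠ u' in 𝓝 u, ∀ v ∈ V ∩ B, v ≠ p (g u) → dist (g u') (p (g u)) < dist (g u') v := by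
        rw [(hV.inter_of_left B).eventually_all]
        intro v hv
        by_cases hne : v = p (g u)
        · simp [hne]
        · have hlt : dist (g u) (p (g u)) < dist (g u) v :=
            lt_of_le_of_ne ((hp u huI).2 v hv.2) fun he =>
              hne (hties u huI hnZ _ (hpV u huI _ (hp u huI)) _ hv.1 he).symm
          have c1 : ContinuousAt (fun u' => dist (g u') (p (g u))) u := hgc.dist continuousAt_const
          have c2 : ContinuousAt (fun u' => dist (g u') v) u := hgc.dist continuousAt_const
          filter_upwards [c1.eventually_lt c2 hlt] with u' hu' _ using hu'
      filter_upwards [ev, isOpen_Ioo.mem_nhds hu] with u' h1 h2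
      have hu'I := hI j hj u' (Ioo_subset_Icc_self h2)
      by_contra hne
      have := h1 _ ⟨hpV u' hu'I _ (hp u' hu'I), (hp u' hu'I).1⟩ hne
      exact absurd ((hp u' hu'I).2 _ (hp u huI).1) (not_le.2 this)
    have hc : ContinuousOn (fun u => p (g u)) (Ioo (a j) (a (j + 1))) := fun u hu =>
      (continuousAt_const.congr ((hloc u hu).mono fun _ h => h.symm)).continuousWithinAt
    -- The selection is continuous on the piece with values in a finite set, so its connected image
    -- is a single point.
    have hsub : (((fun u => p (g u)) '' Ioo (a j) (a (j + 1)))).Subsingleton := by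
      refine hV.countable.isTotallyDisconnected _ ?_ (isPreconnected_Ioo.image _ hc)
      rintro _ ⟨u, hu, rfl⟩
      have huI := hI j hj u (Ioo_subset_Icc_self hu)
      exact hpV u huI _ (hp u huI)
    obtain ⟨m, hm⟩ := nonempty_Ioo.2 (halt j hj)
    exact ⟨p (g m), fun u hu => hsub ⟨u, hu, rfl⟩ ⟨m, hm, rfl⟩⟩
  choose! v hv using hconst
  have hmid : ∀ w : Plane, Continuous fun y : Plane => midpoint ℝ y w := fun w => by
    simp only [midpoint_eq_smul_add]; fun_prop
  have key : ∀ j < N, ∀ u ∈ Ioo (a j) (a (j + 1)),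
      midpoint ℝ (g u) (v j) = midpoint ℝ (g u) (p (g u)) := fun j hj u hu => by
    rw [hv j hj u hu]
  have hR : ∀ j < N, Tendsto (fun u => midpoint ℝ (g u) (p (g u))) (𝓝[>] a j)
      (𝓝 (midpoint ℝ (g (a j)) (v j))) := by
    intro j hj
    have hlim := tendsto_nhdsGT_of_continuousOn hg.continuousOn
      (hI j hj _ ⟨le_rfl, (halt j hj).le⟩).1 (halt j hj) (hI j hj _ ⟨(halt j hj).le, le_rfl⟩).2
    refine (((hmid (v j)).tendsto _).comp hlim).congr' ?_
    filter_upwards [Ioo_mem_nhdsGT (halt j hj)] with u hu using key j hj u hu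
  have hL : ∀ j < N, Tendsto (fun u => midpoint ℝ (g u) (p (g u))) (𝓝[<] a (j + 1))
      (𝓝 (midpoint ℝ (g (a (j + 1))) (v j))) := by
    intro j hj
    have hlim := tendsto_nhdsLT_of_continuousOn hg.continuousOn
      (hI j hj _ ⟨le_rfl, (halt j hj).le⟩).1 (halt j hj) (hI j hj _ ⟨(halt j hj).le, le_rfl⟩).2
    refine (((hmid (v j)).tendsto _).comp hlim).congr' ?_
    filter_upwards [Ioo_mem_nhdsLT (halt j hj)] with u hu using key j hj u hu
  -- The left limit at `a j` comes from the preceding piece, hence `v (j - 1)`; the value of `l` at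
  -- `0` is never read. The right limit at `N` is that at `0`, as the wrap condition demands.
  refine ⟨N, a, fun j => midpoint ℝ (g (a j)) (v (j - 1)),
    fun j => if j < N then midpoint ℝ (g (a j)) (v j) else midpoint ℝ (g (a 0)) (v 0),
    hN, ha0, haN, halt, ?_, ?_, ?_, ?_⟩
  · intro j hj
    refine ContinuousOn.congr (f := fun u => midpoint ℝ (g u) (v j)) ?_
      fun u hu => (key j hj u hu).symm
    exact (hmid (v j)).comp_continuousOn
      (hg.continuousOn.mono fun u hu => hI j hj u (Ioo_subset_Icc_self hu))
  · intro j hj; simpa [hj] using hR j hj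
  · intro j hj; simpa using hL j hj
  · simp [hN]

/-! ### Existence of completions -/

lemma IsPiecewiseContinuousWith.exists_isCompletion {F : ℝ → Plane} {N : ℕ} {a : ℕ → ℝ}
    {l r : ℕ → Plane} (h : IsPiecewiseContinuousWith F N a l r) : ∃ G, IsCompletion F G := by
  classical
  have hN : (0 : ℝ) < N := by exact_mod_cast h.pos
  -- Equal time slots; where there is a jump, half of the slot is reserved for its segment.
  set s : ℕ → ℝ := fun j => j / N with hs
  set t : ℕ → ℝ := fun j => if l (j + 1) = r (j + 1) then s (j + 1) else (s j + s (j + 1)) / 2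
    with ht
  have hslt : ∀ j, s j < s (j + 1) := fun j => by
    simp only [hs]; push_cast; gcongr; linarith
  have hst : ∀ j, s j < t j := fun j => by
    simp only [ht]; split_ifs <;> linarith [hslt j]
  have hts : ∀ j, t j ≤ s (j + 1) := fun j => by
    simp only [ht]; split_ifs <;> linarith [hslt j]
  have htseq : ∀ j, t j = s (j + 1) ↔ l (j + 1) = r (j + 1) := fun j => by
    simp only [ht]; split_ifs with h1
    · simp [h1]
    · simp only [h1, iff_false]; intro h2; linarith [hslt j]
  have hs0 : s 0 = 0 := by simp [hs]
  have hsN : s N = 1 := by simp [hs, hN.ne']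
  have hidx : ∀ x : ℝ, ∃ j, 0 < x → x ≤ 1 → j < N ∧ x ∈ Ioc (s j) (s (j + 1)) := by
    intro x
    by_cases hx : 0 < x ∧ x ≤ 1
    · obtain ⟨j, hj, hxj⟩ := exists_chain_index (a := s) (N := N) (u := x)
        (by rw [hs0]; exact hx.1) (by rw [hsN]; exact hx.2)
      exact ⟨j, fun _ _ => ⟨hj, hxj⟩⟩
    · exact ⟨0, fun h1 h2 => absurd ⟨h1, h2⟩ hx⟩
  choose J hJ using hidx
  have hJeq : ∀ j < N, ∀ x ∈ Ioc (s j) (s (j + 1)), 0 < x ∧ J x = j := by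
    intro j hj x hx
    have h0 : 0 < x := by
      have := le_of_chain (N := N) (fun j _ => hslt j) (Nat.zero_le j) hj.le
      rw [hs0] at this; exact this.trans_lt hx.1
    have h1 : x ≤ 1 := by
      have := le_of_chain (N := N) (fun j _ => hslt j) (show j + 1 ≤ N from hj) le_rfl
      rw [hsN] at this; exact hx.2.trans this
    obtain ⟨h2, h3⟩ := hJ x h0 h1
    exact ⟨h0, chain_index_unique (fun j _ => hslt j) h2 hj h3 hx⟩
  refine ⟨fun x => if 0 < x then
      if x < t (J x) then F (AffineMap.lineMap (a (J x)) (a (J x + 1))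
        ((x - s (J x)) / (t (J x) - s (J x))))
      else AffineMap.lineMap (l (J x + 1)) (r (J x + 1))
        ((x - t (J x)) / (s (J x + 1) - t (J x)))
    else r 0, N, a, l, r, s, t, h, hs0, hsN, fun j _ => ⟨hst j, hts j, htseq j⟩, by simp, ?_, ?_⟩
  · intro j hj x hx
    have hlt := hst j
    have hle := hts j
    set w := AffineMap.lineMap (s j) (t j) x with hw
    rw [lineMap_real] at hw
    have hw1 : s j < w := by nlinarith [hx.1]
    have hw2 : w < t j := by nlinarith [hx.2]
    obtain ⟨h0, hJw⟩ := hJeq j hj w ⟨hw1, by linarith⟩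
    simp only [h0, if_true, hJw, hw2]
    congr 2
    rw [hw]; field_simp [show t j - s j ≠ 0 by linarith]; ring
  · intro j hj x hx
    have hlt := hst j
    have hle := hts j
    set w := AffineMap.lineMap (t j) (s (j + 1)) x with hw
    rw [lineMap_real] at hw
    have hw1 : t j ≤ w := by nlinarith [hx.1]
    have hw2 : w ≤ s (j + 1) := by nlinarith [hx.2]
    obtain ⟨h0, hJw⟩ := hJeq j hj w ⟨by linarith, hw2⟩
    simp only [h0, if_true, hJw, not_lt.2 hw1, if_false]
    rcases hle.eq_or_lt with h1 | h1
    -- The zero denominator is harmless: without a jump the segment is constant.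
    · rw [(htseq j).1 h1]; simp
    · congr 1
      rw [hw]; field_simp [show s (j + 1) - t j ≠ 0 by linarith]; ring

/-! ### Monotonicity of closest points -/

/-- `m` is the midpoint of `y` and a point of a segment between two closest points to `y`. -/
def IsOver (B : Set Plane) (y m : Plane) : Prop :=
  ∃ v v', IsNearest B y v ∧ IsNearest B y v' ∧ ∃ w ∈ segment ℝ v v', m = midpoint ℝ y w

lemma IsNearest.isOver {B : Set Plane} {y v : Plane} (h : IsNearest B y v) :
    IsOver B y (midpoint ℝ y v) := ⟨v, v, h, h, v, left_mem_segment ℝ v v, rfl⟩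

/-- Adding `‖y - v‖² ≤ ‖y - v'‖²` and `‖y' - v'‖² ≤ ‖y' - v‖²` cancels all squares and leaves the
monotonicity of the closest-point relation. -/
lemma IsNearest.inner_nonneg {B : Set Plane} {y y' v v' : Plane} (h : IsNearest B y v)
    (h' : IsNearest B y' v') : 0 ≤ inner ℝ (y - y') (v - v') := by
  have h1 := pow_le_pow_left₀ dist_nonneg (h.2 v' h'.1) 2
  have h2 := pow_le_pow_left₀ dist_nonneg (h'.2 v h.1) 2
  simp only [dist_eq_norm, norm_sub_sq_real] at h1 h2
  rw [inner_sub_left, inner_sub_right, inner_sub_right]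
  linarith

lemma inner_nonneg_of_mem_segment {d v v' w c : Plane} (h : 0 ≤ inner ℝ d (v - c))
    (h' : 0 ≤ inner ℝ d (v' - c)) (hw : w ∈ segment ℝ v v') : 0 ≤ inner ℝ d (w - c) := by
  obtain ⟨a, b, ha, hb, hab, rfl⟩ := hw
  rw [show a • v + b • v' - c = a • (v - c) + b • (v' - c) by
    rw [smul_sub, smul_sub, show a • v - a • c + (b • v' - b • c) =
      a • v + b • v' - (a + b) • c by rw [add_smul]; abel, hab, one_smul], inner_add_right,
    real_inner_smul_right, real_inner_smul_right]
  positivity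

/-- The inequality `inner_nonneg` is affine in each closest point, so it extends to points `x`, `x'`
of the segments between ties. Since `2 • (m - m') = (y - y') + (x - x')`, pairing with `y - y'` and
Cauchy–Schwarz finish. Thus a point of the completed curve determines its boundary point, in a
Lipschitz way. -/
lemma norm_sub_le_of_isOver {B : Set Plane} {y y' m m' : Plane} (h : IsOver B y m)
    (h' : IsOver B y' m') : ‖y - y'‖ ≤ 2 * ‖m - m'‖ := by
  obtain ⟨v, w, hv, hw, x, hx, rfl⟩ := h
  obtain ⟨v', w', hv', hw', x', hx', rfl⟩ := h'
  have key : ∀ q, IsNearest B y q → 0 ≤ inner ℝ (y' - y) (x' - q) := fun q hq =>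
    inner_nonneg_of_mem_segment (hv'.inner_nonneg hq) (hw'.inner_nonneg hq) hx'
  have flip : ∀ q, inner ℝ (y' - y) (x' - q) = inner ℝ (y - y') (q - x') := fun q => by
    rw [← neg_sub y y', ← neg_sub q x', inner_neg_neg]
  have h0 : 0 ≤ inner ℝ (y - y') (x - x') :=
    inner_nonneg_of_mem_segment (flip v ▸ key v hv) (flip w ▸ key w hw) hx
  have h1 : midpoint ℝ y x - midpoint ℝ y' x' = (2 : ℝ)⁻¹ • ((y - y') + (x - x')) := by
    simp only [midpoint_eq_smul_add, invOf_eq_inv, ← smul_sub]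
    congr 1; abel
  have h2 := real_inner_le_norm (y - y') ((y - y') + (x - x'))
  rw [inner_add_right, real_inner_self_eq_norm_sq] at h2
  rw [h1, norm_smul, norm_inv, Real.norm_two, mul_inv_cancel_left₀ two_ne_zero]
  rcases (norm_nonneg (y - y')).eq_or_lt with h3 | h3
  · rw [← h3]; exact norm_nonneg _
  · have : ‖y - y'‖ * ‖y - y'‖ ≤ ‖y - y'‖ * ‖(y - y') + (x - x')‖ := by nlinarith
    exact le_of_mul_le_mul_left this h3

/-- One-sided limits of a medial fit come from closest points. -/
lemma exists_isNearest_of_tendsto {g : ℝ → Plane} {B : Set Plane} (hB : IsClosed B)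
    {p : Plane → Plane} (hp : ∀ u ∈ Icc (0 : ℝ) 1, IsNearest B (g u) (p (g u))) {𝓕 : Filter ℝ}
    [𝓕.NeBot] (hF : ∀ᶠ u in 𝓕, u ∈ Icc (0 : ℝ) 1) {y L : Plane} (hg : Tendsto g 𝓕 (𝓝 y))
    (hL : Tendsto (fun u => midpoint ℝ (g u) (p (g u))) 𝓕 (𝓝 L)) :
    ∃ v, IsNearest B y v ∧ L = midpoint ℝ y v := by
  have hlim : Tendsto (fun u => p (g u)) 𝓕 (𝓝 ((2 : ℝ) • L - y)) := by
    refine ((hL.const_smul (2 : ℝ)).sub hg).congr fun u => ?_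
    simp [midpoint_eq_smul_add]
  refine ⟨(2 : ℝ) • L - y, ⟨hB.mem_of_tendsto hlim (hF.mono fun u hu => (hp u hu).1),
    fun z hz => le_of_tendsto_of_tendsto (hg.dist hlim) (hg.dist tendsto_const_nhds)
      (hF.mono fun u hu => (hp u hu).2 z hz)⟩, ?_⟩
  simp [midpoint_eq_smul_add]

/-! ### Completions of medial fits -/

lemma continuousOn_Icc_of_tendsto {f : ℝ → Plane} {a b : ℝ} (hab : a < b)
    (hf : ContinuousOn f (Ioo a b)) (ha : Tendsto f (𝓝[>] a) (𝓝 (f a)))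
    (hb : Tendsto f (𝓝[<] b) (𝓝 (f b))) : ContinuousOn f (Icc a b) := by
  intro x hx
  rcases hx.1.eq_or_lt with rfl | h1
  · exact (continuousWithinAt_Ioi_iff_Ici.1 ha).mono Icc_subset_Ici_self
  rcases hx.2.eq_or_lt with rfl | h2
  · exact (continuousWithinAt_Iio_iff_Iic.1 hb).mono Icc_subset_Iic_self
  · exact (hf.continuousAt (Ioo_mem_nhds h1 h2)).continuousWithinAt

lemma tendsto_affine_nhdsGT {a b c d : ℝ} (hab : a < b) (hcd : c < d) :
    Tendsto (fun x => c + (x - a) / (b - a) * (d - c)) (𝓝[>] a) (𝓝[>] c) := by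
  refine tendsto_nhdsWithin_iff.2 ⟨?_, ?_⟩
  · have : Continuous fun x : ℝ => c + (x - a) / (b - a) * (d - c) := by fun_prop
    have := this.tendsto a
    simp only [sub_self, zero_div, zero_mul, add_zero] at this
    exact this.mono_left nhdsWithin_le_nhds
  · filter_upwards [self_mem_nhdsWithin] with x hx
    have : 0 < (x - a) / (b - a) * (d - c) :=
      mul_pos (div_pos (sub_pos.2 hx) (by linarith)) (by linarith)
    exact mem_Ioi.2 (by linarith)

lemma tendsto_affine_nhdsLT {a b c d : ℝ} (hab : a < b) (hcd : c < d) :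
    Tendsto (fun x => c + (x - a) / (b - a) * (d - c)) (𝓝[<] b) (𝓝[<] d) := by
  have hne : b - a ≠ 0 := by linarith
  refine tendsto_nhdsWithin_iff.2 ⟨?_, ?_⟩
  · have : Continuous fun x : ℝ => c + (x - a) / (b - a) * (d - c) := by fun_prop
    have := this.tendsto b
    rw [div_self hne, one_mul, add_sub_cancel] at this
    exact this.mono_left nhdsWithin_le_nhds
  · filter_upwards [self_mem_nhdsWithin] with x hx
    have h1 : (x - a) / (b - a) < 1 := (div_lt_one (by linarith)).2 (by linarith [mem_Iio.1 hx])
    exact mem_Iio.2 (by nlinarith)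

/-- A completed medial fit together with its partition, one-sided limits and time scale. -/
structure MedialCompletion (g : ℝ → Plane) (B : Set Plane) (p : Plane → Plane) (F G : ℝ → Plane)
    (N : ℕ) (a : ℕ → ℝ) (l r : ℕ → Plane) (s t : ℕ → ℝ) : Prop where
  simple : IsSimpleClosedCurve g
  closed : IsClosed B
  nearest : ∀ u ∈ Icc (0 : ℝ) 1, IsNearest B (g u) (p (g u))
  fit : F = fun u => midpoint ℝ (g u) (p (g u))
  piecewise : IsPiecewiseContinuousWith F N a l r
  first : s 0 = 0
  last : s N = 1
  times : ∀ j < N, s j < t j ∧ t j ≤ s (j + 1) ∧ (t j = s (j + 1) ↔ l (j + 1) = r (j + 1))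
  start : G 0 = r 0
  run : ∀ j < N, ∀ x ∈ Ioo (0 : ℝ) 1, G (AffineMap.lineMap (s j) (t j) x) =
    F (AffineMap.lineMap (a j) (a (j + 1)) x)
  jump : ∀ j < N, ∀ x ∈ Icc (0 : ℝ) 1, G (AffineMap.lineMap (t j) (s (j + 1)) x) =
    AffineMap.lineMap (l (j + 1)) (r (j + 1)) x

namespace MedialCompletion
variable {g : ℝ → Plane} {B : Set Plane} {p : Plane → Plane} {F G : ℝ → Plane} {N : ℕ}
  {a : ℕ → ℝ} {l r : ℕ → Plane} {s t : ℕ → ℝ}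

lemma chain (h : MedialCompletion g B p F G N a l r s t) : ∀ j < N, s j < s (j + 1) :=
  fun j hj => (h.times j hj).1.trans_le (h.times j hj).2.1

lemma mem_Icc (h : MedialCompletion g B p F G N a l r s t) {j : ℕ} (hj : j < N) {u : ℝ}
    (hu : u ∈ Icc (a j) (a (j + 1))) : u ∈ Icc (0 : ℝ) 1 := by
  have h1 := le_of_chain h.piecewise.lt (Nat.zero_le j) hj.le
  have h2 := le_of_chain h.piecewise.lt (show j + 1 ≤ N from hj) le_rfl
  rw [h.piecewise.first] at h1
  rw [h.piecewise.last] at h2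
  exact ⟨h1.trans hu.1, hu.2.trans h2⟩

lemma mem_Ioc (h : MedialCompletion g B p F G N a l r s t) {j : ℕ} (hj : j < N) {u : ℝ}
    (hu : u ∈ Ioc (a j) (a (j + 1))) : u ∈ Ioc (0 : ℝ) 1 :=
  ⟨(h.mem_Icc hj ⟨le_rfl, (h.piecewise.lt j hj).le⟩).1.trans_lt hu.1,
    (h.mem_Icc hj ⟨hu.1.le, hu.2⟩).2⟩

lemma apply_time (h : MedialCompletion g B p F G N a l r s t) {j : ℕ} (hj : j < N) :
    G (t j) = l (j + 1) := by
  simpa using h.jump j hj 0 (by simp)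

lemma apply_node (h : MedialCompletion g B p F G N a l r s t) {j : ℕ} (hj : j ≤ N) :
    G (s j) = r j := by
  cases j with
  | zero => rw [h.first, h.start]
  | succ k => simpa using h.jump k hj 1 (by simp)

lemma exists_left (h : MedialCompletion g B p F G N a l r s t) {j : ℕ} (hj : j < N) :
    ∃ v, IsNearest B (g (a (j + 1))) v ∧ l (j + 1) = midpoint ℝ (g (a (j + 1))) v := by
  have hlt := h.piecewise.lt j hj
  have hL := h.piecewise.left j hj
  rw [h.fit] at hL
  refine exists_isNearest_of_tendsto h.closed h.nearest ?_
    (tendsto_nhdsLT_of_continuousOn h.simple.continuousOn (h.mem_Icc hj ⟨le_rfl, hlt.le⟩).1 hlt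
      (h.mem_Icc hj ⟨hlt.le, le_rfl⟩).2) hL
  filter_upwards [Ioo_mem_nhdsLT hlt] with u hu using h.mem_Icc hj (Ioo_subset_Icc_self hu)

lemma exists_right (h : MedialCompletion g B p F G N a l r s t) {j : ℕ} (hj : j < N) :
    ∃ v, IsNearest B (g (a j)) v ∧ r j = midpoint ℝ (g (a j)) v := by
  have hlt := h.piecewise.lt j hj
  have hL := h.piecewise.right j hj
  rw [h.fit] at hL
  refine exists_isNearest_of_tendsto h.closed h.nearest ?_
    (tendsto_nhdsGT_of_continuousOn h.simple.continuousOn (h.mem_Icc hj ⟨le_rfl, hlt.le⟩).1 hlt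
      (h.mem_Icc hj ⟨hlt.le, le_rfl⟩).2) hL
  filter_upwards [Ioo_mem_nhdsGT hlt] with u hu using h.mem_Icc hj (Ioo_subset_Icc_self hu)

/-- At the last partition point the right limit is the one at `0`, and `g 0 = g 1` identifies the
boundary points. -/
lemma exists_right' (h : MedialCompletion g B p F G N a l r s t) {j : ℕ} (hj : j < N) :
    ∃ v, IsNearest B (g (a (j + 1))) v ∧ r (j + 1) = midpoint ℝ (g (a (j + 1))) v := by
  rcases Nat.lt_or_ge (j + 1) N with h1 | h1
  · exact h.exists_right h1
  · have h2 : j + 1 = N := by omega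
    obtain ⟨v, hv, hr⟩ := h.exists_right h.piecewise.pos
    refine ⟨v, ?_, ?_⟩
    · rw [h2, h.piecewise.last, ← h.simple.closed, ← h.piecewise.first]; exact hv
    · rw [h2, h.piecewise.wrap, h.piecewise.last, ← h.simple.closed, ← h.piecewise.first]; exact hr

/-- Both one-sided limits are midpoints with closest points to the same boundary point, and taking
the midpoint with a fixed point is affine. -/
lemma isOver_jump (h : MedialCompletion g B p F G N a l r s t) {j : ℕ} (hj : j < N) {m : Plane}
    (hm : m ∈ segment ℝ (l (j + 1)) (r (j + 1))) : IsOver B (g (a (j + 1))) m := by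
  obtain ⟨v, hv, hl⟩ := h.exists_left hj
  obtain ⟨v', hv', hr⟩ := h.exists_right' hj
  obtain ⟨x, y, hx, hy, hxy, rfl⟩ := hm
  refine ⟨v, v', hv, hv', x • v + y • v', ⟨x, y, hx, hy, hxy, rfl⟩, ?_⟩
  rw [hl, hr]
  simp only [midpoint_eq_smul_add, smul_add, smul_smul]
  rw [show (⅟2 : ℝ) • g (a (j + 1)) = (x * ⅟2) • g (a (j + 1)) + (y * ⅟2) • g (a (j + 1)) by
    rw [← add_smul, ← add_mul, hxy, one_mul], mul_comm x, mul_comm y]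
  abel

/-- Every time `x ∈ (0, 1]` belongs to exactly one parameter `u ∈ (0, 1]`, either in the interior
of a piece or at a partition point. -/
lemma exists_piece (h : MedialCompletion g B p F G N a l r s t) {x : ℝ} (hx : x ∈ Ioc (0 : ℝ) 1) :
    ∃ j < N, ∃ u ∈ Ioc (a j) (a (j + 1)), IsOver B (g u) (G x) ∧
      ((u < a (j + 1) ∧ G x = F u ∧ ∃ y : ℝ, u = AffineMap.lineMap (a j) (a (j + 1)) y ∧
          x = AffineMap.lineMap (s j) (t j) y) ∨
        (u = a (j + 1) ∧ ∃ y ∈ Icc (0 : ℝ) 1, x = AffineMap.lineMap (t j) (s (j + 1)) y ∧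
          G x = AffineMap.lineMap (l (j + 1)) (r (j + 1)) y)) := by
  obtain ⟨j, hj, hxj⟩ := exists_chain_index (a := s) (N := N) (u := x)
    (by rw [h.first]; exact hx.1) (by rw [h.last]; exact hx.2)
  obtain ⟨h1, h2, -⟩ := h.times j hj
  have hlt := h.piecewise.lt j hj
  refine ⟨j, hj, ?_⟩
  rcases lt_or_ge x (t j) with hxt | hxt
  · set y := (x - s j) / (t j - s j) with hy
    have hy0 : 0 < y := div_pos (by linarith [hxj.1]) (by linarith)
    have hy1 : y < 1 := (div_lt_one (by linarith)).2 (by linarith)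
    have hxy : x = AffineMap.lineMap (s j) (t j) y := by
      rw [lineMap_real, hy, div_mul_cancel₀ _ (by linarith)]; ring
    set u := AffineMap.lineMap (a j) (a (j + 1)) y with hu
    have hu' : u = a j + y * (a (j + 1) - a j) := by rw [hu, lineMap_real]
    have hu0 : a j < u := by rw [hu']; nlinarith
    have hu1 : u < a (j + 1) := by rw [hu']; nlinarith
    have hG : G x = F u := by rw [hxy, h.run j hj y ⟨hy0, hy1⟩]
    refine ⟨u, ⟨hu0, hu1.le⟩, ?_, Or.inl ⟨hu1, hG, y, rfl, hxy⟩⟩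
    rw [hG, h.fit]
    exact (h.nearest u (h.mem_Icc hj ⟨hu0.le, hu1.le⟩)).isOver
  · obtain ⟨y, hy, hxy⟩ : ∃ y ∈ Icc (0 : ℝ) 1, x = AffineMap.lineMap (t j) (s (j + 1)) y := by
      have : x ∈ segment ℝ (t j) (s (j + 1)) := by
        rw [segment_eq_Icc h2]; exact ⟨hxt, hxj.2⟩
      rw [segment_eq_image_lineMap] at this
      obtain ⟨y, hy, rfl⟩ := this
      exact ⟨y, hy, rfl⟩
    have hG : G x = AffineMap.lineMap (l (j + 1)) (r (j + 1)) y := by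
      rw [hxy]; exact h.jump j hj y hy
    refine ⟨a (j + 1), ⟨hlt, le_rfl⟩, ?_, Or.inr ⟨rfl, y, hy, hxy, hG⟩⟩
    refine h.isOver_jump hj ?_
    rw [hG, segment_eq_image_lineMap]
    exact mem_image_of_mem _ hy

lemma eq_of_isOver (h : MedialCompletion g B p F G N a l r s t) {u u' : ℝ}
    (hu : u ∈ Ioc (0 : ℝ) 1) (hu' : u' ∈ Ioc (0 : ℝ) 1) {m : Plane} (hm : IsOver B (g u) m)
    (hm' : IsOver B (g u') m) : u = u' := by
  have h1 := norm_sub_le_of_isOver hm hm'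
  rw [sub_self, norm_zero, mul_zero] at h1
  exact h.simple.injOn_Ioc hu hu' (sub_eq_zero.1 (norm_le_zero_iff.1 h1))

/-- By `eq_of_isOver` the value determines the parameter `u`, and with it the piece or the jump.
Inside a piece time is affine in `u`; on a jump the position on the segment determines the time. -/
lemma injOn_Ioc (h : MedialCompletion g B p F G N a l r s t) : InjOn G (Ioc 0 1) := by
  intro x hx x' hx' hxx
  obtain ⟨j, hj, u, hu, hov, hcase⟩ := h.exists_piece hx
  obtain ⟨j', hj', u', hu', hov', hcase'⟩ := h.exists_piece hx'
  rw [← hxx] at hov'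
  have huu := h.eq_of_isOver (h.mem_Ioc hj hu) (h.mem_Ioc hj' hu') hov hov'
  subst huu
  have hjj := chain_index_unique h.piecewise.lt hj hj' hu hu'
  subst hjj
  have hlt := h.piecewise.lt j hj
  rcases hcase with ⟨h1, -, y, hy, hxy⟩ | ⟨h1, y, -, hxy, hG⟩ <;>
    rcases hcase' with ⟨h1', -, y', hy', hxy'⟩ | ⟨h1', y', -, hxy', hG'⟩
  · rw [hy] at hy'
    rw [hxy, hxy', AffineMap.lineMap_injective ℝ hlt.ne hy']
  · exact absurd h1' h1.ne
  · exact absurd h1 h1'.ne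
  -- A degenerate segment would destroy injectivity if it took positive time; the time scale gives
  -- it a single instant.
  · by_cases hlr : l (j + 1) = r (j + 1)
    · rw [hxy, hxy', (h.times j hj).2.2.2 hlr]; simp
    · rw [← hxx, hG] at hG'
      rw [hxy, hxy', AffineMap.lineMap_injective ℝ hlr hG']

lemma continuousOn_run (h : MedialCompletion g B p F G N a l r s t) {j : ℕ} (hj : j < N) :
    ContinuousOn G (Icc (s j) (t j)) := by
  obtain ⟨h1, h2, -⟩ := h.times j hj
  have hlt := h.piecewise.lt j hj
  set φ := fun x => a j + (x - s j) / (t j - s j) * (a (j + 1) - a j) with hφ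
  have hmap : ∀ x ∈ Ioo (s j) (t j), φ x ∈ Ioo (a j) (a (j + 1)) ∧ G x = F (φ x) := by
    intro x hx
    have hy0 : 0 < (x - s j) / (t j - s j) := div_pos (by linarith [hx.1]) (by linarith)
    have hy1 : (x - s j) / (t j - s j) < 1 := (div_lt_one (by linarith)).2 (by linarith [hx.2])
    refine ⟨⟨by simp only [hφ]; nlinarith, by simp only [hφ]; nlinarith⟩, ?_⟩
    have := h.run j hj _ ⟨hy0, hy1⟩
    rw [lineMap_real, lineMap_real, div_mul_cancel₀ _ (by linarith), add_sub_cancel] at this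
    exact this
  refine continuousOn_Icc_of_tendsto h1 ?_ ?_ ?_
  · refine ContinuousOn.congr (f := F ∘ φ) ?_ fun x hx => (hmap x hx).2
    refine (h.piecewise.continuousOn j hj).comp ?_ fun x hx => (hmap x hx).1
    simp only [hφ]; fun_prop
  · rw [h.apply_node hj.le]
    refine ((h.piecewise.right j hj).comp (tendsto_affine_nhdsGT h1 hlt)).congr' ?_
    filter_upwards [Ioo_mem_nhdsGT h1] with x hx using (hmap x hx).2.symm
  · rw [h.apply_time hj]
    refine ((h.piecewise.left j hj).comp (tendsto_affine_nhdsLT h1 hlt)).congr' ?_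
    filter_upwards [Ioo_mem_nhdsLT h1] with x hx using (hmap x hx).2.symm

lemma continuousOn_jump (h : MedialCompletion g B p F G N a l r s t) {j : ℕ} (hj : j < N) :
    ContinuousOn G (Icc (t j) (s (j + 1))) := by
  obtain ⟨h1, h2, -⟩ := h.times j hj
  rcases h2.eq_or_lt with h3 | h3
  · rw [h3, Icc_self]; exact continuousOn_singleton _ _
  refine ContinuousOn.congr (f := fun x => AffineMap.lineMap (l (j + 1)) (r (j + 1))
    ((x - t j) / (s (j + 1) - t j))) ?_ fun x hx => ?_
  · exact AffineMap.lineMap_continuous.comp_continuousOn (by fun_prop)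
  · have hne : 0 < s (j + 1) - t j := by linarith
    have := h.jump j hj ((x - t j) / (s (j + 1) - t j))
      ⟨div_nonneg (by linarith [hx.1]) hne.le, (div_le_one hne).2 (by linarith [hx.2])⟩
    rwa [lineMap_real, div_mul_cancel₀ _ hne.ne', add_sub_cancel] at this

lemma continuousOn (h : MedialCompletion g B p F G N a l r s t) : ContinuousOn G (Icc 0 1) := by
  have key : ∀ k ≤ N, ContinuousOn G (Icc (s 0) (s k)) := by
    intro k
    induction k with
    | zero => intro _; rw [Icc_self]; exact continuousOn_singleton _ _
    | succ k ih =>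
      intro hk
      obtain ⟨h1, h2, -⟩ := h.times k hk
      have h3 := le_of_chain h.chain (Nat.zero_le k) (by omega)
      rw [← Icc_union_Icc_eq_Icc h3 (h1.le.trans h2), ← Icc_union_Icc_eq_Icc h1.le h2]
      exact (ih (by omega)).union_of_isClosed ((h.continuousOn_run hk).union_of_isClosed
        (h.continuousOn_jump hk) isClosed_Icc isClosed_Icc) isClosed_Icc
        (isClosed_Icc.union isClosed_Icc)
  have := key N le_rfl
  rwa [h.first, h.last] at this

lemma apply_zero (h : MedialCompletion g B p F G N a l r s t) : G 0 = G 1 := by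
  rw [h.start, ← h.last, h.apply_node le_rfl, h.piecewise.wrap]

theorem isSimpleClosedCurve (h : MedialCompletion g B p F G N a l r s t) :
    IsSimpleClosedCurve G := by
  refine ⟨h.continuousOn, h.apply_zero, fun x hx y hy hxy => ?_⟩
  rcases hx.1.eq_or_lt with h1 | h1 <;> rcases hy.1.eq_or_lt with h2 | h2
  · rw [← h1, ← h2]
  · rw [← h1, h.apply_zero] at hxy
    have := h.injOn_Ioc (by simp) ⟨h2, hy.2.le⟩ hxy
    linarith [hy.2]
  · rw [← h2, h.apply_zero] at hxy
    have := h.injOn_Ioc ⟨h1, hx.2.le⟩ (by simp) hxy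
    linarith [hx.2]
  · exact h.injOn_Ioc ⟨h1, hx.2.le⟩ ⟨h2, hy.2.le⟩ hxy

lemma exists_time_pos (h : MedialCompletion g B p F G N a l r s t) {m : Plane} (hm : m ∈ trace G) :
    ∃ x ∈ Ioc (0 : ℝ) 1, G x = m := by
  obtain ⟨x, hx, rfl⟩ := hm
  rcases hx.1.eq_or_lt with h1 | h1
  · exact ⟨1, by simp, by rw [← h1, h.apply_zero]⟩
  · exact ⟨x, ⟨h1, hx.2⟩, rfl⟩

lemma exists_isOver (h : MedialCompletion g B p F G N a l r s t) {m : Plane} (hm : m ∈ trace G) :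
    ∃ y ∈ trace g, IsOver B y m := by
  obtain ⟨x, hx, rfl⟩ := h.exists_time_pos hm
  obtain ⟨j, hj, u, hu, hov, -⟩ := h.exists_piece hx
  exact ⟨g u, ⟨u, h.mem_Icc hj ⟨hu.1.le, hu.2⟩, rfl⟩, hov⟩

lemma exists_param_pos (h : MedialCompletion g B p F G N a l r s t) {y : Plane}
    (hy : y ∈ trace g) : ∃ u ∈ Ioc (0 : ℝ) 1, g u = y := by
  obtain ⟨x, hx, rfl⟩ := hy
  rcases hx.1.eq_or_lt with h1 | h1
  · exact ⟨1, by simp, by rw [← h1, h.simple.closed]⟩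
  · exact ⟨x, ⟨h1, hx.2⟩, rfl⟩

lemma exists_mem_trace (h : MedialCompletion g B p F G N a l r s t) {y : Plane}
    (hy : y ∈ trace g) : ∃ m ∈ trace G, IsOver B y m := by
  obtain ⟨u, hu, rfl⟩ := h.exists_param_pos hy
  obtain ⟨j, hj, huj⟩ := exists_chain_index (a := a) (N := N) (u := u)
    (by rw [h.piecewise.first]; exact hu.1) (by rw [h.piecewise.last]; exact hu.2)
  obtain ⟨h1, h2, -⟩ := h.times j hj
  have hlt := h.piecewise.lt j hj
  have e0 := le_of_chain h.chain (Nat.zero_le j) hj.le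
  have e1 := le_of_chain h.chain (show j + 1 ≤ N from hj) le_rfl
  rw [h.first] at e0
  rw [h.last] at e1
  rcases huj.2.eq_or_lt with h3 | h3
  · refine ⟨G (t j), ⟨t j, ⟨by linarith, by linarith⟩, rfl⟩, ?_⟩
    rw [h3]
    refine h.isOver_jump hj ?_
    rw [h.apply_time hj]; exact left_mem_segment ℝ _ _
  · set y := (u - a j) / (a (j + 1) - a j) with hy
    have hy0 : 0 < y := div_pos (by linarith [huj.1]) (by linarith)
    have hy1 : y < 1 := (div_lt_one (by linarith)).2 (by linarith)
    have := h.run j hj y ⟨hy0, hy1⟩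
    rw [lineMap_real, lineMap_real, hy, div_mul_cancel₀ _ (by linarith), add_sub_cancel, ← hy] at this
    refine ⟨_, ⟨s j + y * (t j - s j), ⟨by nlinarith, by nlinarith⟩, rfl⟩, ?_⟩
    rw [this, h.fit]
    exact (h.nearest u (h.mem_Icc hj ⟨huj.1.le, huj.2⟩)).isOver

/-- The part of the completed curve over a boundary point is convex. -/
lemma segment_subset (h : MedialCompletion g B p F G N a l r s t) {y m m' : Plane}
    (hy : y ∈ trace g) (hm : m ∈ trace G) (hm' : m' ∈ trace G) (hym : IsOver B y m)
    (hym' : IsOver B y m') : ∀ q ∈ segment ℝ m m', q ∈ trace G ∧ IsOver B y q := by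
  obtain ⟨v, hv, rfl⟩ := h.exists_param_pos hy
  obtain ⟨x, hx, rfl⟩ := h.exists_time_pos hm
  obtain ⟨x', hx', rfl⟩ := h.exists_time_pos hm'
  obtain ⟨j, hj, u, hu, hov, hcase⟩ := h.exists_piece hx
  obtain ⟨j', hj', u', hu', hov', hcase'⟩ := h.exists_piece hx'
  have huv := h.eq_of_isOver (h.mem_Ioc hj hu) hv hov hym
  have huv' := h.eq_of_isOver (h.mem_Ioc hj' hu') hv hov' hym'
  subst huv
  subst huv'
  have hjj := chain_index_unique h.piecewise.lt hj hj' hu hu'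
  subst hjj
  have hlt := h.piecewise.lt j hj
  rcases hcase with ⟨h1, hG, -⟩ | ⟨h1, y, hy, hxy, hG⟩ <;>
    rcases hcase' with ⟨h1', hG', -⟩ | ⟨h1', y', hy', hxy', hG'⟩
  · intro q hq
    rw [hG', ← hG, segment_same, mem_singleton_iff] at hq
    rw [hq]; exact ⟨hm, hov⟩
  · exact absurd h1' h1.ne
  · exact absurd h1 h1'.ne
  · intro q hq
    have hseg : q ∈ segment ℝ (l (j + 1)) (r (j + 1)) := by
      refine (convex_segment _ _).segment_subset ?_ ?_ hq
      · rw [hG, segment_eq_image_lineMap]; exact mem_image_of_mem _ hy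
      · rw [hG', segment_eq_image_lineMap]; exact mem_image_of_mem _ hy'
    refine ⟨?_, h1 ▸ h.isOver_jump hj hseg⟩
    rw [segment_eq_image_lineMap] at hseg
    obtain ⟨z, hz, rfl⟩ := hseg
    obtain ⟨h4, h5, -⟩ := h.times j hj
    have e0 := le_of_chain h.chain (Nat.zero_le j) hj.le
    have e1 := le_of_chain h.chain (show j + 1 ≤ N from hj) le_rfl
    rw [h.first] at e0
    rw [h.last] at e1
    refine ⟨_, ?_, h.jump j hj z hz⟩
    rw [lineMap_real]
    constructor <;> nlinarith [hz.1, hz.2]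

end MedialCompletion

/-! ### Medial fits of a dense sample -/

namespace Sample
variable {γ N : ℝ → Plane} {τ σ ε : ℝ} {Y : Finset Plane}

lemma edge_neg_neg (h : Sample γ N τ σ ε Y) : h.neg.neg.edge = h.edge := by
  funext s
  simp only [edge, neg_neg]

/-- A parametrization of the boundary curve on the side of `N`, with a choice of closest points on
the other boundary curve. -/
structure Selection (h : Sample γ N τ σ ε Y) (g : ℝ → Plane) (p : Plane → Plane) : Prop where
  simple : IsSimpleClosedCurve g
  trace_eq : trace g = range h.edge
  nearest : ∀ u ∈ Icc (0 : ℝ) 1, IsNearest (range h.neg.edge) (g u) (p (g u))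

/-- Uniqueness of the boundary pair leaves just the two labellings, which reversal of the normal
exchanges. -/
lemma exists_selection (h : Sample γ N τ σ ε Y) {F : ℝ → Plane}
    (hF : IsMedialFit (⋃ c ∈ Y, Metric.closedBall c ε) F) : ∃ g p,
      F = (fun u => midpoint ℝ (g u) (p (g u))) ∧ (h.Selection g p ∨ h.neg.Selection g p) := by
  obtain ⟨g₀, g₁, p, hg, hp, rfl⟩ := hF
  refine ⟨g₀, p, rfl, ?_⟩
  have hnear : ∀ u ∈ Icc (0 : ℝ) 1, IsNearest (trace g₁) (g₀ u) (p (g₀ u)) := fun u hu =>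
    hp _ ⟨u, hu, rfl⟩
  rcases hg.trace_eq h.isBoundaryPair with ⟨h0, h1⟩ | ⟨h0, h1⟩ <;>
    rw [h.trace_edge] at * <;> rw [h.neg.trace_edge] at *
  · exact Or.inl ⟨hg.simple₀, h0, h1 ▸ hnear⟩
  · refine Or.inr ⟨hg.simple₀, h0, ?_⟩
    rw [h.edge_neg_neg, ← h1]; exact hnear

lemma exists_isMedialFit (h : Sample γ N τ σ ε Y) :
    ∃ F, IsMedialFit (⋃ c ∈ Y, Metric.closedBall c ε) F := by
  have : ∀ y, ∃ v, IsNearest (trace h.neg.edge) y v := fun y => by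
    obtain ⟨v, hv, hd⟩ := h.neg.isSimpleClosedCurve_edge.isCompact_trace.exists_infDist_eq_dist
      (trace_nonempty _) y
    exact ⟨v, hv, fun z hz => hd ▸ Metric.infDist_le_dist_of_mem hz⟩
  choose p hp using this
  exact ⟨_, h.edge, h.neg.edge, p, h.isBoundaryPair, fun y _ => hp y, rfl⟩

namespace Selection
variable {h : Sample γ N τ σ ε Y} {g : ℝ → Plane} {p : Plane → Plane}

lemma exists_edge_eq (hs : h.Selection g p) {u : ℝ} (hu : u ∈ Icc (0 : ℝ) 1) :
    ∃ s, h.edge s = g u := by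
  have : g u ∈ range h.edge := hs.trace_eq ▸ ⟨u, hu, rfl⟩
  exact this

lemma isPiecewiseContinuous (hs : h.Selection g p) :
    IsPiecewiseContinuous fun u => midpoint ℝ (g u) (p (g u)) := by
  refine isPiecewiseContinuous_midpoint hs.simple hs.nearest (finite_vertices Y ε)
    (finite_ties Y ε) (fun u hu v hv => ?_) fun u hu hZ v hv v' hv' hd => ?_
  · obtain ⟨s, hs'⟩ := hs.exists_edge_eq hu
    rw [← hs'] at hv
    exact h.mem_cocircle_of_isNearest hv
  · by_contra hne
    refine hZ ⟨?_, v, hv, v', hv', hne, hd⟩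
    obtain ⟨s, hs'⟩ := hs.exists_edge_eq hu
    obtain ⟨c, hc, hcd⟩ := h.exists_dist_eq (g u)
    rw [← hs', h.infDist_edge, hs'] at hcd
    exact ⟨c, hc, hcd⟩

lemma exists_medialCompletion (hs : h.Selection g p) {G : ℝ → Plane}
    (hG : IsCompletion (fun u => midpoint ℝ (g u) (p (g u))) G) : ∃ K a l r s t,
      MedialCompletion g (range h.neg.edge) p (fun u => midpoint ℝ (g u) (p (g u))) G K a l r s t := by
  obtain ⟨K, a, l, r, s, t, hpc, hs0, hsN, htimes, hstart, hrun, hjump⟩ := hG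
  exact ⟨K, a, l, r, s, t, hs.simple, h.neg.isCompact_range_edge.isClosed, hs.nearest, rfl, hpc,
    hs0, hsN, htimes, hstart, hrun, hjump⟩

end Selection

/-- The medial fits of a dense sample are piecewise continuous, and their completions are simple
closed curves. -/
theorem medialFit_properties (h : Sample γ N τ σ ε Y) {F : ℝ → Plane}
    (hF : IsMedialFit (⋃ c ∈ Y, Metric.closedBall c ε) F) :
    IsPiecewiseContinuous F ∧ (∃ G, IsCompletion F G) ∧
      ∀ G, IsCompletion F G → IsSimpleClosedCurve G := by
  obtain ⟨g, p, rfl, hs⟩ := h.exists_selection hF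
  have hpc : IsPiecewiseContinuous fun u => midpoint ℝ (g u) (p (g u)) := by
    rcases hs with hs | hs <;> exact hs.isPiecewiseContinuous
  refine ⟨hpc, ?_, fun G hG => ?_⟩
  · obtain ⟨K, a, l, r, hpc⟩ := hpc
    exact hpc.exists_isCompletion
  · rcases hs with hs | hs <;>
      exact (hs.exists_medialCompletion hG).elim fun _ ⟨_, _, _, _, _, h⟩ => h.isSimpleClosedCurve

end Sample

/-! ### Hausdorff distance of the completed fit -/

lemma norm_sq_add_norm_sq_of_convex {a b : ℝ} (hab : a + b = 1) (x y : Plane) :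
    a * ‖x‖ ^ 2 + b * ‖y‖ ^ 2 = ‖a • x + b • y‖ ^ 2 + a * b * ‖x - y‖ ^ 2 := by
  simp only [norm_sq_eq, PiLp.add_apply, PiLp.smul_apply, PiLp.sub_apply, smul_eq_mul]
  obtain rfl : b = 1 - a := by linarith
  ring

namespace NormalFrame
variable {γ N : ℝ → Plane} {τ : ℝ}

/-- A short chord of the curve stays close to the curve. -/
lemma infDist_mul_le_of_mem_segment (h : NormalFrame γ N τ) {z₁ z₂ z : Plane} (h₁ : z₁ ∈ range γ)
    (h₂ : z₂ ∈ range γ) (hz : z ∈ segment ℝ z₁ z₂) (hd : Metric.infDist z (range γ) ≤ τ) :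
    Metric.infDist z (range γ) * τ ≤ ‖z₁ - z₂‖ ^ 2 / 4 := by
  obtain ⟨s, hs⟩ := h.exists_foot_nonneg_or z
  set t := Metric.infDist z (range γ) with ht
  have ht0 : 0 ≤ t := Metric.infDist_nonneg
  obtain ⟨M, hM, hzM⟩ : ∃ M : ℝ → Plane, NormalFrame γ M τ ∧ z = γ s + t • M s := by
    rcases hs with hs | hs
    · exact ⟨N, h, hs⟩
    · exact ⟨fun s => -N s, h.neg, by rw [smul_neg, ← neg_smul]; exact hs⟩
  have hτ := h.radius_pos
  -- The tangent disc centred at `q` lies on the side of `z`: both ends of the chord are at least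
  -- `τ` from `q`, while `z` is at distance `τ - t`. The convexity identity compares the squares.
  set q := γ s + τ • M s with hq
  have far : ∀ x ∈ range γ, τ ^ 2 ≤ ‖x - q‖ ^ 2 := by
    rintro _ ⟨s', rfl⟩
    have := hM.le_norm_sq s τ s'
    rw [abs_of_pos hτ, div_self hτ.ne', sub_self, zero_mul, add_zero] at this
    rwa [norm_sub_rev]
  obtain ⟨a, b, ha, hb, hab, hzab⟩ := hz
  have e1 := norm_sq_add_norm_sq_of_convex hab (z₁ - q) (z₂ - q)
  have e2 : a • (z₁ - q) + b • (z₂ - q) = z - q := by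
    rw [← hzab, smul_sub, smul_sub, show a • z₁ - a • q + (b • z₂ - b • q) =
      a • z₁ + b • z₂ - (a + b) • q by rw [add_smul]; abel, hab, one_smul]
  have e3 : ‖z - q‖ ^ 2 = (τ - t) ^ 2 := by
    rw [hzM, hq, add_sub_add_left_eq_sub, ← sub_smul, norm_smul, hM.norm_eq, mul_one,
      Real.norm_eq_abs, sq_abs]; ring
  rw [e2, e3, sub_sub_sub_cancel_right] at e1
  have e4 : a * b ≤ 1 / 4 := by nlinarith [sq_nonneg (a - b)]
  have e5 := mul_le_mul_of_nonneg_right e4 (sq_nonneg ‖z₁ - z₂‖)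
  have e6 := mul_le_mul_of_nonneg_left (far z₁ h₁) ha
  have e7 := mul_le_mul_of_nonneg_left (far z₂ h₂) hb
  have e8 : a * τ ^ 2 + b * τ ^ 2 = τ ^ 2 := by rw [← add_mul, hab, one_mul]
  nlinarith

end NormalFrame

namespace Sample
variable {γ N : ℝ → Plane} {τ σ ε : ℝ} {Y : Finset Plane}

/-- The constant in the bound for the tangential deviation of the medial fit. -/
noncomputable def devConst (τ σ : ℝ) : ℝ := 16 * σ * τ / (τ - σ)

lemma devConst_pos (h : Sample γ N τ σ ε Y) : 0 < devConst τ σ := by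
  have := h.frame.radius_pos
  have := h.tube_pos
  have : 0 < τ - σ := by linarith [h.small, h.pos]
  unfold devConst; positivity

/-- The crossing point is within `σ + 2 * ε` of the boundary point, whose height is at least `σ`. By
`le_norm_sq` the excess of the squared distance, at most `8 * σ * ε`, controls the squared
displacement from the foot, since `1 - height / τ ≥ (τ - σ) / (2 * τ)`. -/
lemma exists_mem_range_near (h : Sample γ N τ σ ε Y) {s : ℝ} {v : Plane}
    (hv : IsNearest (range h.neg.edge) (h.edge s) v) : ∃ z ∈ range γ,
      dist (midpoint ℝ (h.edge s) v) z ≤ ε ∧ ‖z - γ s‖ ^ 2 ≤ devConst τ σ * ε := by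
  obtain ⟨_, ⟨s', rfl⟩, -, hyz, -, hmz⟩ := h.exists_crossing hv.1 (h.dist_le_of_isNearest hv)
  refine ⟨γ s', mem_range_self s', hmz, ?_⟩
  have h1 := h.frame.le_norm_sq s (h.height s) s'
  have h2 := pow_le_pow_left₀ dist_nonneg hyz 2
  rw [dist_eq_norm, edge] at h2
  have hm := h.height_mem s
  have hτ := h.frame.radius_pos
  have hε := h.pos
  have hσ := h.tube_pos
  have hsm := h.small
  have hle := h.le
  rw [h.abs_height] at h1
  have h3 : (τ - σ) / (2 * τ) ≤ 1 - h.height s / τ := by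
    rw [one_sub_div hτ.ne', div_le_div_iff₀ (by positivity) hτ]; nlinarith [hm.2]
  have h4 := mul_le_mul_of_nonneg_right h3 (sq_nonneg ‖γ s' - γ s‖)
  have h5 : σ ^ 2 ≤ h.height s ^ 2 := pow_le_pow_left₀ hσ.le (by linarith [hm.1]) 2
  have h6 : (τ - σ) / (2 * τ) * ‖γ s' - γ s‖ ^ 2 ≤ 8 * σ * ε := by nlinarith
  rw [div_mul_eq_mul_div, div_le_iff₀ (by positivity)] at h6
  rw [devConst, div_mul_eq_mul_div, le_div_iff₀ (by linarith)]
  linarith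

/-- A point over `h.edge s` is within `ε` of a chord between two crossing points. These may be
displaced by order `√ε` along the curve, but a chord of that length deviates from the curve only by
order `ε`. -/
lemma isOver_bounds (h : Sample γ N τ σ ε Y) (hsmall : devConst τ σ * ε ≤ τ ^ 2) {s : ℝ}
    {m : Plane} (hm : IsOver (range h.neg.edge) (h.edge s) m) :
    Metric.infDist m (range γ) ≤ (1 + devConst τ σ / τ) * ε ∧
      ‖m - γ s‖ ≤ ε + √(devConst τ σ * ε) := by
  obtain ⟨v₁, v₂, hv₁, hv₂, w, ⟨a, b, ha, hb, hab, rfl⟩, rfl⟩ := hm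
  obtain ⟨z₁, hz₁, hm₁, hd₁⟩ := h.exists_mem_range_near hv₁
  obtain ⟨z₂, hz₂, hm₂, hd₂⟩ := h.exists_mem_range_near hv₂
  set K := devConst τ σ
  have hτ := h.frame.radius_pos
  set y := h.edge s
  set z := a • z₁ + b • z₂ with hz
  have hzs : z ∈ segment ℝ z₁ z₂ := ⟨a, b, ha, hb, hab, rfl⟩
  have hmid : midpoint ℝ y (a • v₁ + b • v₂) =
      a • midpoint ℝ y v₁ + b • midpoint ℝ y v₂ := by
    simp only [midpoint_eq_smul_add]
    rw [show (⅟2 : ℝ) • (y + (a • v₁ + b • v₂)) = (⅟2 : ℝ) • ((a + b) • y + (a • v₁ + b • v₂)) by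
      rw [hab, one_smul]]
    module
  have hmz : dist (midpoint ℝ y (a • v₁ + b • v₂)) z ≤ ε := by
    rw [hmid, hz, dist_eq_norm, show a • midpoint ℝ y v₁ + b • midpoint ℝ y v₂ -
      (a • z₁ + b • z₂) = a • (midpoint ℝ y v₁ - z₁) + b • (midpoint ℝ y v₂ - z₂) by module]
    refine (norm_add_le _ _).trans ?_
    rw [norm_smul, norm_smul, Real.norm_of_nonneg ha, Real.norm_of_nonneg hb, ← dist_eq_norm,
      ← dist_eq_norm]
    calc a * dist (midpoint ℝ y v₁) z₁ + b * dist (midpoint ℝ y v₂) z₂ ≤ a * ε + b * ε := by gcongr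
      _ = ε := by rw [← add_mul, hab, one_mul]
  have hzγ : ‖z - γ s‖ ≤ √(K * ε) := by
    rw [hz, show a • z₁ + b • z₂ - γ s = a • (z₁ - γ s) + b • (z₂ - γ s) by
      rw [show a • z₁ + b • z₂ - γ s = a • z₁ + b • z₂ - (a + b) • γ s by rw [hab, one_smul]]
      module]
    refine (norm_add_le _ _).trans ?_
    rw [norm_smul, norm_smul, Real.norm_of_nonneg ha, Real.norm_of_nonneg hb]
    have e1 := Real.le_sqrt_of_sq_le hd₁
    have e2 := Real.le_sqrt_of_sq_le hd₂
    calc a * ‖z₁ - γ s‖ + b * ‖z₂ - γ s‖ ≤ a * √(K * ε) + b * √(K * ε) := by gcongr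
      _ = √(K * ε) := by rw [← add_mul, hab, one_mul]
  have hsq : √(K * ε) ≤ τ := by
    rw [Real.sqrt_le_left hτ.le]; exact hsmall
  have hzd : Metric.infDist z (range γ) ≤ τ := by
    refine (Metric.infDist_le_dist_of_mem (mem_range_self s)).trans ?_
    rw [dist_eq_norm]; exact hzγ.trans hsq
  have hch := h.frame.infDist_mul_le_of_mem_segment hz₁ hz₂ hzs hzd
  have h12 : ‖z₁ - z₂‖ ^ 2 ≤ 4 * (K * ε) := by
    have e1 : ‖z₁ - z₂‖ ≤ ‖z₁ - γ s‖ + ‖z₂ - γ s‖ := by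
      rw [show z₁ - z₂ = (z₁ - γ s) - (z₂ - γ s) by abel]; exact norm_sub_le _ _
    have e2 := pow_le_pow_left₀ (norm_nonneg _) e1 2
    nlinarith [sq_nonneg (‖z₁ - γ s‖ - ‖z₂ - γ s‖)]
  have hzK : Metric.infDist z (range γ) ≤ K / τ * ε := by
    rw [div_mul_eq_mul_div, le_div_iff₀ hτ]; linarith
  constructor
  · have := Metric.infDist_le_infDist_add_dist (s := range γ)
      (x := midpoint ℝ y (a • v₁ + b • v₂)) (y := z)
    linarith
  · rw [← dist_eq_norm] at hzγ ⊢
    linarith [dist_triangle (midpoint ℝ y (a • v₁ + b • v₂)) z (γ s)]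

end Sample

namespace ClosedFrame
variable {γ T : ℝ → Plane} {ℓ τ : ℝ}

lemma exists_inner_tangent_ge (h : ClosedFrame γ T ℓ τ) :
    ∃ w > 0, ∀ s s', |s - s'| ≤ w → 1 / 2 ≤ inner ℝ (T s) (T s') := by
  -- After translation by `⌊s⌋` the point `s` is in `[0, 1)` and any `s'` within distance `1` of it
  -- is in `[-1, 2]`.
  have hu := isCompact_Icc.uniformContinuousOn_of_continuous
    (h.continuous_tangent.continuousOn (s := Icc (-1) 2))
  obtain ⟨w, hw, hd⟩ := Metric.uniformContinuousOn_iff.1 hu 1 one_pos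
  refine ⟨min (w / 2) 1, by positivity, fun s s' hs => ?_⟩
  have hs1 := hs.trans (min_le_left _ _)
  have hs2 := abs_le.1 (hs.trans (min_le_right _ _))
  have e1 : T (s - ⌊s⌋) = T s := by
    simpa using h.periodic_tangent.sub_int_mul_eq ⌊s⌋ (x := s)
  have e2 : T (s' - ⌊s⌋) = T s' := by
    simpa using h.periodic_tangent.sub_int_mul_eq ⌊s⌋ (x := s')
  have hf := Int.floor_le s
  have hf' := Int.lt_floor_add_one s
  have h1 := hd (s - ⌊s⌋) ⟨by linarith, by linarith⟩ (s' - ⌊s⌋)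
    ⟨by linarith [hs2.2], by linarith [hs2.1]⟩ (by
      rw [Real.dist_eq, sub_sub_sub_cancel_right]; linarith)
  rw [e1, e2] at h1
  rw [dist_eq_norm] at h1
  have h2 : ‖T s - T s'‖ ^ 2 < 1 := by nlinarith [norm_nonneg (T s - T s')]
  rw [norm_sub_sq_real, h.norm_eq, h.norm_eq] at h2
  linarith

lemma hasDerivAt_inner (h : ClosedFrame γ T ℓ τ) (s₀ s : ℝ) :
    HasDerivAt (fun s => inner ℝ (T s₀) (γ s)) (ℓ * inner ℝ (T s₀) (T s)) s := by
  have := (hasDerivAt_const s (T s₀)).inner ℝ (h.deriv s)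
  simpa [real_inner_smul_right] using this

lemma le_inner_sub (h : ClosedFrame γ T ℓ τ) {w : ℝ}
    (hw : ∀ s s', |s - s'| ≤ w → 1 / 2 ≤ inner ℝ (T s) (T s')) {s₀ a b : ℝ} (hab : a ≤ b)
    (ha : s₀ - w ≤ a) (hb : b ≤ s₀ + w) :
    ℓ * (b - a) / 2 ≤ inner ℝ (T s₀) (γ b - γ a) := by
  have hmono : MonotoneOn (fun s => inner ℝ (T s₀) (γ s) - ℓ / 2 * s) (Icc a b) := by
    have hd : ∀ s, HasDerivAt (fun s => inner ℝ (T s₀) (γ s) - ℓ / 2 * s)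
        (ℓ * inner ℝ (T s₀) (T s) - ℓ / 2) s := fun s => by
      have := (h.hasDerivAt_inner s₀ s).sub ((hasDerivAt_id s).const_mul (ℓ / 2))
      simpa using! this
    refine monotoneOn_of_deriv_nonneg (convex_Icc a b)
      (fun s _ => (hd s).continuousAt.continuousWithinAt)
      (fun s _ => (hd s).differentiableAt.differentiableWithinAt) fun s hs => ?_
    rw [interior_Icc] at hs
    rw [(hd s).deriv]
    have := hw s₀ s (by rw [abs_le]; constructor <;> linarith [hs.1, hs.2])
    nlinarith [h.speed_pos]
  have := hmono ⟨le_rfl, hab⟩ ⟨hab, le_rfl⟩ hab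
  rw [inner_sub_right]
  simp only at this
  linarith

lemma norm_sub_le (h : ClosedFrame γ T ℓ τ) (s s' : ℝ) : ‖γ s' - γ s‖ ≤ ℓ * |s' - s| := by
  refine (convex_univ (𝕜 := ℝ)).norm_image_sub_le_of_norm_hasDerivWithin_le
    (fun x _ => (h.deriv x).hasDerivWithinAt) (fun x _ => ?_) (mem_univ s) (mem_univ s')
  rw [norm_smul, h.norm_eq x, Real.norm_of_nonneg h.speed_pos.le, mul_one]

end ClosedFrame

namespace Sample
variable {γ N T : ℝ → Plane} {τ σ ε ℓ : ℝ} {Y : Finset Plane}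

/-- The completed fit crosses every normal line of the curve near its foot point. -/
lemma exists_mem_trace_inner_eq_zero (h : Sample γ N τ σ ε Y) (hC : ClosedFrame γ T ℓ τ)
    {w R : ℝ} (hw : ∀ s s', |s - s'| ≤ w → 1 / 2 ≤ inner ℝ (T s) (T s')) (hR : 0 < R)
    (hRw : 2 * R / ℓ ≤ w) {g G F : ℝ → Plane} {p : Plane → Plane} (hs : h.Selection g p)
    {K : ℕ} {a : ℕ → ℝ} {l r : ℕ → Plane} {sj tj : ℕ → ℝ}
    (hG : MedialCompletion g (range h.neg.edge) p F G K a l r sj tj)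
    (hnear : ∀ s m, IsOver (range h.neg.edge) (h.edge s) m → ‖m - γ s‖ ≤ R) (s₀ : ℝ) :
    ∃ m ∈ trace G, ∃ s, IsOver (range h.neg.edge) (h.edge s) m ∧ ‖m - γ s₀‖ ≤ 3 * R ∧
      inner ℝ (T s₀) (m - γ s₀) = 0 := by
  set B := range h.neg.edge
  have hℓ := hC.speed_pos
  -- Over a parameter distance `d` the curve advances by at least `ℓ * d / 2 = R` in direction `T
  -- s₀`, enough to absorb the error `R` in `hnear`.
  set d := 2 * R / ℓ with hd
  have hd0 : 0 < d := by positivity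
  have hℓd : ℓ * d = 2 * R := by rw [hd]; field_simp
  have hE : IsCompact (trace G) := hG.isSimpleClosedCurve.isCompact_trace
  have hπ : ∀ m, ∃ y, m ∈ trace G → IsOver B y m := fun m => by
    by_cases hm : m ∈ trace G
    · obtain ⟨y, -, hy⟩ := hG.exists_isOver hm
      exact ⟨y, fun _ => hy⟩
    · exact ⟨0, fun h => absurd h hm⟩
  choose π hπ using hπ
  have hπc : ContinuousOn π (trace G) := by
    have : LipschitzOnWith 2 π (trace G) := LipschitzOnWith.of_dist_le_mul fun m hm m' hm' => by
      rw [dist_eq_norm, dist_eq_norm]; exact norm_sub_le_of_isOver (hπ m hm) (hπ m' hm')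
    exact this.continuousOn
  have hπu : ∀ m ∈ trace G, ∀ y, IsOver B y m → π m = y := fun m hm y hy => by
    have := norm_sub_le_of_isOver (hπ m hm) hy
    rw [sub_self, norm_zero, mul_zero] at this
    exact sub_eq_zero.1 (norm_le_zero_iff.1 this)
  set ψ : Plane → ℝ := fun m => inner ℝ (T s₀) (m - γ s₀) with hψ
  have hψc : Continuous ψ := by simp only [hψ]; fun_prop
  -- The completed curve need not be a function of the boundary point, so its two closed halves are
  -- projected to the boundary. They cover the connected arc around `h.edge s₀` and each contains
  -- one end, hence they share a point; the part of the curve over it is convex and meets both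
  -- half-planes.
  set A₁ := π '' (trace G ∩ {m | 0 ≤ ψ m}) with hA₁
  set A₂ := π '' (trace G ∩ {m | ψ m ≤ 0}) with hA₂
  have hc₁ : IsClosed A₁ := ((hE.inter_right (isClosed_le continuous_const hψc)).image_of_continuousOn
    (hπc.mono inter_subset_left)).isClosed
  have hc₂ : IsClosed A₂ := ((hE.inter_right (isClosed_le hψc continuous_const)).image_of_continuousOn
    (hπc.mono inter_subset_left)).isClosed
  have hover : ∀ s, ∃ m ∈ trace G, IsOver B (h.edge s) m := fun s =>
    hG.exists_mem_trace (hs.trace_eq ▸ mem_range_self s)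
  have hcon : IsPreconnected (h.edge '' Icc (s₀ - d) (s₀ + d)) :=
    isPreconnected_Icc.image _ h.continuous_edge.continuousOn
  have hψs : ∀ s m, IsOver B (h.edge s) m → |ψ m - inner ℝ (T s₀) (γ s - γ s₀)| ≤ R := by
    intro s m hm
    simp only [hψ]
    rw [← inner_sub_right, sub_sub_sub_cancel_right]
    refine (abs_real_inner_le_norm _ _).trans ?_
    rw [hC.norm_eq, one_mul]; exact hnear s m hm
  obtain ⟨y, ⟨s, hsI, rfl⟩, ⟨m₁, ⟨hm₁, hψ₁⟩, hy₁⟩, ⟨m₂, ⟨hm₂, hψ₂⟩, hy₂⟩⟩ :=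
    isPreconnected_closed_iff.1 hcon A₁ A₂ hc₁ hc₂ (by
      rintro _ ⟨s, -, rfl⟩
      obtain ⟨m, hm, hov⟩ := hover s
      rcases le_total 0 (ψ m) with h0 | h0
      · exact Or.inl ⟨m, ⟨hm, h0⟩, hπu m hm _ hov⟩
      · exact Or.inr ⟨m, ⟨hm, h0⟩, hπu m hm _ hov⟩) (by
      obtain ⟨m, hm, hov⟩ := hover (s₀ + d)
      refine ⟨h.edge (s₀ + d), ⟨_, ⟨by linarith, le_rfl⟩, rfl⟩, m, ⟨hm, ?_⟩, hπu m hm _ hov⟩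
      have e1 := (abs_le.1 (hψs _ m hov)).1
      have e2 := hC.le_inner_sub hw (s₀ := s₀) (a := s₀) (b := s₀ + d) (by linarith) (by linarith)
        (by linarith)
      rw [add_sub_cancel_left, hℓd] at e2
      show 0 ≤ ψ m
      linarith) (by
      obtain ⟨m, hm, hov⟩ := hover (s₀ - d)
      refine ⟨h.edge (s₀ - d), ⟨_, ⟨le_rfl, by linarith⟩, rfl⟩, m, ⟨hm, ?_⟩, hπu m hm _ hov⟩
      have e1 := (abs_le.1 (hψs _ m hov)).2
      have e2 := hC.le_inner_sub hw (s₀ := s₀) (a := s₀ - d) (b := s₀) (by linarith) (by linarith)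
        (by linarith)
      rw [sub_sub_cancel, hℓd, ← neg_sub, inner_neg_right] at e2
      show ψ m ≤ 0
      linarith)
  have hov₁ : IsOver B (h.edge s) m₁ := hy₁ ▸ hπ m₁ hm₁
  have hov₂ : IsOver B (h.edge s) m₂ := hy₂ ▸ hπ m₂ hm₂
  obtain ⟨m, hm, hm0⟩ := (convex_segment m₁ m₂).isPreconnected.intermediate_value
    (right_mem_segment ℝ m₁ m₂) (left_mem_segment ℝ m₁ m₂) hψc.continuousOn
    (show (0 : ℝ) ∈ Icc (ψ m₂) (ψ m₁) from ⟨hψ₂, hψ₁⟩)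
  obtain ⟨hmG, hov⟩ := hG.segment_subset (hs.trace_eq ▸ mem_range_self s) hm₁ hm₂ hov₁ hov₂ m hm
  refine ⟨m, hmG, s, hov, ?_, hm0⟩
  have e1 := hC.norm_sub_le s₀ s
  have e2 : |s - s₀| ≤ d := by rw [abs_le]; constructor <;> linarith [hsI.1, hsI.2]
  have e3 : ‖γ s - γ s₀‖ ≤ 2 * R := by
    rw [← hℓd]; exact e1.trans (mul_le_mul_of_nonneg_left e2 hℓ.le)
  have e4 := hnear s m hov
  rw [show m - γ s₀ = (m - γ s) + (γ s - γ s₀) by abel]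
  linarith [norm_add_le (m - γ s) (γ s - γ s₀)]

/-- The constant in the Hausdorff bound. -/
noncomputable def fitConst (τ σ : ℝ) : ℝ :=
  2 * (1 + devConst τ σ / τ) +
    (36 * (devConst τ σ + σ) + 2 * (1 + devConst τ σ / τ) ^ 2 * σ) / (2 * τ)

/-- One direction is `isOver_bounds`. For the other, take `m` on the normal line at `γ s₀`, within
`3 * R`, and the curve point `z` nearest to it, within `κ * ε`. The tangential part of `z - γ s₀` is
at most `κ * ε`, since that of `m - γ s₀` vanishes. Its normal part is at most `‖z - γ s₀‖ ^ 2 / (2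
* τ)`, which is of order `ε` because `R ^ 2` is. -/
theorem hausdorffEDist_le_of_selection (h : Sample γ N τ σ ε Y) (hC : ClosedFrame γ T ℓ τ)
    (hN : ∀ s v, inner ℝ (T s) v ^ 2 + inner ℝ (N s) v ^ 2 = ‖v‖ ^ 2) {w : ℝ}
    (hw : ∀ s s', |s - s'| ≤ w → 1 / 2 ≤ inner ℝ (T s) (T s')) (hw0 : 0 < w)
    (hsmall : devConst τ σ * ε ≤ τ ^ 2)
    (hsmall' : 2 * (devConst τ σ + σ) * ε ≤ (w * ℓ / 2) ^ 2) {g G : ℝ → Plane}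
    {p : Plane → Plane} (hs : h.Selection g p)
    (hG : IsCompletion (fun u => midpoint ℝ (g u) (p (g u))) G) :
    Metric.hausdorffEDist (trace G) (range γ) ≤ ENNReal.ofReal (fitConst τ σ * ε) := by
  obtain ⟨K, a, l, r, sj, tj, hG⟩ := hs.exists_medialCompletion hG
  have hε := h.pos
  have hσ := h.tube_pos
  have hεσ := h.le
  have hτ := h.frame.radius_pos
  have hℓ := hC.speed_pos
  have hD := h.devConst_pos
  set D := devConst τ σ with hDdef
  set κ := 1 + D / τ with hκ
  have hκ0 : 0 < κ := by positivity
  set R := ε + √(D * ε) with hR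
  have hR0 : 0 < R := by positivity
  have hRsq : R ^ 2 ≤ 2 * (D + σ) * ε := by
    have e1 := Real.sq_sqrt (show 0 ≤ D * ε by positivity)
    nlinarith [sq_nonneg (ε - √(D * ε))]
  have hRw : 2 * R / ℓ ≤ w := by
    rw [div_le_iff₀ hℓ]
    have := (sq_le_sq₀ hR0.le (by positivity)).1 (hRsq.trans hsmall')
    linarith
  have hκle : κ ≤ fitConst τ σ := by
    have : 0 ≤ (36 * (D + σ) + 2 * κ ^ 2 * σ) / (2 * τ) := by positivity
    unfold fitConst
    rw [← hDdef, ← hκ]; linarith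
  refine Metric.hausdorffEDist_le_of_mem_edist ?_ ?_
  · intro m hm
    obtain ⟨y, hy, hov⟩ := hG.exists_isOver hm
    obtain ⟨s, rfl⟩ : y ∈ range h.edge := hs.trace_eq ▸ hy
    obtain ⟨z, hz, hmz⟩ := h.frame.isCompact_range.exists_infDist_eq_dist (range_nonempty γ) m
    refine ⟨z, hz, ?_⟩
    rw [edist_dist]
    refine ENNReal.ofReal_le_ofReal ?_
    rw [← hmz]
    exact (h.isOver_bounds hsmall hov).1.trans (mul_le_mul_of_nonneg_right hκle hε.le)
  · rintro _ ⟨s₀, rfl⟩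
    obtain ⟨m, hm, s, hov, hm3, hm0⟩ := h.exists_mem_trace_inner_eq_zero hC hw hR0 hRw hs hG
      (fun s m hm => (h.isOver_bounds hsmall hm).2) s₀
    refine ⟨m, hm, ?_⟩
    rw [edist_dist]
    refine ENNReal.ofReal_le_ofReal ?_
    obtain ⟨_, ⟨s', rfl⟩, hmz⟩ :=
      h.frame.isCompact_range.exists_infDist_eq_dist (range_nonempty γ) m
    have hmd := (h.isOver_bounds hsmall hov).1
    rw [hmz, dist_eq_norm] at hmd
    set z := γ s'
    rw [dist_comm, dist_eq_norm]
    have e1 : ‖z - γ s₀‖ ≤ 3 * R + κ * ε := by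
      rw [show z - γ s₀ = (m - γ s₀) - (m - z) by abel]
      linarith [_root_.norm_sub_le (m - γ s₀) (m - z)]
    have e2 : |inner ℝ (T s₀) (z - γ s₀)| ≤ κ * ε := by
      rw [show z - γ s₀ = (m - γ s₀) - (m - z) by abel, inner_sub_right, hm0, zero_sub, abs_neg]
      refine (abs_real_inner_le_norm _ _).trans ?_
      rw [hC.norm_eq, one_mul]; exact hmd
    have e3 := h.frame.disc s₀ s'
    have e4 := pow_le_pow_left₀ (norm_nonneg _) e1 2
    have e5 : (3 * R + κ * ε) ^ 2 ≤ (36 * (D + σ) + 2 * κ ^ 2 * σ) * ε := by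
      have : κ ^ 2 * ε ^ 2 ≤ κ ^ 2 * (σ * ε) :=
        mul_le_mul_of_nonneg_left (by nlinarith) (sq_nonneg κ)
      nlinarith [sq_nonneg (3 * R - κ * ε)]
    have e6 : |inner ℝ (N s₀) (z - γ s₀)| ≤
        (36 * (D + σ) + 2 * κ ^ 2 * σ) / (2 * τ) * ε := by
      rw [div_mul_eq_mul_div, le_div_iff₀ (by positivity)]; linarith
    have e7 : ‖z - γ s₀‖ ≤ |inner ℝ (T s₀) (z - γ s₀)| + |inner ℝ (N s₀) (z - γ s₀)| := by
      rw [← sq_le_sq₀ (norm_nonneg _) (by positivity), ← hN s₀, add_sq, sq_abs, sq_abs]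
      nlinarith [mul_nonneg (abs_nonneg (inner ℝ (T s₀) (z - γ s₀)))
        (abs_nonneg (inner ℝ (N s₀) (z - γ s₀)))]
    have e8 : ‖m - γ s₀‖ ≤ ‖m - z‖ + ‖z - γ s₀‖ := by
      rw [show m - γ s₀ = (m - z) + (z - γ s₀) by abel]; exact norm_add_le _ _
    unfold fitConst
    rw [← hDdef, ← hκ, add_mul]
    linarith

/-- The Hausdorff distance of the completed fits of a dense sample from the curve is of the order
of the radius of the balls. -/
theorem iSup_hausdorffEDist_le (h : Sample γ (fun s => perp (T s)) τ σ ε Y)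
    (hC : ClosedFrame γ T ℓ τ) {w : ℝ}
    (hw : ∀ s s', |s - s'| ≤ w → 1 / 2 ≤ inner ℝ (T s) (T s')) (hw0 : 0 < w)
    (hsmall : devConst τ σ * ε ≤ τ ^ 2)
    (hsmall' : 2 * (devConst τ σ + σ) * ε ≤ (w * ℓ / 2) ^ 2) :
    ⨆ G ∈ completedMedialEstimators (⋃ c ∈ Y, Metric.closedBall c ε),
      Metric.hausdorffEDist (trace G) (range γ) ≤ ENNReal.ofReal (fitConst τ σ * ε) := by
  refine iSup₂_le fun G ⟨F, hF, hG⟩ => ?_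
  obtain ⟨g, p, rfl, hs | hs⟩ := h.exists_selection hF
  · exact h.hausdorffEDist_le_of_selection hC
      (fun s v => inner_sq_add_inner_perp_sq (hC.norm_eq s) v) hw hw0 hsmall hsmall' hs hG
  · exact h.neg.hausdorffEDist_le_of_selection hC
      (fun s v => by rw [inner_neg_left, neg_sq]; exact inner_sq_add_inner_perp_sq (hC.norm_eq s) v)
      hw hw0 hsmall hsmall' hs hG

end Sample

/-! ### Small-ball probabilities -/

/-- The edge asymptotics apply at radius `σ - d`; radial monotonicity carries the bound to all
smaller radii. Half the constant absorbs the error of the asymptotic equivalence. -/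
lemma IsNoiseDensity.exists_lower_bound {σ β : ℝ} {φ : Plane → ℝ} (hσ : 0 < σ)
    (hφ : IsNoiseDensity σ β φ) : ∃ c > 0, ∃ η > 0, ∀ d, 0 < d → d < η → ∀ x : Plane,
      ‖x‖ ≤ σ - d → c * d ^ β ≤ φ x := by
  obtain ⟨C, hC, hequiv⟩ := hφ.edge
  have h1 := hequiv.isLittleO.def (show (0 : ℝ) < 1 / 2 by norm_num)
  rw [Filter.eventually_comap] at h1
  obtain ⟨b, hb, hbs⟩ := (mem_nhdsLT_iff_exists_Ioo_subset' (show (0 : ℝ) < σ from hσ)).1 h1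
  have hb' : b < σ := hb
  refine ⟨C / 2, by positivity, min (σ - b) σ, lt_min (by linarith) hσ, fun d hd hdη x hx => ?_⟩
  obtain ⟨h2, h3⟩ := lt_min_iff.1 hdη
  set z : Plane := EuclideanSpace.single 0 (σ - d) with hz
  have hzn : ‖z‖ = σ - d := by
    rw [hz, PiLp.norm_single, Real.norm_of_nonneg (by linarith)]
  have h4 := hbs (show σ - d ∈ Ioo b σ from ⟨by linarith, by linarith⟩) z hzn
  simp only [Pi.sub_apply, hzn, sub_sub_cancel] at h4
  have h5 : 0 < C * d ^ β := by positivity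
  rw [Real.norm_eq_abs, Real.norm_of_nonneg h5.le] at h4
  have h6 := (abs_le.1 h4).1
  have h7 := hφ.nonincreasing x z (hx.trans hzn.ge)
  linarith

/-- Lower bound for the noise probability of a disc whose centre is slightly outside the support. -/
lemma IsNoiseDensity.exists_noiseLaw_closedBall_ge {σ β : ℝ} {φ : Plane → ℝ} (hσ : 0 < σ)
    (hφ : IsNoiseDensity σ β φ) : ∃ c > 0, ∃ η > 0, ∀ δ, 0 < δ → δ < η → ∀ z : Plane,
      ‖z‖ ≤ σ + δ / 4 → ENNReal.ofReal (c * δ ^ (2 + β)) ≤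
        noiseLaw φ (Metric.closedBall z δ) := by
  obtain ⟨c, hc, η, hη, hlow⟩ := hφ.exists_lower_bound hσ
  set V := (volume (Metric.ball (0 : Plane) 1)).toReal with hV
  have hVf : volume (Metric.ball (0 : Plane) 1) ≠ ∞ := measure_ball_lt_top.ne
  have hV0 : 0 < V := ENNReal.toReal_pos (Metric.measure_ball_pos _ _ one_pos).ne' hVf
  refine ⟨c * (1 / 8) ^ β * (1 / 64) * V, by positivity, min η σ, lt_min hη hσ,
    fun δ hδ hδη z hz => ?_⟩
  obtain ⟨hδ1, hδ2⟩ := lt_min_iff.1 hδη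
  have hden : 0 < σ + δ / 4 := by positivity
  -- Radial shrinking by `k` moves the centre by at most `δ / 2` and to depth at least `δ / 4`
  -- inside the support, so the disc of radius `δ / 8` about `k • z` lies in the given disc and
  -- stays at depth `δ / 8`.
  set k := (σ - δ / 4) / (σ + δ / 4) with hk
  have hk0 : 0 ≤ k := div_nonneg (by linarith) hden.le
  have hk1 : k * (σ + δ / 4) = σ - δ / 4 := div_mul_cancel₀ _ hden.ne'
  have hk2 : (1 - k) * (σ + δ / 4) = δ / 2 := by rw [sub_mul, hk1]; ring
  have hk3 : 0 ≤ 1 - k := by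
    by_contra hneg
    push Not at hneg
    nlinarith
  have hz1 : ‖k • z‖ ≤ σ - δ / 4 := by
    rw [norm_smul, Real.norm_of_nonneg hk0, ← hk1]; exact mul_le_mul_of_nonneg_left hz hk0
  have hz2 : dist (k • z) z ≤ δ / 2 := by
    rw [dist_comm, dist_eq_norm, show z - k • z = (1 - k) • z by rw [sub_smul, one_smul], norm_smul,
      Real.norm_of_nonneg hk3, ← hk2]
    exact mul_le_mul_of_nonneg_left hz hk3
  have hsub : Metric.ball (k • z) (δ / 8) ⊆ Metric.closedBall z δ := by
    intro x hx
    rw [Metric.mem_ball] at hx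
    rw [Metric.mem_closedBall]
    linarith [dist_triangle x (k • z) z]
  have hval : ∀ x ∈ Metric.ball (k • z) (δ / 8), c * (δ / 8) ^ β ≤ φ x := by
    intro x hx
    refine hlow (δ / 8) (by positivity) (by linarith) x ?_
    rw [Metric.mem_ball, dist_eq_norm] at hx
    have : x = k • z + (x - k • z) := by abel
    rw [this]
    linarith [norm_add_le (k • z) (x - k • z)]
  have hvol : volume (Metric.ball (k • z) (δ / 8)) = ENNReal.ofReal ((δ / 8) ^ 2 * V) := by
    rw [Measure.addHaar_ball _ _ (by positivity), finrank_euclideanSpace_fin,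
      ENNReal.ofReal_mul (by positivity), hV, ENNReal.ofReal_toReal hVf]
  calc ENNReal.ofReal (c * (1 / 8) ^ β * (1 / 64) * V * δ ^ (2 + β))
      = ENNReal.ofReal (c * (δ / 8) ^ β) * volume (Metric.ball (k • z) (δ / 8)) := by
        rw [hvol, ← ENNReal.ofReal_mul (by positivity)]
        congr 1
        rw [div_eq_mul_one_div δ 8, Real.mul_rpow hδ.le (by norm_num), Real.rpow_add hδ,
          Real.rpow_two]
        ring
    _ = ∫⁻ _ in Metric.ball (k • z) (δ / 8), ENNReal.ofReal (c * (δ / 8) ^ β) := by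
        rw [setLIntegral_const]
    _ ≤ ∫⁻ x in Metric.ball (k • z) (δ / 8), ENNReal.ofReal (φ x) :=
        setLIntegral_mono' measurableSet_ball fun x hx => ENNReal.ofReal_le_ofReal (hval x hx)
    _ ≤ ∫⁻ x in Metric.closedBall z δ, ENNReal.ofReal (φ x) := lintegral_mono_set hsub
    _ = noiseLaw φ (Metric.closedBall z δ) := by
        rw [noiseLaw, withDensity_apply _ measurableSet_closedBall]

/-- Lower bound for the design probability of an interval around a point of `[0,1]`. -/
lemma designLaw_ge {h : ℝ → ℝ} {c : ℝ} (hc : 0 < c) (hh : ∀ u ∈ Icc (0 : ℝ) 1, c ≤ h u)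
    {s w : ℝ} (hs : s ∈ Icc (0 : ℝ) 1) (hw : 0 ≤ w) (hw' : w ≤ 1 / 2) {I : Set ℝ}
    (hI : ∀ u ∈ Icc (0 : ℝ) 1, |u - s| ≤ w → u ∈ I) : ENNReal.ofReal (c * w) ≤ designLaw h I := by
  -- An interval on one side of `s` is enough; the side is chosen to stay in `[0, 1]`.
  obtain ⟨a, ha, hJ⟩ : ∃ a, Icc a (a + w) ⊆ Icc (0 : ℝ) 1 ∧ ∀ u ∈ Icc a (a + w), |u - s| ≤ w := by
    rcases le_total s (1 / 2) with h1 | h1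
    · refine ⟨s, Icc_subset_Icc hs.1 (by linarith), fun u hu => ?_⟩
      rw [abs_le]; constructor <;> linarith [hu.1, hu.2]
    · refine ⟨s - w, Icc_subset_Icc (by linarith) (by linarith [hs.2]), fun u hu => ?_⟩
      rw [abs_le]; constructor <;> linarith [hu.1, hu.2]
  calc ENNReal.ofReal (c * w) = ENNReal.ofReal c * volume (Icc a (a + w)) := by
        rw [Real.volume_Icc, add_sub_cancel_left, ENNReal.ofReal_mul hc.le]
    _ = ∫⁻ _ in Icc a (a + w), ENNReal.ofReal c := by rw [setLIntegral_const]
    _ ≤ ∫⁻ u in Icc a (a + w), ENNReal.ofReal (h u) :=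
        setLIntegral_mono' measurableSet_Icc fun u hu => ENNReal.ofReal_le_ofReal (hh u (ha hu))
    _ = designLaw h (Icc a (a + w)) := by
        rw [designLaw, withDensity_apply _ measurableSet_Icc, Measure.restrict_restrict
          measurableSet_Icc, inter_eq_left.2 ha]
    _ ≤ designLaw h I := measure_mono fun u hu => hI u (ha hu) (hJ u hu)

section
variable {Ω : Type*} [MeasurableSpace Ω] {P : Measure Ω}

lemma ae_mem_Icc {h : ℝ → ℝ} {U : Ω → ℝ} (hU : Measurable U) (hlaw : P.map U = designLaw h) :
    ∀ᵐ ω ∂P, U ω ∈ Icc (0 : ℝ) 1 := by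
  rw [ae_iff]
  have : P {ω | ¬ U ω ∈ Icc (0 : ℝ) 1} = P.map U (Icc 0 1)ᶜ := by
    rw [Measure.map_apply hU measurableSet_Icc.compl]; rfl
  rw [this, hlaw, designLaw, withDensity_apply _ measurableSet_Icc.compl, Measure.restrict_restrict
    measurableSet_Icc.compl]
  simp

lemma ae_norm_le {σ β : ℝ} {φ : Plane → ℝ} (hφ : IsNoiseDensity σ β φ) {e : Ω → Plane}
    (he : Measurable e) (hlaw : P.map e = noiseLaw φ) : ∀ᵐ ω ∂P, ‖e ω‖ ≤ σ := by
  rw [ae_iff]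
  have hm : MeasurableSet {x : Plane | ¬ ‖x‖ ≤ σ} :=
    (measurableSet_le measurable_norm measurable_const).compl
  have : P {ω | ¬ ‖e ω‖ ≤ σ} = P.map e {x : Plane | ¬ ‖x‖ ≤ σ} := by
    rw [Measure.map_apply he hm]; rfl
  rw [this, hlaw, noiseLaw, withDensity_apply _ hm, setLIntegral_congr_fun hm
    (g := fun _ => 0) fun x hx => by
      simp only [hφ.eq_zero x (not_le.1 hx), ENNReal.ofReal_zero]]
  simp

/-- Lower bound for the probability that an observation falls into a small disc centred in the
tube. -/
lemma exists_prob_closedBall_ge [IsProbabilityMeasure P] {γ T : ℝ → Plane} {ℓ τ σ β : ℝ}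
    (hC : ClosedFrame γ T ℓ τ) (hσ : 0 < σ) (hστ : σ < τ) {h : ℝ → ℝ} (hh : IsDesignDensity h)
    {φ : Plane → ℝ} (hφ : IsNoiseDensity σ β φ) : ∃ c > 0, ∃ η > 0, ∀ δ, 0 < δ → δ < η →
      ∀ x, Metric.infDist x (range γ) ≤ σ → ∀ (U : Ω → ℝ) (e : Ω → Plane), Measurable U →
      Measurable e → P.map U = designLaw h → P.map e = noiseLaw φ → IndepFun U e P →
      ENNReal.ofReal (c * δ ^ (2 + (β + 1 / 2))) ≤
        P {ω | γ (U ω) + e ω ∈ Metric.closedBall x δ} := by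
  obtain ⟨c₁, c₂, hc₁, hb⟩ := hh.bounds
  obtain ⟨c, hc, η, hη, hnoise⟩ := hφ.exists_noiseLaw_closedBall_ge hσ
  have hℓ := hC.speed_pos
  have hF := hC.normalFrame
  have hτ := hC.radius_pos
  -- Chosen so that parameters within `κ * √δ` of the foot satisfy `‖γ u - γ s'‖ ^ 2 ≤ σ * δ / 4`.
  set κ := √σ / (2 * ℓ) with hκ
  have hκ0 : 0 < κ := by positivity
  have hκ2 : (ℓ * κ) ^ 2 = σ / 4 := by
    rw [hκ, show ℓ * (√σ / (2 * ℓ)) = √σ / 2 by field_simp, div_pow, Real.sq_sqrt hσ.le]; norm_num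
  refine ⟨c₁ * κ * c, by positivity, min η ((1 / (2 * κ)) ^ 2), by positivity,
    fun δ hδ hδη x hx U e hU he hUlaw helaw hind => ?_⟩
  obtain ⟨hδ1, hδ2⟩ := lt_min_iff.1 hδη
  have hsq : κ * √δ ≤ 1 / 2 := by
    have := (Real.sqrt_lt' (by positivity)).2 hδ2
    rw [lt_div_iff₀ (by positivity)] at this
    linarith
  obtain ⟨s, t, hxs, ht⟩ := hF.foot x
  rw [← periodic_comp_fract hC.periodic s, ← periodic_comp_fract hF.periodic_normal s] at hxs
  set s' := Int.fract s with hs'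
  have htσ : |t| ≤ σ := ht ▸ hx
  set I : Set ℝ := {u | ‖x - γ u‖ ≤ σ + δ / 4} with hI
  have hγc : Continuous γ := hF.continuous
  have hImeas : MeasurableSet I := by
    apply IsClosed.measurableSet
    exact isClosed_le (by fun_prop) continuous_const
  -- The source of the half power in `α`. By the disc condition `‖x - γ u‖ ^ 2` exceeds `t ^ 2` by
  -- at most `2 * ‖γ u - γ s'‖ ^ 2`, so a parameter interval of length of order `√δ` keeps `x`
  -- within `σ + δ / 4` of `γ u`.
  have hIge : ENNReal.ofReal (c₁ * (κ * √δ)) ≤ designLaw h I := by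
    refine designLaw_ge hc₁ (fun u hu => (hb u hu).1) (fract_mem_Icc s) (by positivity) hsq
      fun u _ hus => ?_
    have e1 : ‖γ u - γ s'‖ ^ 2 ≤ σ / 4 * δ := by
      have : ‖γ u - γ s'‖ ≤ ℓ * κ * √δ := by
        refine (hC.norm_sub_le s' u).trans ?_
        rw [mul_assoc]; exact mul_le_mul_of_nonneg_left hus hℓ.le
      have := pow_le_pow_left₀ (norm_nonneg _) this 2
      rwa [mul_pow, hκ2, Real.sq_sqrt hδ.le] at this
    have e2 := hF.disc s' u
    have e3 : |t * inner ℝ (perp (T s')) (γ u - γ s')| ≤ ‖γ u - γ s'‖ ^ 2 / 2 := by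
      rw [abs_mul]
      have : |t| * |inner ℝ (perp (T s')) (γ u - γ s')| ≤
          τ * |inner ℝ (perp (T s')) (γ u - γ s')| :=
        mul_le_mul_of_nonneg_right (by linarith) (abs_nonneg _)
      linarith
    have e4 := (abs_le.1 e3).1
    have e5 : t ^ 2 ≤ σ ^ 2 := sq_le_sq' (by linarith [(abs_le.1 htσ).1]) (abs_le.1 htσ).2
    show ‖x - γ u‖ ≤ σ + δ / 4
    rw [← sq_le_sq₀ (norm_nonneg _) (by positivity), hxs]
    have e6 := hF.norm_sq_add_smul_sub s' t (γ u)
    rw [e6]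
    nlinarith
  have hpush : P {ω | γ (U ω) + e ω ∈ Metric.closedBall x δ} =
      ∫⁻ u, noiseLaw φ (Metric.closedBall (x - γ u) δ) ∂designLaw h := by
    have hmeas : MeasurableSet {q : ℝ × Plane | γ q.1 + q.2 ∈ Metric.closedBall x δ} := by
      apply IsClosed.measurableSet
      exact Metric.isClosed_closedBall.preimage (by fun_prop)
    have hprod := (indepFun_iff_map_prod_eq_prod_map_map hU.aemeasurable he.aemeasurable).1 hind
    have : P {ω | γ (U ω) + e ω ∈ Metric.closedBall x δ} =
        P.map (fun ω => (U ω, e ω)) {q : ℝ × Plane | γ q.1 + q.2 ∈ Metric.closedBall x δ} := by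
      rw [Measure.map_apply (hU.prodMk he) hmeas]; rfl
    have i1 : IsProbabilityMeasure (P.map e) := Measure.isProbabilityMeasure_map he.aemeasurable
    rw [this, hprod, Measure.prod_apply hmeas, hUlaw, helaw]
    refine lintegral_congr fun u => ?_
    congr 1
    ext v
    simp only [mem_preimage, Set.mem_ofPred_eq, Metric.mem_closedBall, dist_eq_norm]
    rw [show γ u + v - x = v - (x - γ u) by abel]
  rw [hpush]
  calc ENNReal.ofReal (c₁ * κ * c * δ ^ (2 + (β + 1 / 2)))
      = ENNReal.ofReal (c * δ ^ (2 + β)) * ENNReal.ofReal (c₁ * (κ * √δ)) := by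
        rw [← ENNReal.ofReal_mul (by positivity)]
        congr 1
        rw [← add_assoc, Real.rpow_add hδ, ← Real.sqrt_eq_rpow]; ring
    _ ≤ ENNReal.ofReal (c * δ ^ (2 + β)) * designLaw h I := by gcongr
    _ = ∫⁻ _ in I, ENNReal.ofReal (c * δ ^ (2 + β)) ∂designLaw h := by rw [setLIntegral_const]
    _ ≤ ∫⁻ u in I, noiseLaw φ (Metric.closedBall (x - γ u) δ) ∂designLaw h :=
        setLIntegral_mono' hImeas fun u hu => hnoise δ hδ hδ1 _ hu
    _ ≤ ∫⁻ u, noiseLaw φ (Metric.closedBall (x - γ u) δ) ∂designLaw h := setLIntegral_le_lintegral _ _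

/-- The probability that none of the first `n` observations falls into a given disc. -/
lemma prob_forall_notMem_le [IsProbabilityMeasure P] {γ : ℝ → Plane} (hγ : Continuous γ)
    {U : ℕ → Ω → ℝ} {e : ℕ → Ω → Plane} (hU : ∀ i, Measurable (U i)) (he : ∀ i, Measurable (e i))
    (hind : iIndepFun (fun i ω => (U i ω, e i ω)) P) {x : Plane} {δ q : ℝ}
    (hq : ∀ i, ENNReal.ofReal q ≤ P {ω | γ (U i ω) + e i ω ∈ Metric.closedBall x δ}) (n : ℕ) :
    P {ω | ∀ i < n, γ (U i ω) + e i ω ∉ Metric.closedBall x δ} ≤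
      ENNReal.ofReal (Real.exp (-(n * q))) := by
  set A : Set (ℝ × Plane) := {z | γ z.1 + z.2 ∈ Metric.closedBall x δ} with hA
  have hAm : MeasurableSet A := by
    apply IsClosed.measurableSet
    exact Metric.isClosed_closedBall.preimage (by fun_prop)
  have hm : ∀ i, Measurable fun ω => (U i ω, e i ω) := fun i => (hU i).prodMk (he i)
  have hset : {ω | ∀ i < n, γ (U i ω) + e i ω ∉ Metric.closedBall x δ} =
      ⋂ i ∈ Finset.range n, (fun ω => (U i ω, e i ω)) ⁻¹' Aᶜ := by
    ext ω; simp [hA]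
  rw [hset, hind.measure_inter_preimage_eq_mul (Finset.range n) (fun i _ => hAm.compl)]
  have hone : ∀ i ∈ Finset.range n, P ((fun ω => (U i ω, e i ω)) ⁻¹' Aᶜ) ≤
      ENNReal.ofReal (Real.exp (-q)) := by
    intro i _
    have h1 : (fun ω => (U i ω, e i ω)) ⁻¹' Aᶜ = ((fun ω => (U i ω, e i ω)) ⁻¹' A)ᶜ := rfl
    rw [h1, prob_compl_eq_one_sub ((hm i) hAm)]
    calc 1 - P ((fun ω => (U i ω, e i ω)) ⁻¹' A) ≤ 1 - ENNReal.ofReal q :=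
          tsub_le_tsub_left (hq i) _
      _ ≤ ENNReal.ofReal (Real.exp (-q)) := by
        rw [tsub_le_iff_right, ← ENNReal.ofReal_one]
        refine le_trans ?_ (ENNReal.ofReal_add_le)
        exact ENNReal.ofReal_le_ofReal (by linarith [Real.add_one_le_exp (-q)])
  refine (Finset.prod_le_pow_card _ _ _ hone).trans ?_
  rw [Finset.card_range, ← ENNReal.ofReal_pow (Real.exp_pos _).le, ← Real.exp_nat_mul]
  exact ENNReal.ofReal_le_ofReal (by rw [mul_neg])

end

/-! ### Nets -/

/-- A bounded set in the plane has `δ`-nets of cardinality `O(δ⁻²)`. -/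
lemma exists_net {S : Set Plane} (hS : Bornology.IsBounded S) : ∃ K > 0, ∀ δ, 0 < δ → δ ≤ 1 →
    ∃ A : Finset Plane, (∀ y ∈ A, y ∈ S) ∧ (A.card : ℝ) ≤ K / δ ^ 2 ∧
      ∀ x ∈ S, ∃ y ∈ A, dist x y ≤ δ := by
  classical
  obtain ⟨R, hR0, hR⟩ := hS.exists_pos_norm_le
  refine ⟨(4 * R + 5) ^ 2, by positivity, fun δ hδ hδ1 => ?_⟩
  set m : ℕ := ⌈2 * R / δ⌉₊ with hm
  have hmR : 2 * R / δ ≤ m := Nat.le_ceil _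
  have hm' : (m : ℝ) < 2 * R / δ + 1 := Nat.ceil_lt_add_one (by positivity)
  -- Grid cells of side `δ / 2`, with one representative from `S` for each occupied cell: the net
  -- must lie in `S` because the small-ball bound is available only for centres in the tube.
  set cell : Plane → ℤ × ℤ := fun x => (⌊x 0 / (δ / 2)⌋, ⌊x 1 / (δ / 2)⌋) with hcell
  set Q : Finset (ℤ × ℤ) := Finset.Icc (-(m : ℤ)) m ×ˢ Finset.Icc (-(m : ℤ)) m with hQ
  have hcoord : ∀ x : Plane, ∀ i, |x i| ≤ ‖x‖ := fun x i => by
    simpa using PiLp.norm_apply_le x i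
  have hfl : ∀ x ∈ S, ∀ i, ⌊x i / (δ / 2)⌋ ∈ Finset.Icc (-(m : ℤ)) m := by
    intro x hx i
    have h1 := abs_le.1 ((hcoord x i).trans (hR x hx))
    have h2 : 2 * R / δ = R / (δ / 2) := by field_simp
    have h3 : x i / (δ / 2) ≤ m := by
      refine le_trans ?_ hmR
      rw [h2]; exact div_le_div_of_nonneg_right h1.2 (by positivity)
    have h4 : -(m : ℝ) ≤ x i / (δ / 2) := by
      rw [neg_le, ← neg_div]
      refine le_trans ?_ hmR
      rw [h2]; exact div_le_div_of_nonneg_right (by linarith [h1.1]) (by positivity)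
    rw [Finset.mem_Icc]
    constructor
    · rw [Int.le_floor]; push_cast; exact h4
    · have : ((⌊x i / (δ / 2)⌋ : ℤ) : ℝ) ≤ ((m : ℤ) : ℝ) := by
        push_cast; exact (Int.floor_le (x i / (δ / 2))).trans h3
      exact Int.cast_le.1 this
  have hrep : ∀ q : ℤ × ℤ, ∃ y, (∃ x ∈ S, cell x = q) → y ∈ S ∧ cell y = q := fun q => by
    by_cases hq : ∃ x ∈ S, cell x = q
    · obtain ⟨x, hx, hxq⟩ := hq
      exact ⟨x, fun _ => ⟨hx, hxq⟩⟩
    · exact ⟨0, fun h => absurd h hq⟩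
  choose rep hrep using hrep
  refine ⟨(Q.filter fun q => ∃ x ∈ S, cell x = q).image rep, ?_, ?_, ?_⟩
  · intro y hy
    obtain ⟨q, hq, rfl⟩ := Finset.mem_image.1 hy
    exact (hrep q (Finset.mem_filter.1 hq).2).1
  · have h1 : ((Q.filter fun q => ∃ x ∈ S, cell x = q).image rep).card ≤ (2 * m + 1) ^ 2 := by
      refine Finset.card_image_le.trans ((Finset.card_filter_le _ _).trans ?_)
      rw [hQ, Finset.card_product, Int.card_Icc, sq]
      apply le_of_eq
      congr 1 <;> omega
    calc ((((Q.filter fun q => ∃ x ∈ S, cell x = q).image rep).card : ℕ) : ℝ)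
        ≤ (2 * m + 1 : ℝ) ^ 2 := by exact_mod_cast h1
      _ ≤ ((4 * R + 5) / δ) ^ 2 := by
        apply pow_le_pow_left₀ (by positivity)
        rw [le_div_iff₀ hδ]
        have : 2 * R / δ * δ = 2 * R := div_mul_cancel₀ _ hδ.ne'
        nlinarith
      _ = _ := by rw [div_pow]
  · intro x hx
    have hc := hrep (cell x) ⟨x, hx, rfl⟩
    refine ⟨rep (cell x), Finset.mem_image_of_mem _ (Finset.mem_filter.2
      ⟨Finset.mem_product.2 ⟨hfl x hx 0, hfl x hx 1⟩, x, hx, rfl⟩), ?_⟩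
    obtain ⟨-, hc2⟩ := hc
    simp only [hcell, Prod.mk.injEq] at hc2
    set y := rep (cell x)
    have key : ∀ i, ⌊y i / (δ / 2)⌋ = ⌊x i / (δ / 2)⌋ → (x i - y i) ^ 2 ≤ (δ / 2) ^ 2 := by
      intro i hi
      have h1 := Int.abs_sub_lt_one_of_floor_eq_floor hi.symm
      rw [← sub_div, abs_div, abs_of_pos (show 0 < δ / 2 by positivity),
        div_lt_one (by positivity)] at h1
      rw [← sq_abs]; exact pow_le_pow_left₀ (abs_nonneg _) h1.le 2
    rw [dist_eq_norm, ← sq_le_sq₀ (norm_nonneg _) hδ.le, norm_sq_eq]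
    have h0 := key 0 hc2.1
    have h1 := key 1 hc2.2
    simp only [PiLp.sub_apply]
    nlinarith

/-! ### Covering by the observations -/

lemma tendsto_rate {β : ℝ} (hβ : 0 ≤ β) : Tendsto (rate β) atTop (𝓝 0) := by
  have h1 : Tendsto (fun n : ℕ => Real.log n / n) atTop (𝓝 0) :=
    (Real.isLittleO_log_id_atTop.tendsto_div_nhds_zero).comp tendsto_natCast_atTop_atTop
  have hp : 0 < 1 / (2 + (β + 1 / 2)) := by positivity
  have h2 := h1.rpow_const (p := 1 / (2 + (β + 1 / 2))) (Or.inr hp.le)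
  rwa [Real.zero_rpow hp.ne'] at h2

lemma one_le_log_natCast {n : ℕ} (hn : 3 ≤ n) : 1 ≤ Real.log n := by
  have h3 : (3 : ℝ) ≤ n := by exact_mod_cast hn
  rw [Real.le_log_iff_exp_le (by linarith)]
  linarith [Real.exp_one_lt_d9]

lemma rate_pos (β : ℝ) {n : ℕ} (hn : 3 ≤ n) : 0 < rate β n := by
  have := one_le_log_natCast hn
  have : (0 : ℝ) < n := by exact_mod_cast (by omega : 0 < n)
  unfold rate; positivity

lemma rate_rpow {β : ℝ} (hβ : 0 ≤ β) {n : ℕ} (hn : 3 ≤ n) :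
    rate β n ^ (2 + (β + 1 / 2)) = Real.log n / n := by
  have := one_le_log_natCast hn
  rw [rate, ← Real.rpow_mul (by positivity), one_div_mul_cancel (by positivity), Real.rpow_one]

/-- Bounds the cardinality of the net, of order `δ⁻²`, by a multiple of `n`. -/
lemma one_div_le_rate_sq {β : ℝ} (hβ : 0 ≤ β) {n : ℕ} (hn : 3 ≤ n) :
    1 / (n : ℝ) ≤ rate β n ^ 2 := by
  have hlog := one_le_log_natCast hn
  have hn0 : (0 : ℝ) < n := by exact_mod_cast (by omega : 0 < n)
  have hx1 : Real.log n / n ≤ 1 := by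
    rw [div_le_one hn0]; linarith [Real.log_le_sub_one_of_pos hn0]
  rw [rate, ← Real.rpow_natCast, ← Real.rpow_mul (by positivity)]
  calc 1 / (n : ℝ) ≤ Real.log n / n := by gcongr
    _ = (Real.log n / n) ^ (1 : ℝ) := (Real.rpow_one _).symm
    _ ≤ _ := by
      refine Real.rpow_le_rpow_of_exponent_ge (by positivity) hx1 ?_
      rw [one_div_mul_eq_div, div_le_one (by positivity)]
      push_cast; linarith

section
variable {Ω : Type*}

/-- Some point of the tube of radius `σ` about the curve has no observation within `ρ`. -/
def uncovered (γ : ℝ → Plane) (σ : ℝ) (U : ℕ → Ω → ℝ) (e : ℕ → Ω → Plane) (n : ℕ) (ρ : ℝ) :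
    Set Ω :=
  {ω | ∃ x, Metric.infDist x (range γ) ≤ σ ∧ ∀ i < n, ρ < dist x (observation γ U e i ω)}

lemma ClosedFrame.isBounded_tube {γ T : ℝ → Plane} {ℓ τ : ℝ} (hC : ClosedFrame γ T ℓ τ) (σ : ℝ) :
    Bornology.IsBounded {x | Metric.infDist x (range γ) ≤ σ} := by
  have hK := hC.normalFrame.isCompact_range
  refine (hK.isBounded.cthickening (δ := σ)).subset fun x hx => ?_
  obtain ⟨y, hy, hd⟩ := hK.exists_infDist_eq_dist (range_nonempty γ) x
  exact Metric.mem_cthickening_of_dist_le x y σ _ hy (hd ▸ hx)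

/-- If the observations are as they should be, they form a sample. -/
lemma sample_of_notMem_uncovered {γ T : ℝ → Plane} {ℓ τ σ ρ : ℝ} (hC : ClosedFrame γ T ℓ τ)
    {U : ℕ → Ω → ℝ} {e : ℕ → Ω → Plane} {n : ℕ} {ω : Ω} (he : ∀ i, ‖e i ω‖ ≤ σ) (hρ : 0 < ρ)
    (hρσ : ρ ≤ σ) (hsmall : 16 * ρ ≤ τ - σ) (hcov : ω ∉ uncovered γ σ U e n (ρ / 2)) :
    Sample γ (fun s => perp (T s)) τ σ ρ
      ((Finset.range n).image fun i => observation γ U e i ω) where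
  frame := hC.normalFrame
  pos := hρ
  le := hρσ
  small := hsmall
  subset c hc := by
    obtain ⟨i, -, rfl⟩ := Finset.mem_image.1 hc
    refine (Metric.infDist_le_dist_of_mem (mem_range_self (U i ω))).trans ?_
    rw [observation, dist_self_add_left]
    exact he i
  dense x hx := by
    by_contra! hne
    exact hcov ⟨x, hx, fun i hi => hne _ (Finset.mem_image_of_mem _ (Finset.mem_range.2 hi))⟩

variable [MeasurableSpace Ω] {P : Measure Ω}

/-- With a large enough constant, the observations cover the tube with high probability. -/
lemma exists_prob_uncovered_le [IsProbabilityMeasure P] {γ T : ℝ → Plane} {ℓ τ σ β : ℝ}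
    (hC : ClosedFrame γ T ℓ τ) (hσ : 0 < σ) (hστ : σ < τ) (hβ : 0 ≤ β) {h : ℝ → ℝ}
    (hh : IsDesignDensity h) {φ : Plane → ℝ} (hφ : IsNoiseDensity σ β φ) {U : ℕ → Ω → ℝ}
    {e : ℕ → Ω → Plane} (hU : ∀ i, Measurable (U i)) (he : ∀ i, Measurable (e i))
    (hUlaw : ∀ i, P.map (U i) = designLaw h) (helaw : ∀ i, P.map (e i) = noiseLaw φ)
    (hUe : ∀ i, IndepFun (U i) (e i) P) (hind : iIndepFun (fun i ω => (U i ω, e i ω)) P) :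
    ∃ C₀ > 0, ∃ K > 0, ∀ C, C₀ ≤ C → ∀ᶠ n : ℕ in atTop,
      P (uncovered γ σ U e n (C * rate β n / 2)) ≤ ENNReal.ofReal (K / n ^ 2) := by
  obtain ⟨c, hc, η, hη, hball⟩ := exists_prob_closedBall_ge (P := P) hC hσ hστ hh hφ
  obtain ⟨K, hK, hnet⟩ := exists_net (hC.isBounded_tube σ)
  -- With `a = C / 4` and `δ = a * rate β n`, the bound `a ≥ 3 / c` makes each net disc empty with
  -- probability at most `n⁻³`, and `a ≥ 1` gives both `a ≤ a ^ p` and a net of at most `K * n`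
  -- points.
  refine ⟨4 * max 1 (3 / c), by positivity, K, hK, fun C hC₀ => ?_⟩
  set a := C / 4 with ha
  have hmax : max 1 (3 / c) ≤ a := by rw [ha]; linarith
  have ha1 : 1 ≤ a := (le_max_left _ _).trans hmax
  have ha2 : 3 ≤ a * c := (div_le_iff₀ hc).1 ((le_max_right _ _).trans hmax)
  have hlim : Tendsto (fun n => a * rate β n) atTop (𝓝 0) := by
    simpa using (tendsto_rate hβ).const_mul a
  filter_upwards [hlim.eventually_lt_const hη, hlim.eventually_lt_const one_pos,
    eventually_ge_atTop 3] with n hn1 hn2 hn3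
  have hr := rate_pos β hn3
  have hn0 : (0 : ℝ) < n := by exact_mod_cast (by omega : 0 < n)
  set δ := a * rate β n with hδ
  have hδ0 : 0 < δ := by positivity
  set p := 2 + (β + 1 / 2) with hp
  have hq : 3 * Real.log n ≤ n * (c * δ ^ p) := by
    have hlog := one_le_log_natCast hn3
    have h1 : a ≤ a ^ p := by
      nth_rewrite 1 [← Real.rpow_one a]
      exact Real.rpow_le_rpow_of_exponent_le ha1 (by linarith)
    rw [hδ, Real.mul_rpow (by linarith) hr.le, rate_rpow hβ hn3]
    calc 3 * Real.log n ≤ a * c * Real.log n := by gcongr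
      _ ≤ a ^ p * c * Real.log n := by gcongr
      _ = n * (c * (a ^ p * (Real.log n / n))) := by field_simp
  obtain ⟨A, hAS, hcard, hA⟩ := hnet δ hδ0 hn2.le
  have hγ := hC.normalFrame.continuous
  have hsub : uncovered γ σ U e n (C * rate β n / 2) ⊆
      ⋃ y ∈ A, {ω | ∀ i < n, γ (U i ω) + e i ω ∉ Metric.closedBall y δ} := by
    -- The covering radius is `2 * δ`: one `δ` from the point to the net, one from the net point to
    -- an observation.
    rintro ω ⟨x, hx, hfar⟩
    obtain ⟨y, hy, hxy⟩ := hA x hx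
    refine mem_iUnion₂.2 ⟨y, hy, fun i hi hmem => ?_⟩
    rw [Metric.mem_closedBall] at hmem
    have h1 := hfar i hi
    rw [observation] at h1
    have h2 := dist_triangle_right x (γ (U i ω) + e i ω) y
    have h3 : C * rate β n / 2 = 2 * δ := by rw [hδ, ha]; ring
    linarith
  have hone : ∀ y ∈ A, P {ω | ∀ i < n, γ (U i ω) + e i ω ∉ Metric.closedBall y δ} ≤
      ENNReal.ofReal (Real.exp (-(3 * Real.log n))) := fun y hy =>
    (prob_forall_notMem_le hγ hU he hind (fun i => hball δ hδ0 hn1 y (hAS y hy) _ _ (hU i) (he i)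
      (hUlaw i) (helaw i) (hUe i)) n).trans
      (ENNReal.ofReal_le_ofReal (Real.exp_le_exp.2 (neg_le_neg hq)))
  calc P (uncovered γ σ U e n (C * rate β n / 2))
      ≤ ∑ y ∈ A, P {ω | ∀ i < n, γ (U i ω) + e i ω ∉ Metric.closedBall y δ} :=
        (measure_mono hsub).trans (measure_biUnion_finset_le _ _)
    _ ≤ A.card • ENNReal.ofReal (Real.exp (-(3 * Real.log n))) := Finset.sum_le_card_nsmul _ _ _ hone
    _ = ENNReal.ofReal (A.card * Real.exp (-(3 * Real.log n))) := by
        rw [nsmul_eq_mul, ENNReal.ofReal_mul (Nat.cast_nonneg _), ENNReal.ofReal_natCast]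
    _ ≤ ENNReal.ofReal (K / n ^ 2) := by
        refine ENNReal.ofReal_le_ofReal ?_
        have h1 : Real.exp (-(3 * Real.log n)) = 1 / (n : ℝ) ^ 3 := by
          rw [Real.exp_neg, mul_comm, Real.exp_mul, Real.exp_log hn0, one_div]
          norm_cast
        have h2 : 1 / (n : ℝ) ≤ δ ^ 2 := by
          refine (one_div_le_rate_sq hβ hn3).trans (pow_le_pow_left₀ hr.le ?_ 2)
          exact le_mul_of_one_le_left hr.le ha1
        have h3 : (A.card : ℝ) ≤ K * n := by
          refine hcard.trans ?_
          rw [div_le_iff₀ (by positivity)]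
          rw [div_le_iff₀ hn0] at h2
          nlinarith
        rw [h1]
        calc (A.card : ℝ) * (1 / (n : ℝ) ^ 3) ≤ K * n * (1 / (n : ℝ) ^ 3) := by gcongr
          _ = K / n ^ 2 := by field_simp

lemma unionOfBalls_eq (y : ℕ → Plane) (n : ℕ) (ρ : ℝ) :
    unionOfBalls y n ρ = ⋃ c ∈ (Finset.range n).image y, Metric.closedBall c ρ := by
  rw [unionOfBalls, Finset.set_biUnion_finset_image]

end
end Filament

/-! ### Assembly of the theorem -/

theorem mainTheorem5 {Ω : Type*} [MeasurableSpace Ω] (P : Measure Ω) [IsProbabilityMeasure P]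
    (f : ℝ → Filament.Plane) (hf : Filament.IsSimpleClosedCurve f)
    (hf_arc : Filament.IsArclengthParametrized f)
    (σ β : ℝ) (hσ : 0 < σ) (hβ : 0 ≤ β)
    (hσ_thick : ENNReal.ofReal σ < Filament.thickness (Filament.trace f))
    (h : ℝ → ℝ) (hh : Filament.IsDesignDensity h)
    (φ : Filament.Plane → ℝ) (hφ : Filament.IsNoiseDensity σ β φ)
    (U : ℕ → Ω → ℝ) (ε : ℕ → Ω → Filament.Plane)
    (hU : ∀ i, Measurable (U i)) (hε : ∀ i, Measurable (ε i))
    (hU_law : ∀ i, P.map (U i) = Filament.designLaw h)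
    (hε_law : ∀ i, P.map (ε i) = Filament.noiseLaw φ)
    (hUε : ∀ i, IndepFun (U i) (ε i) P)
    (h_indep : iIndepFun (fun i ω => (U i ω, ε i ω)) P) :
    ∃ C₀ : ℝ, 0 < C₀ ∧ ∀ C : ℝ, C₀ ≤ C →
      ∀ S_hat : ℕ → Ω → Set Filament.Plane,
      (∀ n ω, S_hat n ω = Filament.unionOfBalls
        (fun i => Filament.observation f U ε i ω) n (C * Filament.rate β n)) →
      (∀ᵐ ω ∂P, ∀ᶠ n in atTop,
        (∃ f_hat, Filament.IsMedialFit (S_hat n ω) f_hat) ∧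
        ∀ f_hat, Filament.IsMedialFit (S_hat n ω) f_hat →
          Filament.IsPiecewiseContinuous f_hat ∧
          (∃ f_star, Filament.IsCompletion f_hat f_star) ∧
          ∀ f_star, Filament.IsCompletion f_hat f_star →
            Filament.IsSimpleClosedCurve f_star) ∧
      Filament.IsBigOP P
        (fun n ω => ⨆ f_star ∈ Filament.completedMedialEstimators (S_hat n ω),
          Metric.hausdorffEDist (Filament.trace f_star) (Filament.trace f))
        (Filament.rate β) := by

  open Filament in
  obtain ⟨τ, hτ0, hστ', hτ⟩ := ENNReal.lt_iff_exists_real_btwn.1 hσ_thick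
  have hστ : σ < τ := (ENNReal.ofReal_lt_ofReal_iff_of_nonneg hσ.le).1 hστ'
  obtain ⟨T₀, ℓ, hT⟩ := exists_unitTangent hf hf_arc (hσ.trans hστ) hτ.le
  have hC := hT.closedFrame
  obtain ⟨w, hw0, hw⟩ := hC.exists_inner_tangent_ge
  have hrange := range_comp_fract hf.closed
  set γ : ℝ → Plane := fun s => f (Int.fract s) with hγ
  set T : ℝ → Plane := fun s => T₀ (Int.fract s)
  have hℓ := hC.speed_pos
  obtain ⟨C₀, hC₀, K, hK, hbound⟩ :=
    exists_prob_uncovered_le (P := P) hC hσ hστ hβ hh hφ hU hε hU_law hε_law hUε h_indep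
  refine ⟨C₀, hC₀, fun C hCC S_hat hS => ?_⟩
  have hCpos : 0 < C := hC₀.trans_le hCC
  have hae : ∀ᵐ ω ∂P, (∀ i, U i ω ∈ Icc (0 : ℝ) 1) ∧ ∀ i, ‖ε i ω‖ ≤ σ :=
    (ae_all_iff.2 fun i => ae_mem_Icc (hU i) (hU_law i)).and
      (ae_all_iff.2 fun i => ae_norm_le hφ (hε i) (hε_law i))
  have hlim : Tendsto (fun n => C * rate β n) atTop (𝓝 0) := by
    simpa using (tendsto_rate hβ).const_mul C
  have hlim' : ∀ a b : ℝ, 0 < b → ∀ᶠ n in atTop, a * (C * rate β n) < b := fun a b hb => by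
    have : Tendsto (fun n => a * (C * rate β n)) atTop (𝓝 0) := by simpa using hlim.const_mul a
    exact this.eventually_lt_const hb
  have hsmall : ∀ᶠ n : ℕ in atTop, 0 < C * rate β n ∧ C * rate β n ≤ σ ∧
      16 * (C * rate β n) ≤ τ - σ ∧ Sample.devConst τ σ * (C * rate β n) ≤ τ ^ 2 ∧
      2 * (Sample.devConst τ σ + σ) * (C * rate β n) ≤ (w * ℓ / 2) ^ 2 := by
    filter_upwards [eventually_ge_atTop 3, hlim' 1 σ hσ, hlim' 16 (τ - σ) (by linarith),
      hlim' (Sample.devConst τ σ) (τ ^ 2) (by have := hC.radius_pos; positivity),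
      hlim' (2 * (Sample.devConst τ σ + σ)) ((w * ℓ / 2) ^ 2) (by positivity)] with n h3 h4 h5 h6 h7
    exact ⟨mul_pos hCpos (rate_pos β h3), by linarith, h5.le, h6.le, h7.le⟩
  -- Outside `[0, 1]` the function `f` is arbitrary; it may be replaced by its periodic extension
  -- only where the design points lie in the unit interval, which holds almost surely.
  have hobs : ∀ ω, (∀ i, U i ω ∈ Icc (0 : ℝ) 1) → ∀ n, S_hat n ω =
      ⋃ c ∈ (Finset.range n).image fun i => observation γ U ε i ω,
        Metric.closedBall c (C * rate β n) := by
    intro ω hω n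
    rw [hS, ← unionOfBalls_eq]
    congr 1
    funext i
    have : f (Int.fract (U i ω)) = f (U i ω) := by
      simpa using comp_fract_eq_on_Icc hf.closed 0 (s := U i ω) (by simpa using hω i)
    simp only [observation, hγ, this]
  constructor
  · have hBC : ∀ᵐ ω ∂P, ∀ᶠ n in atTop, ω ∉ uncovered γ σ U ε n (C * rate β n / 2) := by
      obtain ⟨n₀, hn₀⟩ := eventually_atTop.1 (hbound C hCC)
      -- The probability bound holds only from `n₀` on, so earlier events are replaced by `∅` before
      -- Borel–Cantelli is applied.
      have hsum : ∑' n, P (if n₀ ≤ n then uncovered γ σ U ε n (C * rate β n / 2) else ∅) ≠ ∞ := by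
        have hs : Summable fun n : ℕ => K / (n : ℝ) ^ 2 := by
          simpa [div_eq_mul_inv] using (Real.summable_nat_pow_inv.2 one_lt_two).mul_left K
        refine ne_top_of_le_ne_top (hs.tsum_ofReal_ne_top) (ENNReal.tsum_le_tsum fun n => ?_)
        split_ifs with hn
        · exact hn₀ n hn
        · simp
      filter_upwards [ae_eventually_notMem hsum] with ω hω
      filter_upwards [hω, eventually_ge_atTop n₀] with n hn hn'
      rwa [if_pos hn'] at hn
    filter_upwards [hae, hBC] with ω hω hcov
    filter_upwards [hcov, hsmall] with n hn hs
    have hsample := sample_of_notMem_uncovered hC hω.2 hs.1 hs.2.1 hs.2.2.1 hn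
    rw [hobs ω hω.1]
    exact ⟨hsample.exists_isMedialFit, fun F hF => hsample.medialFit_properties hF⟩
  · intro η hη
    -- The same constant works for every `η`: whenever the tube is covered the bound is
    -- deterministic. The maximum with `1` only ensures positivity.
    refine ⟨max 1 (Sample.fitConst τ σ * C), by positivity, ?_⟩
    have hKη : ∀ᶠ n : ℕ in atTop, K / (n : ℝ) ^ 2 < η := by
      have : Tendsto (fun n : ℕ => K / (n : ℝ) ^ 2) atTop (𝓝 0) :=
        tendsto_const_nhds.div_atTop
          ((tendsto_pow_atTop two_ne_zero).comp tendsto_natCast_atTop_atTop)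
      exact this.eventually_lt_const hη
    filter_upwards [hbound C hCC, hsmall, hKη] with n hn hs hnη
    refine le_trans ?_ (hn.trans (ENNReal.ofReal_le_ofReal hnη.le))
    refine measure_mono_ae ?_
    filter_upwards [hae] with ω hω hlt
    by_contra hcov
    have hsample := sample_of_notMem_uncovered hC hω.2 hs.1 hs.2.1 hs.2.2.1 hcov
    have hle := hsample.iSup_hausdorffEDist_le hC hw hw0 hs.2.2.2.1 hs.2.2.2.2
    rw [← hobs ω hω.1, hrange] at hle
    refine absurd hlt (not_lt.2 (hle.trans (ENNReal.ofReal_le_ofReal ?_)))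
    rw [← mul_assoc]
    exact mul_le_mul_of_nonneg_right (le_max_right _ _)
      (pos_of_mul_pos_right hs.1 hCpos.le).le
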